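/- Manifolds are smooth, Hausdorff, finite-dimensional and without boundary. A pseudo-Riemannian manifold $(M,g)$ carries a smooth field $g$ of symmetric nondegenerate bilinear forms (of arbitrary signature) on its tangent spaces; geodesics are those of the Levi-Civita connection $\nabla$. $(M,g)$ is called geodesic orbit (GO) if every maximal geodesic $\gamma:J\to M$ is an orbit of a one-parameter group of isometries of $(M,g)$, i.e. there are a one-parameter group $(\varphi_t)_{t\in\mathbb R}$ of isometries of $(M,g)$ and a diffeomorphism $l:\mathbb R\to J$ with $\gamma(l(t))=\varphi_t(\gamma(l(0)))$ for all $t\in\mathbb R$. A pseudo-Riemannian submanifold of $(M,g)$ is a (possibly only immersed) submanifold $N$ on which $g$ induces a nondegenerate metric; it is totally geodesic if its second fundamental form, the normal component of $\nabla_V W$ for $V,W$ tangent to $N$, vanishes. **Theorem.** Let $(M,g)$ be a geodesic orbit pseudo-Riemannian manifold and let $N$ be a totally geodesic pseudo-Riemannian submanifold of $(M,g)$ which, with the induced metric, is geodesically complete (every geodesic of $N$ extends to a geodesic defined on all of $\mathbb R$). Then $N$ with the induced metric is itself a geodesic orbit pseudo-Riemannian manifold. -/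

import Mathlib

open Set Bundle
open scoped Manifold ContDiff

noncomputable section

/-- A smooth pseudo-Riemannian metric on a boundaryless manifold `M` modelled on `E`: a smooth field
of symmetric nondegenerate bilinear forms, of arbitrary signature, on the tangent spaces. -/
structure PseudoRiemannianMetric (E : Type*) [NormedAddCommGroup E] [NormedSpace ℝ E]
    (M : Type*) [TopologicalSpace M] [ChartedSpace E M] [IsManifold 𝓘(ℝ, E) ∞ M] where
  /-- The scalar product on each tangent space. -/
  inner (x : M) : TangentSpace 𝓘(ℝ, E) x →L[ℝ] TangentSpace 𝓘(ℝ, E) x →L[ℝ] ℝ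
  symm (x : M) (v w : TangentSpace 𝓘(ℝ, E) x) : inner x v w = inner x w v
  nondegenerate (x : M) (v : TangentSpace 𝓘(ℝ, E) x) : (∀ w, inner x v w = 0) → v = 0
  contMDiff : ContMDiff 𝓘(ℝ, E) (𝓘(ℝ, E).prod 𝓘(ℝ, E →L[ℝ] E →L[ℝ] ℝ)) ∞
    (fun x ↦ TotalSpace.mk' (E →L[ℝ] E →L[ℝ] ℝ) x (inner x))

namespace PseudoRiemannianMetric

section Intrinsic

variable {E : Type*} [NormedAddCommGroup E] [NormedSpace ℝ E]
  {M : Type*} [TopologicalSpace M] [ChartedSpace E M] [IsManifold 𝓘(ℝ, E) ∞ M]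
  (g : PseudoRiemannianMetric E M)

/-- The component `g(v, w)` of the metric, as a function of the coordinates `y` in the preferred
chart at `x₀`; here `v, w : E` are regarded as constant coordinate vector fields. -/
def inChart (x₀ : M) (v w : E) (y : E) : ℝ :=
  g.inner ((extChartAt 𝓘(ℝ, E) x₀).symm y)
    (mfderiv 𝓘(ℝ, E) 𝓘(ℝ, E) (extChartAt 𝓘(ℝ, E) x₀).symm y v)
    (mfderiv 𝓘(ℝ, E) 𝓘(ℝ, E) (extChartAt 𝓘(ℝ, E) x₀).symm y w)

/-- The Christoffel symbol of the first kind of the Levi-Civita connection in the preferred chart at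
`x₀`: the number `g(∇_u v, w)` at the point with coordinates `y`, where `u, v, w : E` are regarded
as constant coordinate vector fields (Koszul formula). -/
def christoffel (x₀ : M) (y u v w : E) : ℝ :=
  (fderiv ℝ (g.inChart x₀ v w) y u + fderiv ℝ (g.inChart x₀ u w) y v
    - fderiv ℝ (g.inChart x₀ u v) y w) / 2

/-- `γ` is a geodesic on the set of times `J` (used for open intervals `J`): it is smooth there and
`g(∇_{γ'} γ', w) = 0` for all `w`, that is `∇_{γ'} γ' = 0`. This equation does not depend on
the coordinates; at time `t` it is written in the preferred chart at `γ t`. -/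
def IsGeodesicOn (γ : ℝ → M) (J : Set ℝ) : Prop :=
  ContMDiffOn 𝓘(ℝ, ℝ) 𝓘(ℝ, E) ∞ γ J ∧
  ∀ t ∈ J, ∀ w : E,
    let c : ℝ → E := fun s ↦ extChartAt 𝓘(ℝ, E) (γ t) (γ s)
    g.inChart (γ t) (deriv (deriv c) t) w (c t)
      + g.christoffel (γ t) (c t) (deriv c t) (deriv c t) w = 0

/-- `γ` restricted to the open interval `J` is a maximal geodesic: it cannot be extended to a
geodesic on a larger open interval. The values of `γ` outside `J` are irrelevant. -/
structure IsMaximalGeodesic (γ : ℝ → M) (J : Set ℝ) : Prop where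
  isOpen : IsOpen J
  ordConnected : J.OrdConnected
  nonempty : J.Nonempty
  isGeodesicOn : g.IsGeodesicOn γ J
  maximal : ∀ (γ' : ℝ → M) (J' : Set ℝ), IsOpen J' → J'.OrdConnected → J ⊆ J' →
    g.IsGeodesicOn γ' J' → EqOn γ γ' J → J' = J

/-- Geodesic completeness: each tangent vector is the velocity at time `0` of a geodesic that is
defined for all times. -/
def IsGeodesicallyComplete : Prop :=
  ∀ (x : M) (u : TangentSpace 𝓘(ℝ, E) x), ∃ γ : ℝ → M, g.IsGeodesicOn γ univ ∧
    (⟨γ 0, mfderiv 𝓘(ℝ, ℝ) 𝓘(ℝ, E) γ 0 (1 : ℝ)⟩ : TangentBundle 𝓘(ℝ, E) M) = ⟨x, u⟩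

/-- `φ` is a one-parameter group of isometries of `(M, g)`, that is a one-parameter subgroup of the
full isometry group. (Each `φ t` is a diffeomorphism with inverse `φ (-t)`.) -/
structure IsOneParameterIsometryGroup (φ : ℝ → M → M) : Prop where
  contMDiff : ContMDiff (𝓘(ℝ, ℝ).prod 𝓘(ℝ, E)) 𝓘(ℝ, E) ∞ (fun p : ℝ × M ↦ φ p.1 p.2)
  map_zero (x : M) : φ 0 x = x
  map_add (s t : ℝ) (x : M) : φ (s + t) x = φ s (φ t x)
  isometry (t : ℝ) (x : M) (u v : TangentSpace 𝓘(ℝ, E) x) :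
    g.inner (φ t x) (mfderiv 𝓘(ℝ, E) 𝓘(ℝ, E) (φ t) x u) (mfderiv 𝓘(ℝ, E) 𝓘(ℝ, E) (φ t) x v) =
      g.inner x u v

/-- The curve `γ` with open interval of definition `J` is homogeneous: up to a diffeomorphism
`l : ℝ → J`, it is an orbit of a one-parameter group of isometries. -/
def IsHomogeneousCurve (γ : ℝ → M) (J : Set ℝ) : Prop :=
  ∃ φ : ℝ → M → M, g.IsOneParameterIsometryGroup φ ∧
    ∃ l : ℝ → ℝ, ContDiff ℝ ∞ l ∧ (∀ t, deriv l t ≠ 0) ∧ range l = J ∧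
      ∀ t, γ (l t) = φ t (γ (l 0))

/-- Geodesic orbit (GO) pseudo-Riemannian manifolds: each (maximal) geodesic is an orbit of a
one-parameter group of isometries. -/
def IsGeodesicOrbit : Prop :=
  ∀ (γ : ℝ → M) (J : Set ℝ), g.IsMaximalGeodesic γ J → g.IsHomogeneousCurve γ J

end Intrinsic

section Submanifold

variable {E : Type*} [NormedAddCommGroup E] [NormedSpace ℝ E]
  {M : Type*} [TopologicalSpace M] [ChartedSpace E M] [IsManifold 𝓘(ℝ, E) ∞ M]
  (g : PseudoRiemannianMetric E M)
  {F : Type*} [NormedAddCommGroup F] [NormedSpace ℝ F]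
  {N : Type*} [TopologicalSpace N] [ChartedSpace F N] [IsManifold 𝓘(ℝ, F) ∞ N]

/-- `(N, h)` is a pseudo-Riemannian (immersed) submanifold of `(M, g)` through `f : N → M`: the map
`f` is an immersion and the metric `h` is the one induced from `g`. -/
structure IsSubmanifold (h : PseudoRiemannianMetric F N) (f : N → M) : Prop where
  isImmersion : Manifold.IsImmersion 𝓘(ℝ, F) 𝓘(ℝ, E) ∞ f
  induced (x : N) (u v : TangentSpace 𝓘(ℝ, F) x) :
    h.inner x u v =
      g.inner (f x) (mfderiv 𝓘(ℝ, F) 𝓘(ℝ, E) f x u) (mfderiv 𝓘(ℝ, F) 𝓘(ℝ, E) f x v)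

/-- The number `g(∇_{df u} (df v), w)` at `x`, where `∇` is the Levi-Civita connection of the ambient
metric `g` and `u, v` are regarded as constant coordinate vector fields on `N`, written in the
preferred charts at `x` and `f x`. For `w` normal to `N` it equals `g(II(u, v), w)`, where `II` is
the second fundamental form of `f`. -/
def hessianForm (f : N → M) (x : N) (u v : F) (w : E) : ℝ :=
  let fc : F → E := writtenInExtChartAt 𝓘(ℝ, F) 𝓘(ℝ, E) x f
  let y : F := extChartAt 𝓘(ℝ, F) x x
  g.inChart (f x) (fderiv ℝ (fun z ↦ fderiv ℝ fc z v) y u) w (fc y)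
    + g.christoffel (f x) (fc y) (fderiv ℝ fc y u) (fderiv ℝ fc y v) w

/-- The immersion `f : N → M` is totally geodesic: its second fundamental form (the normal component
of `∇_{df u} (df v)`) vanishes. -/
def IsTotallyGeodesic (f : N → M) : Prop :=
  ∀ (x : N) (u v : F) (w : E),
    (∀ z : F, g.inChart (f x)
      (fderiv ℝ (writtenInExtChartAt 𝓘(ℝ, F) 𝓘(ℝ, E) x f) (extChartAt 𝓘(ℝ, F) x x) z) w
      (extChartAt 𝓘(ℝ, E) (f x) (f x)) = 0) →
    g.hessianForm f x u v w = 0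

end Submanifold

end PseudoRiemannianMetric

end

/-! Let γ be a maximal geodesic of `N`; by completeness it is defined on ℝ. Since `f` is totally
geodesic, `f ∘ γ` is a geodesic of `M`, maximal because its domain is ℝ, so after a
reparametrization `l` it is an orbit of a one-parameter group φ of isometries of `M`. These
isometries need not preserve the image of `N`. The remedy is to take the Killing field Ξ generating
φ and to project it orthogonally to `N`: nondegeneracy of `h` defines a tangential field X by h(X,
z) = g(Ξ, df z).

X is a Killing field of `N` (`lieForm_eq_zero_of_pullback`, `IsKillingField.tangentialField`):
writing Ξ = df X + ν with ν normal, the Lie derivative of `h` along X differs from the restricted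
Lie derivative of `g` along Ξ only by 2 g(ν, II), which vanishes. Moreover `γ ∘ l` is an integral
curve of X, since along it Ξ is already tangent to `N`.

It remains to integrate X to a group. One integral curve of X is complete, and completeness spreads
along geodesics (`IsKillingField.mem_completeSet_of_geodesic`): if the integral curve through σ(r)
is complete, the differentials of the flow carry the velocity of σ at r along for all times; the
geodesics with these velocities exist because `N` is complete, and their points at parameter s trace
the integral curve through σ(s). Geodesics from a point sweep out a neighbourhood of it, so the
points with complete integral curves form an open and closed set. Off this set X is replaced by 0;
the result is a complete Killing field, and its flow is the required group.

The analytic basis is the smooth dependence of flows on initial values, obtained from the inverse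
function theorem on C([0,1], E). Metrics are handled through their Gram forms `chartForm` in
preferred charts. -/

open Filter Topology

noncomputable section

/-! ### Superposition operators on spaces of continuous functions -/

section Nemytskii

variable {K : Type*} [TopologicalSpace K] [CompactSpace K]

/-- The pointwise action of a bilinear map on spaces of continuous functions. -/
def ContinuousMap.pointwiseCLM (K : Type*) [TopologicalSpace K] [CompactSpace K] {H E G : Type*}
    [NormedAddCommGroup H] [NormedSpace ℝ H] [NormedAddCommGroup E] [NormedSpace ℝ E]
    [NormedAddCommGroup G] [NormedSpace ℝ G] (B : H →L[ℝ] E →L[ℝ] G) :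
    C(K, H) →L[ℝ] (C(K, E) →L[ℝ] C(K, G)) :=
  LinearMap.mkContinuous₂
    (LinearMap.mk₂ ℝ (fun (A : C(K, H)) (β : C(K, E)) ↦
      (⟨fun s ↦ B (A s) (β s), by fun_prop⟩ : C(K, G)))
      (by intros; ext; simp) (by intros; ext; simp) (by intros; ext; simp) (by intros; ext; simp))
    ‖B‖ (by
      intro A β
      rw [ContinuousMap.norm_le _ (by positivity)]
      intro s
      calc ‖B (A s) (β s)‖ ≤ ‖B‖ * ‖A s‖ * ‖β s‖ := B.le_opNorm₂ _ _
        _ ≤ ‖B‖ * ‖A‖ * ‖β‖ := by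
          gcongr
          · exact A.norm_coe_le_norm s
          · exact β.norm_coe_le_norm s)

variable {H E G : Type*} [NormedAddCommGroup H] [NormedSpace ℝ H]
  [NormedAddCommGroup E] [NormedSpace ℝ E] [NormedAddCommGroup G] [NormedSpace ℝ G]

@[simp] lemma ContinuousMap.pointwiseCLM_apply (B : H →L[ℝ] E →L[ℝ] G)
    (A : C(K, H)) (β : C(K, E)) (s : K) :
    ContinuousMap.pointwiseCLM K B A β s = B (A s) (β s) := rfl

/-- Pointwise this is the mean value inequality on the segment from `α s` to `β s`. Uniformity in
`s` comes from the continuity of `α ↦ X'.comp α` in the sup metric, so neither local compactness of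
`E` nor uniform continuity of `X'` is needed. -/
lemma ContinuousMap.hasFDerivAt_comp {B : H →L[ℝ] E →L[ℝ] G} {X : C(E, G)} {X' : C(E, H)}
    (hX : ∀ x, HasFDerivAt X (B (X' x)) x) (α : C(K, E)) :
    HasFDerivAt (fun α : C(K, E) ↦ X.comp α) (ContinuousMap.pointwiseCLM K B (X'.comp α)) α := by
  rw [hasFDerivAt_iff_isLittleO, Asymptotics.isLittleO_iff]
  intro ε hε
  have hc : Continuous fun α : C(K, E) ↦ X'.comp α := ContinuousMap.continuous_postcomp _
  obtain ⟨δ, hδ, h⟩ := Metric.continuousAt_iff.1 (hc.continuousAt (x := α)) (ε / (‖B‖ + 1))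
    (by positivity)
  filter_upwards [Metric.ball_mem_nhds α hδ] with β hβ
  rw [ContinuousMap.norm_le _ (by positivity)]
  intro s
  have key : ‖X (β s) - X (α s) - B (X' (α s)) (β s - α s)‖ ≤ ε * ‖β s - α s‖ := by
    apply (convex_segment (α s) (β s)).norm_image_sub_le_of_norm_hasFDerivWithin_le'
      (f' := fun x ↦ B (X' x)) _ _ (left_mem_segment ..) (right_mem_segment ..)
    · intro z _
      exact (hX z).hasFDerivWithinAt
    · intro z hz
      obtain ⟨θ, hθ, rfl⟩ := (segment_eq_image' ℝ (α s) (β s)) ▸ hz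
      -- The point `z` of the segment is the value at `s` of a function within sup-distance `δ` of
      -- `α`, so the choice of `δ` controls `X' z - X' (α s)`.
      have h1 : dist (α + θ • (β - α)) α < δ := by
        rw [dist_eq_norm, add_sub_cancel_left, norm_smul, Real.norm_of_nonneg hθ.1]
        calc θ * ‖β - α‖ ≤ 1 * ‖β - α‖ := by gcongr; exact hθ.2
          _ < δ := by rwa [one_mul, ← dist_eq_norm]
      have h2 := (ContinuousMap.dist_apply_le_dist s).trans_lt (h h1)
      rw [dist_eq_norm] at h2
      rw [← map_sub]
      calc _ ≤ ‖B‖ * (ε / (‖B‖ + 1)) := (B.le_opNorm _).trans (by gcongr; exact h2.le)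
        _ ≤ (‖B‖ + 1) * (ε / (‖B‖ + 1)) := by gcongr; linarith
        _ = ε := by field_simp
  refine key.trans ?_
  gcongr
  exact ContinuousMap.norm_coe_le_norm (β - α) s

lemma ContinuousMap.contDiff_comp_succ (n : ℕ) {B : H →L[ℝ] E →L[ℝ] G} {X : C(E, G)}
    {X' : C(E, H)} (hX : ∀ x, HasFDerivAt X (B (X' x)) x)
    (h : ContDiff ℝ n (fun α : C(K, E) ↦ X'.comp α)) :
    ContDiff ℝ (n + 1 : ℕ) (fun α : C(K, E) ↦ X.comp α) := by
  rw [show ((n + 1 : ℕ) : WithTop ℕ∞) = n + 1 by simp, contDiff_succ_iff_hasFDerivAt]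
  exact ⟨fun α ↦ ContinuousMap.pointwiseCLM K B (X'.comp α),
    (ContinuousMap.pointwiseCLM K B).contDiff.comp h,
    fun α ↦ ContinuousMap.hasFDerivAt_comp hX α⟩

/-- The derivative of superposition by `X` is, up to `pointwiseCLM`, superposition by `fderiv ℝ X`,
which allows induction on `n`. `E` and `G` share a universe so that the induction hypothesis applies
to `E →L[ℝ] G` in place of `G`. -/
lemma ContinuousMap.contDiff_comp_nat.{u} (n : ℕ) {E G : Type u}
    [NormedAddCommGroup E] [NormedSpace ℝ E] [NormedAddCommGroup G] [NormedSpace ℝ G]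
    (X : C(E, G)) (hX : ContDiff ℝ ∞ X) :
    ContDiff ℝ n (fun α : C(K, E) ↦ X.comp α) := by
  induction n generalizing G with
  | zero => exact contDiff_zero.2 (ContinuousMap.continuous_postcomp _)
  | succ n ih =>
    have hd : ContDiff ℝ ∞ (fderiv ℝ X) := hX.fderiv_right (by simp)
    exact ContinuousMap.contDiff_comp_succ n (B := ContinuousLinearMap.id ℝ (E →L[ℝ] G))
      (X' := ⟨fderiv ℝ X, hd.continuous⟩)
      (fun x ↦ (hX.differentiable (by simp) x).hasFDerivAt) (ih _ hd)

/-- The superposition operator of a smooth map is smooth on spaces of continuous functions. -/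
lemma ContinuousMap.contDiff_comp.{u} {E G : Type u}
    [NormedAddCommGroup E] [NormedSpace ℝ E] [NormedAddCommGroup G] [NormedSpace ℝ G]
    (X : C(E, G)) (hX : ContDiff ℝ ∞ X) :
    ContDiff ℝ ∞ (fun α : C(K, E) ↦ X.comp α) :=
  contDiff_infty.2 fun n ↦ ContinuousMap.contDiff_comp_nat n X hX

end Nemytskii

/-! ### The integration operator on C([0,1], E) -/

section Primitive

variable (E : Type*) [NormedAddCommGroup E] [NormedSpace ℝ E]

/-- The primitive vanishing at `0`, as an operator on continuous functions on `[0, 1]`. -/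
def ContinuousMap.primitiveCLM : C(unitInterval, E) →L[ℝ] C(unitInterval, E) :=
  LinearMap.mkContinuous
    { toFun := fun α ↦ ⟨fun s ↦ ∫ r in (0 : ℝ)..s, Set.IccExtend zero_le_one (⇑α) r, by
        have h := intervalIntegral.continuous_primitive (μ := MeasureTheory.volume)
          (f := Set.IccExtend zero_le_one (⇑α))
          (fun a b ↦ (α.continuous.Icc_extend' (h := zero_le_one)).intervalIntegrable a b) 0
        exact h.comp continuous_subtype_val⟩
      map_add' := fun α β ↦ by
        ext s
        exact intervalIntegral.integral_add
          ((α.continuous.Icc_extend' (h := zero_le_one)).intervalIntegrable _ _)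
          ((β.continuous.Icc_extend' (h := zero_le_one)).intervalIntegrable _ _)
      map_smul' := fun c α ↦ by
        ext s
        exact intervalIntegral.integral_smul _ _ }
    1 (by
      intro α
      rw [one_mul, ContinuousMap.norm_le _ (norm_nonneg _)]
      intro s
      refine (intervalIntegral.norm_integral_le_of_norm_le_const (C := ‖α‖)
        fun r _ ↦ α.norm_coe_le_norm _).trans ?_
      rw [sub_zero, abs_of_nonneg s.2.1]
      exact mul_le_of_le_one_right (norm_nonneg _) s.2.2)

variable {E}

lemma ContinuousMap.primitiveCLM_apply (α : C(unitInterval, E)) (s : unitInterval) :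
    ContinuousMap.primitiveCLM E α s = ∫ r in (0 : ℝ)..s, Set.IccExtend zero_le_one (⇑α) r := rfl

end Primitive

/-! ### Smooth local flows of differential equations -/

section LocalFlow

/-- Constant functions, as a continuous linear map. -/
def ContinuousMap.constLinear (E : Type*) [NormedAddCommGroup E] [NormedSpace ℝ E] :
    E →L[ℝ] C(unitInterval, E) :=
  LinearMap.mkContinuous
    { toFun := ContinuousMap.const unitInterval
      map_add' := fun _ _ ↦ rfl
      map_smul' := fun _ _ ↦ rfl } 1
    (fun x ↦ by
      rw [one_mul, ContinuousMap.norm_le _ (norm_nonneg _)]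
      exact fun _ ↦ le_rfl)

variable {E : Type*} [NormedAddCommGroup E] [NormedSpace ℝ E]

@[simp] lemma ContinuousMap.constLinear_apply (x : E) (s : unitInterval) :
    ContinuousMap.constLinear E x s = x := rfl

/-- The map whose zeros in the last variable are the time-rescaled integral curves of `X`. -/
def integralEquationMap (X : C(E, E)) (z : (ℝ × E) × C(unitInterval, E)) :
    (ℝ × E) × C(unitInterval, E) :=
  (z.1, z.2 - (ContinuousMap.constLinear E z.1.2
    + z.1.1 • ContinuousMap.primitiveCLM E (X.comp z.2)))

lemma contDiff_integralEquationMap {X : C(E, E)} (hX : ContDiff ℝ ∞ X) :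
    ContDiff ℝ ∞ (integralEquationMap X) := by
  have h1 : ContDiff ℝ ∞ fun z : (ℝ × E) × C(unitInterval, E) ↦
      ContinuousMap.primitiveCLM E (X.comp z.2) :=
    (ContinuousMap.primitiveCLM E).contDiff.comp ((ContinuousMap.contDiff_comp X hX).comp contDiff_snd)
  have h2 : ContDiff ℝ ∞ fun z : (ℝ × E) × C(unitInterval, E) ↦
      ContinuousMap.constLinear E z.1.2 :=
    (ContinuousMap.constLinear E).contDiff.comp (contDiff_snd.comp contDiff_fst)
  exact contDiff_fst.prodMk (contDiff_snd.sub (h2.add ((contDiff_fst.comp contDiff_fst).smul h1)))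

/-- At time 0 the factor `t` kills the derivative of the integral term in the direction of the
curve. The derivative is therefore triangular with identity blocks on the diagonal, hence invertible
without any contraction estimate. -/
lemma hasFDerivAt_integralEquationMap {X : C(E, E)} (hX : ContDiff ℝ ∞ X) (x₀ : E) :
    ∃ L : ((ℝ × E) × C(unitInterval, E)) ≃L[ℝ] ((ℝ × E) × C(unitInterval, E)),
      HasFDerivAt (integralEquationMap X) (L : _ →L[ℝ] _)
        ((0, x₀), ContinuousMap.constLinear E x₀) := by
  set α₀ := ContinuousMap.constLinear E x₀
  set V := ContinuousMap.primitiveCLM E (X.comp α₀) with hV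
  have h1 : DifferentiableAt ℝ (fun z : (ℝ × E) × C(unitInterval, E) ↦
      ContinuousMap.primitiveCLM E (X.comp z.2)) ((0, x₀), α₀) :=
    (((ContinuousMap.primitiveCLM E).contDiff (n := ∞).comp
      ((ContinuousMap.contDiff_comp X hX).comp contDiff_snd)).differentiable (by simp)) _
  refine ⟨ContinuousLinearEquiv.skewProd (.refl ℝ _) (.refl ℝ _)
    (-((ContinuousMap.constLinear E).comp (.snd ℝ ℝ E) + (ContinuousLinearMap.fst ℝ ℝ E).smulRight V)),
    ?_⟩
  have h2 := ((ContinuousLinearMap.fst ℝ ℝ E).comp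
    (.fst ℝ (ℝ × E) C(unitInterval, E))).hasFDerivAt (x := ((0, x₀), α₀))
  have h3 := ((ContinuousMap.constLinear E).comp ((ContinuousLinearMap.snd ℝ ℝ E).comp
    (.fst ℝ (ℝ × E) C(unitInterval, E)))).hasFDerivAt (x := ((0, x₀), α₀))
  have h := (hasFDerivAt_fst (𝕜 := ℝ) (p := (((0 : ℝ), x₀), α₀))).prodMk
    ((hasFDerivAt_snd (𝕜 := ℝ) (p := (((0 : ℝ), x₀), α₀))).sub (h3.add (h2.smul h1.hasFDerivAt)))
  refine h.congr_fderiv ?_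
  ext z <;> simp [V, sub_eq_add_neg]

/-- Substituting `s * r` for `r` in the integral turns a solution rescaled from time `t` into one
rescaled from time `s * t`. -/
lemma integralEquationMap_comp_mul {X : C(E, E)} {t : ℝ} {x : E} {α : C(unitInterval, E)}
    (h : integralEquationMap X ((t, x), α) = ((t, x), 0)) (s : unitInterval) :
    integralEquationMap X ((s * t, x), α.comp ⟨fun r ↦ s * r, by fun_prop⟩) = ((s * t, x), 0) := by
  have h' : ∀ u, α u = x + t • ContinuousMap.primitiveCLM E (X.comp α) u := fun u ↦ by
    have := DFunLike.congr_fun (congrArg Prod.snd h) u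
    simpa [integralEquationMap, sub_eq_zero] using this
  refine Prod.ext rfl ?_
  ext u
  simp only [integralEquationMap, ContinuousMap.sub_apply, ContinuousMap.add_apply,
    ContinuousMap.comp_apply, ContinuousMap.coe_mk, ContinuousMap.constLinear_apply,
    ContinuousMap.smul_apply, ContinuousMap.zero_apply, h' (s * u), sub_eq_zero]
  congr 1
  rw [mul_comm (s : ℝ) t, mul_smul, ContinuousMap.primitiveCLM_apply, ContinuousMap.primitiveCLM_apply]
  congr 1
  have := intervalIntegral.smul_integral_comp_mul_left
    (f := Set.IccExtend zero_le_one (⇑(X.comp α))) (a := 0) (b := (u : ℝ)) (s : ℝ)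
  rw [mul_zero] at this
  rw [show ((s * u : unitInterval) : ℝ) = s * u from rfl, ← this]
  congr 1
  apply intervalIntegral.integral_congr
  intro r hr
  rw [uIcc_of_le u.2.1] at hr
  have hr' : r ∈ Icc (0 : ℝ) 1 := ⟨hr.1, hr.2.trans u.2.2⟩
  have hs : (s : ℝ) * r ∈ Icc (0 : ℝ) 1 :=
    ⟨mul_nonneg s.2.1 hr'.1, mul_le_one₀ s.2.2 hr'.1 hr'.2⟩
  simp only [IccExtend_of_mem _ _ hr', IccExtend_of_mem _ _ hs]
  rfl

/-- **Smooth dependence on initial values**: a smooth autonomous vector field on a Banach space has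
a smooth local flow. -/
theorem exists_contDiffOn_local_flow [CompleteSpace E] {X : E → E} (hX : ContDiff ℝ ∞ X) (x₀ : E) :
    ∃ ψ : ℝ × E → E, ∃ ε > 0,
      ContDiffOn ℝ ∞ ψ (Ioo (-ε) ε ×ˢ Metric.ball x₀ ε) ∧
      (∀ x ∈ Metric.ball x₀ ε, ψ (0, x) = x) ∧
      ∀ t ∈ Ioo (-ε) ε, ∀ x ∈ Metric.ball x₀ ε,
        HasDerivAt (fun s ↦ ψ (s, x)) (X (ψ (t, x))) t := by
  let Xc : C(E, E) := ⟨X, hX.continuous⟩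
  have hF : ContDiff ℝ ∞ (integralEquationMap Xc) := contDiff_integralEquationMap hX
  obtain ⟨L, hL⟩ := hasFDerivAt_integralEquationMap (X := Xc) hX x₀
  set α₀ := ContinuousMap.constLinear E x₀ with hα₀
  set z₀ : (ℝ × E) × C(unitInterval, E) := ((0, x₀), α₀) with hz₀
  have hstr : HasStrictFDerivAt (integralEquationMap Xc) (L : _ →L[ℝ] _) z₀ :=
    hF.contDiffAt.hasStrictFDerivAt' hL (by simp)
  set P := hstr.toOpenPartialHomeomorph (integralEquationMap Xc) with hP
  have hPc : ∀ z, P z = integralEquationMap Xc z := fun _ ↦ rfl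
  have hzs : z₀ ∈ P.source := hstr.mem_toOpenPartialHomeomorph_source
  have hPz : P z₀ = ((0, x₀), 0) := by
    simp [hPc, integralEquationMap, hz₀, hα₀]
  -- the inverse branch
  let B : ℝ × E → (ℝ × E) × C(unitInterval, E) := fun w ↦ P.symm (w, 0)
  let ι : ℝ × E → (ℝ × E) × C(unitInterval, E) := fun w ↦ (w, 0)
  have hι : ContDiff ℝ ∞ ι := contDiff_id.prodMk contDiff_const
  have hB0 : B (0, x₀) = z₀ := by
    simp only [B, ← hPz]; exact P.left_inv hzs
  have htarget : ∀ᶠ w in 𝓝 ((0 : ℝ), x₀), ι w ∈ P.target := by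
    apply hι.continuous.continuousAt
    refine P.open_target.mem_nhds ?_
    change (((0 : ℝ), x₀), (0 : C(unitInterval, E))) ∈ P.target
    rw [← hPz]
    exact P.map_source hzs
  have hBcont : ContinuousAt B (0, x₀) := by
    have := P.continuousAt_symm (x := ι (0, x₀)) htarget.self_of_nhds
    exact this.comp hι.continuous.continuousAt
  -- Invertibility of the derivative is an open condition, so the inverse branch is smooth at all
  -- nearby points and not only at the image of `z₀`.
  have hinv : ∀ᶠ z in 𝓝 z₀, ∃ L' : ((ℝ × E) × C(unitInterval, E)) ≃L[ℝ]
      ((ℝ × E) × C(unitInterval, E)), (L' : _ →L[ℝ] _) = fderiv ℝ (integralEquationMap Xc) z := by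
    have hc : ContinuousAt (fderiv ℝ (integralEquationMap Xc)) z₀ :=
      (hF.continuous_fderiv (by simp)).continuousAt
    refine hc.eventually (p := fun A ↦ ∃ L' : ((ℝ × E) × C(unitInterval, E)) ≃L[ℝ]
      ((ℝ × E) × C(unitInterval, E)), (L' : _ →L[ℝ] _) = A) ?_
    rw [hL.fderiv]
    exact ContinuousLinearEquiv.nhds L
  have hsm : ∀ᶠ w in 𝓝 ((0 : ℝ), x₀), ContDiffAt ℝ ∞ B w := by
    rw [← hB0] at hinv
    filter_upwards [htarget, hBcont.eventually hinv] with w hw ⟨L', hL'⟩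
    refine ContDiffAt.comp w (g := P.symm) (f := ι) ?_ hι.contDiffAt
    refine P.contDiffAt_symm hw (f₀' := L') ?_ hF.contDiffAt
    rw [hL']
    exact (hF.differentiable (by simp) _).hasFDerivAt
  have heq : ∀ᶠ w in 𝓝 ((0 : ℝ), x₀), integralEquationMap Xc (w, (B w).2) = (w, 0) := by
    filter_upwards [htarget] with w hw
    have h1 : integralEquationMap Xc (B w) = (w, 0) := P.right_inv hw
    have h2 : (B w).1 = w := congrArg Prod.fst h1
    rwa [show B w = (w, (B w).2) from Prod.ext h2 rfl] at h1
  -- uniqueness for small data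
  obtain ⟨δ, hδ, hball⟩ := Metric.mem_nhds_iff.1 (P.open_source.mem_nhds hzs)
  have hsmall : ∀ᶠ w in 𝓝 ((0 : ℝ), x₀), dist (B w).2 α₀ < δ := by
    have := (continuous_snd.continuousAt.comp hBcont)
    rw [Metric.continuousAt_iff'] at this
    have h3 := this δ hδ
    simpa [hB0, hz₀] using h3
  obtain ⟨ε₁, hε₁, hev⟩ := Metric.eventually_nhds_iff_ball.1 (hsm.and (heq.and (hsmall.and htarget)))
  -- The bound `ε₁` keeps the data where the inverse branch is well behaved; the bound `δ` keeps `(s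
  -- * t, x)` inside the ball on which `P` is injective.
  set ε := min ε₁ δ
  have hε : 0 < ε := lt_min hε₁ hδ
  have hmem : ∀ t ∈ Ioo (-ε) ε, ∀ x ∈ Metric.ball x₀ ε,
      (t, x) ∈ Metric.ball ((0 : ℝ), x₀) ε₁ := by
    intro t ht x hx
    rw [Metric.mem_ball, Prod.dist_eq, Real.dist_0_eq_abs, max_lt_iff]
    exact ⟨(abs_lt.2 ht).trans_le (min_le_left _ _), hx.trans_le (min_le_left _ _)⟩
  -- By injectivity of `P`, the solution for time `s * t` is the rescaled solution for time `t`.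
  -- Hence the values at parameter 1 alone, which define `ψ`, already contain the whole curve.
  have hscale : ∀ t ∈ Ioo (-ε) ε, ∀ x ∈ Metric.ball x₀ ε, ∀ s : unitInterval,
      (B (s * t, x)).2 1 = (B (t, x)).2 s := by
    intro t ht x hx s
    have hst : (s : ℝ) * t ∈ Ioo (-ε) ε := by
      rw [mem_Ioo, ← abs_lt] at ht ⊢
      rw [abs_mul, abs_of_nonneg s.2.1]
      exact (mul_le_of_le_one_left (abs_nonneg _) s.2.2).trans_lt ht
    obtain ⟨-, h1, h2, h3⟩ := hev _ (hmem t ht x hx)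
    obtain ⟨-, h4, h5, h6⟩ := hev _ (hmem _ hst x hx)
    have h7 := integralEquationMap_comp_mul h1 s
    have hsrc : ∀ α, dist α α₀ < δ → (((s : ℝ) * t, x), α) ∈ P.source := by
      intro α hα
      apply hball
      rw [Metric.mem_ball, Prod.dist_eq, Prod.dist_eq, Real.dist_0_eq_abs]
      exact max_lt (max_lt ((abs_lt.2 hst).trans_le (min_le_right _ _))
        (hx.trans_le (min_le_right _ _))) hα
    have h8 := P.injOn (hsrc _ h5) (hsrc ((B (t, x)).2.comp ⟨fun r ↦ s * r, by fun_prop⟩) ?_)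
      (by rw [hPc, hPc, h4, h7])
    · have := DFunLike.congr_fun (congrArg Prod.snd h8) 1
      simpa using this
    · rw [ContinuousMap.dist_lt_iff hδ]
      intro r
      exact (ContinuousMap.dist_lt_iff hδ).1 h2 (s * r)
  let ev1 : C(unitInterval, E) →L[ℝ] E := ContinuousMap.evalCLM ℝ 1
  let ψ : ℝ × E → E := fun w ↦ (B w).2 1
  have hψs : ContDiffOn ℝ ∞ ψ (Ioo (-ε) ε ×ˢ Metric.ball x₀ ε) := by
    rintro ⟨t, x⟩ ⟨ht, hx⟩
    exact (ev1.contDiff.contDiffAt.comp _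
      (contDiff_snd.contDiffAt.comp _ (hev _ (hmem t ht x hx)).1)).contDiffWithinAt
  have hint : ∀ t ∈ Ioo (-ε) ε, ∀ x ∈ Metric.ball x₀ ε,
      ψ (t, x) = x + ∫ r in (0 : ℝ)..t, X (ψ (r, x)) := by
    intro t ht x hx
    have h1 := DFunLike.congr_fun (congrArg Prod.snd (hev _ (hmem t ht x hx)).2.1) 1
    have h2 : ψ (t, x) = x + t • ContinuousMap.primitiveCLM E (Xc.comp (B (t, x)).2) 1 := by
      simpa [integralEquationMap, sub_eq_zero] using h1
    rw [h2, ContinuousMap.primitiveCLM_apply]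
    congr 1
    have := intervalIntegral.smul_integral_comp_mul_left (f := fun r ↦ X (ψ (r, x)))
      (a := 0) (b := 1) t
    rw [mul_zero, mul_one] at this
    rw [← this]
    congr 1
    apply intervalIntegral.integral_congr
    intro r hr
    rw [uIcc_of_le (by simp)] at hr
    change Set.IccExtend zero_le_one (⇑(Xc.comp (B (t, x)).2)) r = X (ψ (t * r, x))
    rw [IccExtend_of_mem _ _ hr, mul_comm t r]
    exact congrArg X (hscale t ht x hx ⟨r, hr⟩).symm
  refine ⟨ψ, ε, hε, hψs, ?_, ?_⟩
  · intro x hx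
    rw [hint 0 ⟨by linarith, hε⟩ x hx]; simp
  · intro t ht x hx
    have hc : ContinuousOn (fun r ↦ X (ψ (r, x))) (Ioo (-ε) ε) := by
      refine hX.continuous.comp_continuousOn (hψs.continuousOn.comp (by fun_prop) ?_)
      exact fun r hr ↦ ⟨hr, hx⟩
    have h1 : HasDerivAt (fun u ↦ ∫ r in (0 : ℝ)..u, X (ψ (r, x))) (X (ψ (t, x))) t := by
      apply intervalIntegral.integral_hasDerivAt_right
      · apply ContinuousOn.intervalIntegrable
        exact hc.mono ((ordConnected_Ioo).uIcc_subset ⟨by linarith, hε⟩ ht)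
      · exact hc.stronglyMeasurableAtFilter isOpen_Ioo t ht
      · exact hc.continuousAt (isOpen_Ioo.mem_nhds ht)
    refine (h1.const_add x).congr_of_eventuallyEq ?_
    filter_upwards [isOpen_Ioo.mem_nhds ht] with u hu using hint u hu x hx

/-- A vector field which is smooth on an open set has a smooth local flow there. -/
theorem exists_contDiffOn_local_flow_of_isOpen [FiniteDimensional ℝ E] {X : E → E} {U : Set E}
    (hU : IsOpen U) (hX : ContDiffOn ℝ ∞ X U) {x₀ : E} (hx₀ : x₀ ∈ U) :
    ∃ ψ : ℝ × E → E, ∃ ε > 0,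
      ContDiffOn ℝ ∞ ψ (Ioo (-ε) ε ×ˢ Metric.ball x₀ ε) ∧
      (∀ x ∈ Metric.ball x₀ ε, ψ (0, x) = x) ∧
      ∀ t ∈ Ioo (-ε) ε, ∀ x ∈ Metric.ball x₀ ε, ψ (t, x) ∈ U ∧
        HasDerivAt (fun s ↦ ψ (s, x)) (X (ψ (t, x))) t := by
  have : CompleteSpace E := FiniteDimensional.complete ℝ E
  obtain ⟨r, hr, hrU⟩ := Metric.nhds_basis_closedBall.mem_iff.1 (hU.mem_nhds hx₀)
  -- Multiplying by a bump function supported in `U` and equal to 1 near `x₀` makes the field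
  -- globally smooth without changing it near `x₀`.
  let χ : ContDiffBump x₀ := ⟨r / 2, r, by linarith, by linarith⟩
  have hχ : tsupport χ ⊆ U := by rw [χ.tsupport_eq]; exact hrU
  have hY : ContDiff ℝ ∞ fun x ↦ χ x • X x := by
    rw [contDiff_iff_contDiffAt]
    intro x
    by_cases hx : x ∈ tsupport χ
    · exact χ.contDiffAt.smul (hX.contDiffAt (hU.mem_nhds (hχ hx)))
    · refine (contDiffAt_const (c := (0 : E))).congr_of_eventuallyEq ?_
      filter_upwards [(isClosed_tsupport _).isOpen_compl.mem_nhds hx] with y hy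
      rw [image_eq_zero_of_notMem_tsupport hy, zero_smul]
  obtain ⟨ψ, ε, hε, h1, h2, h3⟩ := exists_contDiffOn_local_flow hY x₀
  have hc : ContinuousAt ψ (0, x₀) := h1.continuousOn.continuousAt
    ((isOpen_Ioo.prod Metric.isOpen_ball).mem_nhds
      ⟨⟨by simpa using hε, hε⟩, Metric.mem_ball_self hε⟩)
  -- For short times the flow of the cut-off field stays where `χ = 1`, and there it solves the
  -- original equation.
  have hev : ∀ᶠ w in 𝓝 ((0 : ℝ), x₀), ψ w ∈ U ∧ χ (ψ w) = 1 := by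
    refine hc.eventually (p := fun y ↦ y ∈ U ∧ χ y = 1) ?_
    rw [h2 x₀ (Metric.mem_ball_self hε)]
    exact (hU.eventually_mem hx₀).and χ.eventuallyEq_one
  obtain ⟨ε', hε', hb⟩ := Metric.eventually_nhds_iff_ball.1 hev
  have hlt : ∀ {t : ℝ} {x : E}, t ∈ Ioo (-min ε ε') (min ε ε') → x ∈ Metric.ball x₀ (min ε ε') →
      (t ∈ Ioo (-ε) ε ∧ x ∈ Metric.ball x₀ ε) ∧ (t, x) ∈ Metric.ball ((0 : ℝ), x₀) ε' := by
    intro t x ht hx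
    have ht' := abs_lt.2 ht
    refine ⟨⟨abs_lt.1 (ht'.trans_le (min_le_left _ _)), Metric.ball_subset_ball (min_le_left _ _) hx⟩, ?_⟩
    rw [Metric.mem_ball, Prod.dist_eq, Real.dist_0_eq_abs]
    exact max_lt (ht'.trans_le (min_le_right _ _)) (Metric.ball_subset_ball (min_le_right _ _) hx)
  refine ⟨ψ, min ε ε', lt_min hε hε', ?_, ?_, ?_⟩
  · exact h1.mono fun w hw ↦ (hlt hw.1 hw.2).1
  · exact fun x hx ↦ h2 x (Metric.ball_subset_ball (min_le_left _ _) hx)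
  · intro t ht x hx
    obtain ⟨⟨ht', hx'⟩, hw⟩ := hlt ht hx
    refine ⟨(hb _ hw).1, ?_⟩
    simpa [(hb _ hw).2] using h3 t ht' x hx'

end LocalFlow

/-! ### Tangent vectors and vector fields in preferred charts -/

section ChartBasics

variable {E : Type*} [NormedAddCommGroup E] [NormedSpace ℝ E]
  {M : Type*} [TopologicalSpace M] [ChartedSpace E M] [IsManifold 𝓘(ℝ, E) ∞ M]

lemma contMDiffAt_chart {p x : M} (hx : x ∈ (extChartAt 𝓘(ℝ, E) p).source) :
    ContMDiffAt 𝓘(ℝ, E) 𝓘(ℝ, E) ∞ (extChartAt 𝓘(ℝ, E) p) x :=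
  contMDiffAt_extChartAt' (by rwa [extChartAt_source] at hx)

lemma contMDiffAt_chart_symm {p : M} {y : E} (hy : y ∈ (extChartAt 𝓘(ℝ, E) p).target) :
    ContMDiffAt 𝓘(ℝ, E) 𝓘(ℝ, E) ∞ (extChartAt 𝓘(ℝ, E) p).symm y :=
  (contMDiffOn_extChartAt_symm p).contMDiffAt ((isOpen_extChartAt_target p).mem_nhds hy)

lemma mdifferentiableAt_chart {p x : M} (hx : x ∈ (extChartAt 𝓘(ℝ, E) p).source) :
    MDifferentiableAt 𝓘(ℝ, E) 𝓘(ℝ, E) (extChartAt 𝓘(ℝ, E) p) x :=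
  (contMDiffAt_chart hx).mdifferentiableAt (by simp)

lemma mdifferentiableAt_chart_symm {p : M} {y : E} (hy : y ∈ (extChartAt 𝓘(ℝ, E) p).target) :
    MDifferentiableAt 𝓘(ℝ, E) 𝓘(ℝ, E) (extChartAt 𝓘(ℝ, E) p).symm y :=
  (contMDiffAt_chart_symm hy).mdifferentiableAt (by simp)

/-- The derivative of the preferred chart at `p`. -/
def chartDeriv (p x : M) : TangentSpace 𝓘(ℝ, E) x →L[ℝ] E :=
  mfderiv 𝓘(ℝ, E) 𝓘(ℝ, E) (extChartAt 𝓘(ℝ, E) p) x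

/-- The derivative of the inverse of the preferred chart at `p`. -/
def chartSymmDeriv (p : M) (y : E) :
    E →L[ℝ] TangentSpace 𝓘(ℝ, E) ((extChartAt 𝓘(ℝ, E) p).symm y) :=
  mfderiv 𝓘(ℝ, E) 𝓘(ℝ, E) (extChartAt 𝓘(ℝ, E) p).symm y

lemma chartDeriv_chartSymmDeriv {p : M} {y : E} (hy : y ∈ (extChartAt 𝓘(ℝ, E) p).target) (v : E) :
    chartDeriv p _ (chartSymmDeriv p y v) = v := by
  have : IsManifold 𝓘(ℝ, E) 1 M := .of_le (n := ∞) (by norm_cast)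
  have h := mfderiv_extChartAt_comp_mfderivWithin_extChartAt_symm (I := 𝓘(ℝ, E)) hy
  simp only [modelWithCornersSelf_coe, range_id, mfderivWithin_univ] at h
  exact DFunLike.congr_fun h v

lemma chartSymmDeriv_chartDeriv {p : M} {y : E} (hy : y ∈ (extChartAt 𝓘(ℝ, E) p).target)
    (v : TangentSpace 𝓘(ℝ, E) ((extChartAt 𝓘(ℝ, E) p).symm y)) :
    chartSymmDeriv p y (chartDeriv p _ v) = v := by
  have : IsManifold 𝓘(ℝ, E) 1 M := .of_le (n := ∞) (by norm_cast)
  have h := mfderivWithin_extChartAt_symm_comp_mfderiv_extChartAt (I := 𝓘(ℝ, E)) hy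
  simp only [modelWithCornersSelf_coe, range_id, mfderivWithin_univ] at h
  exact DFunLike.congr_fun h v

/-- The derivative is put in the `smulRight` form that occurs in the definition of integral curves.
-/
lemma HasDerivAt.hasMFDerivAt_chart_symm {p : M} {c : ℝ → E} {c' : E} {t : ℝ}
    (hc : HasDerivAt c c' t) (ht : c t ∈ (extChartAt 𝓘(ℝ, E) p).target) :
    HasMFDerivAt 𝓘(ℝ, ℝ) 𝓘(ℝ, E) (fun s ↦ (extChartAt 𝓘(ℝ, E) p).symm (c s)) t
      ((1 : ℝ →L[ℝ] ℝ).smulRight (chartSymmDeriv p (c t) c')) := by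
  have hm := (mdifferentiableAt_chart_symm ht).hasMFDerivAt.comp t hc.hasFDerivAt.hasMFDerivAt
  refine hm.congr_mfderiv ?_
  refine ContinuousLinearMap.ext fun (r : ℝ) ↦ ?_
  exact (chartSymmDeriv p (c t)).map_smul r c'

lemma HasMFDerivAt.hasDerivAt_chart {p : M} {c : ℝ → M} {t : ℝ} {v : TangentSpace 𝓘(ℝ, E) (c t)}
    (hc : HasMFDerivAt 𝓘(ℝ, ℝ) 𝓘(ℝ, E) c t ((1 : ℝ →L[ℝ] ℝ).smulRight v))
    (ht : c t ∈ (extChartAt 𝓘(ℝ, E) p).source) :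
    HasDerivAt (fun s ↦ extChartAt 𝓘(ℝ, E) p (c s)) (chartDeriv p (c t) v) t := by
  have hm := (mdifferentiableAt_chart ht).hasMFDerivAt.comp t hc
  rw [hasDerivAt_iff_hasFDerivAt]
  refine hasMFDerivAt_iff_hasFDerivAt.1 (hm.congr_mfderiv ?_)
  refine ContinuousLinearMap.ext fun (r : ℝ) ↦ ?_
  exact (chartDeriv p (c t)).map_smul r v

/-- The coordinate expression of a vector field in the preferred chart at `p`. -/
def coordField (X : (x : M) → TangentSpace 𝓘(ℝ, E) x) (p : M) (y : E) : E :=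
  chartDeriv p _ (X ((extChartAt 𝓘(ℝ, E) p).symm y))

variable {X : (x : M) → TangentSpace 𝓘(ℝ, E) x}

lemma chartSymmDeriv_coordField {p : M} {y : E} (hy : y ∈ (extChartAt 𝓘(ℝ, E) p).target) :
    chartSymmDeriv p y (coordField X p y) = X ((extChartAt 𝓘(ℝ, E) p).symm y) :=
  chartSymmDeriv_chartDeriv hy _

/-- Smoothness of a section of the tangent bundle is tested in trivializations, while the
computations below use `chartDeriv`; this identifies the two. -/
lemma trivializationAt_snd_eq {p x : M} (hx : x ∈ (extChartAt 𝓘(ℝ, E) p).source)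
    (v : TangentSpace 𝓘(ℝ, E) x) :
    (trivializationAt E (TangentSpace 𝓘(ℝ, E)) p (⟨x, v⟩ : TangentBundle 𝓘(ℝ, E) M)).2 =
      chartDeriv p x v := by
  have : IsManifold 𝓘(ℝ, E) 1 M := .of_le (n := ∞) (by norm_cast)
  have hx' : x ∈ (chartAt E p).source := by rwa [extChartAt_source] at hx
  have h := TangentBundle.continuousLinearMapAt_trivializationAt (I := 𝓘(ℝ, E)) (x₀ := p) hx'
  have h2 : Trivialization.continuousLinearMapAt ℝ
      (trivializationAt E (TangentSpace 𝓘(ℝ, E)) p) x = chartDeriv p x := h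
  rw [← h2, Trivialization.continuousLinearMapAt_apply, Trivialization.coe_linearMapAt_of_mem]
  exact hx'

lemma contDiffOn_coordField (p : M)
    (hX : ContMDiff 𝓘(ℝ, E) 𝓘(ℝ, E).tangent ∞ fun x ↦ (⟨x, X x⟩ : TangentBundle 𝓘(ℝ, E) M)) :
    ContDiffOn ℝ ∞ (coordField X p) (extChartAt 𝓘(ℝ, E) p).target := by
  intro y hy
  have hx := (extChartAt 𝓘(ℝ, E) p).map_target hy
  have h1 := (((trivializationAt E (TangentSpace 𝓘(ℝ, E)) p).contMDiffAt_iff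
    (IB := 𝓘(ℝ, E)) (IM := 𝓘(ℝ, E)) (n := ∞)
    (f := fun x ↦ (⟨x, X x⟩ : TangentBundle 𝓘(ℝ, E) M)) (x₀ := (extChartAt 𝓘(ℝ, E) p).symm y)
    (by rw [Trivialization.mem_source]; simpa [extChartAt_source] using hx)).1 (hX _)).2
  have h2 := (h1.comp y (contMDiffAt_chart_symm hy)).contDiffAt
  refine (h2.congr_of_eventuallyEq ?_).contDiffWithinAt
  filter_upwards [(isOpen_extChartAt_target p).mem_nhds hy] with z hz
  exact (trivializationAt_snd_eq ((extChartAt 𝓘(ℝ, E) p).map_target hz) _).symm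

lemma contMDiff_of_contDiffAt_coordField
    (hX : ∀ p, ContDiffAt ℝ ∞ (coordField X p) (extChartAt 𝓘(ℝ, E) p p)) :
    ContMDiff 𝓘(ℝ, E) 𝓘(ℝ, E).tangent ∞ fun x ↦ (⟨x, X x⟩ : TangentBundle 𝓘(ℝ, E) M) := by
  intro p
  rw [(trivializationAt E (TangentSpace 𝓘(ℝ, E)) p).contMDiffAt_iff
    (by rw [Trivialization.mem_source]; simp)]
  refine ⟨contMDiffAt_id, ?_⟩
  refine ((hX p).contMDiffAt.comp p (contMDiffAt_chart (mem_extChartAt_source p))).congr_of_eventuallyEq ?_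
  filter_upwards [extChartAt_source_mem_nhds (I := 𝓘(ℝ, E)) p] with x hx
  rw [trivializationAt_snd_eq hx, Function.comp_apply, coordField,
    (extChartAt 𝓘(ℝ, E) p).left_inv hx]

lemma ContMDiff.vectorField_one
    (hX : ContMDiff 𝓘(ℝ, E) 𝓘(ℝ, E).tangent ∞ fun x ↦ (⟨x, X x⟩ : TangentBundle 𝓘(ℝ, E) M)) :
    ContMDiff 𝓘(ℝ, E) 𝓘(ℝ, E).tangent 1 fun x ↦ (⟨x, X x⟩ : TangentBundle 𝓘(ℝ, E) M) :=
  hX.of_le (by norm_cast)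

end ChartBasics

/-! ### The maximal flow of a vector field: open domain and smoothness -/

section Flow

variable {F : Type*} [NormedAddCommGroup F] [NormedSpace ℝ F]
  {N : Type*} [TopologicalSpace N] [ChartedSpace F N]

/-- The domain of the maximal flow of a vector field. -/
def flowDomain (X : (x : N) → TangentSpace 𝓘(ℝ, F) x) : Set (ℝ × N) :=
  {w | ∃ (c : ℝ → N) (a b : ℝ), (0 : ℝ) ∈ Ioo a b ∧ w.1 ∈ Ioo a b ∧ c 0 = w.2 ∧
    IsMIntegralCurveOn c X (Ioo a b)}

open Classical in
/-- The maximal flow of a vector field; it takes junk values outside `flowDomain X`. -/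
def flowMap (X : (x : N) → TangentSpace 𝓘(ℝ, F) x) (t : ℝ) (x : N) : N :=
  if h : (t, x) ∈ flowDomain X then h.choose t else x

variable {X : (x : N) → TangentSpace 𝓘(ℝ, F) x} [IsManifold 𝓘(ℝ, F) ∞ N] [T2Space N]

/-- Integral curves are unique, by Hausdorffness of `N`, so the curve chosen in `flowMap` can be
replaced by any other on the common interval. -/
lemma flowMap_eq
    (hX : ContMDiff 𝓘(ℝ, F) 𝓘(ℝ, F).tangent ∞ fun x ↦ (⟨x, X x⟩ : TangentBundle 𝓘(ℝ, F) N))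
    {c : ℝ → N} {a b t : ℝ} {x : N} (h0 : (0 : ℝ) ∈ Ioo a b) (ht : t ∈ Ioo a b) (hc : c 0 = x)
    (h : IsMIntegralCurveOn c X (Ioo a b)) : (t, x) ∈ flowDomain X ∧ flowMap X t x = c t := by
  have : IsManifold 𝓘(ℝ, F) 1 N := .of_le (n := ∞) (by norm_cast)
  have hD : (t, x) ∈ flowDomain X := ⟨c, a, b, h0, ht, hc, h⟩
  refine ⟨hD, ?_⟩
  rw [flowMap, dif_pos hD]
  obtain ⟨a', b', h0', ht', hc', h'⟩ := hD.choose_spec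
  set c' := hD.choose
  have hsub1 : Ioo (max a a') (min b b') ⊆ Ioo a b :=
    Ioo_subset_Ioo (le_max_left _ _) (min_le_left _ _)
  have hsub2 : Ioo (max a a') (min b b') ⊆ Ioo a' b' :=
    Ioo_subset_Ioo (le_max_right _ _) (min_le_right _ _)
  refine isMIntegralCurveOn_Ioo_eqOn_of_contMDiff_boundaryless
    (a := max a a') (b := min b b') (t₀ := 0) ?_ hX.vectorField_one (h'.mono hsub2) (h.mono hsub1)
    (hc'.trans hc.symm) ?_
  · exact ⟨max_lt h0.1 h0'.1, lt_min h0.2 h0'.2⟩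
  · exact ⟨max_lt ht.1 ht'.1, lt_min ht.2 ht'.2⟩

lemma flowMap_eq_of_isMIntegralCurve
    (hX : ContMDiff 𝓘(ℝ, F) 𝓘(ℝ, F).tangent ∞ fun x ↦ (⟨x, X x⟩ : TangentBundle 𝓘(ℝ, F) N))
    {c : ℝ → N} (h : IsMIntegralCurve c X) (t : ℝ) :
    (t, c 0) ∈ flowDomain X ∧ flowMap X t (c 0) = c t :=
  flowMap_eq hX (a := -(|t| + 1)) (b := |t| + 1) ⟨by linarith [abs_nonneg t], by positivity⟩
    ⟨by linarith [neg_abs_le t], by linarith [le_abs_self t]⟩ rfl (h.isMIntegralCurveOn _)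

/-- The curve through `flowMap X s x`, shifted in time by `s`, is glued to the curve through `x`.
The domains overlap at `s`, so their union is an interval and contains `r + s`. -/
lemma flowMap_add
    (hX : ContMDiff 𝓘(ℝ, F) 𝓘(ℝ, F).tangent ∞ fun x ↦ (⟨x, X x⟩ : TangentBundle 𝓘(ℝ, F) N))
    {s r : ℝ} {x : N} (hs : (s, x) ∈ flowDomain X) (hr : (r, flowMap X s x) ∈ flowDomain X) :
    (r + s, x) ∈ flowDomain X ∧ flowMap X (r + s) x = flowMap X r (flowMap X s x) := by
  have : IsManifold 𝓘(ℝ, F) 1 N := .of_le (n := ∞) (by norm_cast)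
  obtain ⟨c, a, b, h0, hsab, hc, h⟩ := hs
  obtain ⟨c', a', b', h0', hr', hc', h'⟩ := hr
  have hcs : flowMap X s x = c s := (flowMap_eq hX h0 hsab hc h).2
  rw [(flowMap_eq hX h0' hr' hc' h').2]
  have hshift : IsMIntegralCurveOn (c' ∘ (· + -s)) X (Ioo (a' + s) (b' + s)) := by
    have := h'.comp_add (-s)
    refine this.mono fun t ht ↦ ?_
    exact ⟨by linarith [ht.1], by linarith [ht.2]⟩
  have hov : s ∈ Ioo a b ∩ Ioo (a' + s) (b' + s) :=
    ⟨hsab, by linarith [h0'.1], by linarith [h0'.2]⟩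
  have heq : c s = (c' ∘ (· + -s)) s := by
    simp only [Function.comp_apply, add_neg_cancel, hc']
    exact hcs.symm
  classical
  have hpw := isMIntegralCurveOn_piecewise hX.vectorField_one h hshift hov heq
  have hE := eqOn_piecewise_of_isMIntegralCurveOn_Ioo hX.vectorField_one h hshift hov heq
  have hun : Ioo (min a (a' + s)) (max b (b' + s)) ⊆ Ioo a b ∪ Ioo (a' + s) (b' + s) := by
    intro u hu
    by_contra hcon
    simp only [mem_union, mem_Ioo, not_or, not_and, not_lt] at hcon
    rcases lt_or_ge u s with hlt | hge
    · have h1 : a < u ∨ a' + s < u := min_lt_iff.1 hu.1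
      rcases h1 with h1 | h1
      · linarith [hcon.1 h1, hsab.2]
      · linarith [hcon.2 h1, hov.2.2]
    · have h1 : u < b ∨ u < b' + s := lt_max_iff.1 hu.2
      rcases h1 with h1 | h1
      · linarith [hcon.1 (by linarith [hsab.1])]
      · linarith [hcon.2 (by linarith [hov.2.1])]
  have key := flowMap_eq hX (x := x) (t := r + s) (c := piecewise (Ioo a b) c (c' ∘ (· + -s)))
    (a := min a (a' + s)) (b := max b (b' + s)) ⟨(min_le_left _ _).trans_lt h0.1,
      h0.2.trans_le (le_max_left _ _)⟩
    ⟨(min_le_right _ _).trans_lt (by linarith [hr'.1]),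
      lt_of_lt_of_le (by linarith [hr'.2]) (le_max_right _ _)⟩
    (by rw [piecewise_eq_of_mem _ _ _ h0, hc]) (hpw.mono hun)
  refine ⟨key.1, ?_⟩
  rw [key.2, hE (x := r + s) ⟨by linarith [hr'.1], by linarith [hr'.2]⟩]
  simp

lemma flowMap_zero
    (hX : ContMDiff 𝓘(ℝ, F) 𝓘(ℝ, F).tangent ∞ fun x ↦ (⟨x, X x⟩ : TangentBundle 𝓘(ℝ, F) N))
    {x : N} (h : (0, x) ∈ flowDomain X) : flowMap X 0 x = x := by
  obtain ⟨c, a, b, h0, h1, hc, h⟩ := h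
  rw [(flowMap_eq hX h0 h1 hc h).2, hc]

lemma hasMFDerivAt_flowMap
    (hX : ContMDiff 𝓘(ℝ, F) 𝓘(ℝ, F).tangent ∞ fun x ↦ (⟨x, X x⟩ : TangentBundle 𝓘(ℝ, F) N))
    {t : ℝ} {x : N} (h : (t, x) ∈ flowDomain X) :
    HasMFDerivAt 𝓘(ℝ, ℝ) 𝓘(ℝ, F) (fun s ↦ flowMap X s x) t
      ((1 : ℝ →L[ℝ] ℝ).smulRight (X (flowMap X t x))) := by
  obtain ⟨c, a, b, h0, ht, hc, h⟩ := h
  rw [(flowMap_eq hX h0 ht hc h).2]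
  refine ((h t ht).hasMFDerivAt (isOpen_Ioo.mem_nhds ht)).congr_of_eventuallyEq ?_
  filter_upwards [isOpen_Ioo.mem_nhds ht] with s hs using (flowMap_eq hX h0 hs hc h).2

lemma eventually_flowMap_zero [FiniteDimensional ℝ F]
    (hX : ContMDiff 𝓘(ℝ, F) 𝓘(ℝ, F).tangent ∞ fun x ↦ (⟨x, X x⟩ : TangentBundle 𝓘(ℝ, F) N))
    (p : N) : ∀ᶠ w : ℝ × N in 𝓝 (0, p), w ∈ flowDomain X ∧
      ContMDiffAt (𝓘(ℝ, ℝ).prod 𝓘(ℝ, F)) 𝓘(ℝ, F) ∞ (fun w : ℝ × N ↦ flowMap X w.1 w.2) w := by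
  obtain ⟨ψ, ε, hε, h1, h2, h3⟩ := exists_contDiffOn_local_flow_of_isOpen
    (isOpen_extChartAt_target p) (contDiffOn_coordField p hX) (mem_extChartAt_target p)
  set e := extChartAt 𝓘(ℝ, F) p
  let W : Set N := e.source ∩ e ⁻¹' Metric.ball (e p) ε
  have hW : IsOpen W := by
    have := (continuousOn_extChartAt (I := 𝓘(ℝ, F)) p).isOpen_inter_preimage
      (isOpen_extChartAt_source p) (Metric.isOpen_ball (x := e p) (ε := ε))
    exact this
  have hpW : p ∈ W := ⟨mem_extChartAt_source p, Metric.mem_ball_self hε⟩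
  have key : ∀ t ∈ Ioo (-ε) ε, ∀ x ∈ W, (t, x) ∈ flowDomain X ∧
      flowMap X t x = e.symm (ψ (t, e x)) := by
    intro t ht x hx
    refine flowMap_eq hX (c := fun s ↦ e.symm (ψ (s, e x))) ⟨by linarith, hε⟩ ht ?_ ?_
    · simp only [h2 _ hx.2, e.left_inv hx.1]
    · intro s hs
      obtain ⟨hU, hd⟩ := h3 s hs _ hx.2
      have hm := hd.hasMFDerivAt_chart_symm hU
      rw [chartSymmDeriv_coordField hU] at hm
      exact hm.hasMFDerivWithinAt
  have hO : IsOpen (Ioo (-ε) ε ×ˢ W) := isOpen_Ioo.prod hW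
  filter_upwards [hO.mem_nhds ⟨⟨by linarith, hε⟩, hpW⟩] with w hw
  refine ⟨(key _ hw.1 _ hw.2).1, ?_⟩
  have hs : ContMDiffAt (𝓘(ℝ, ℝ).prod 𝓘(ℝ, F)) 𝓘(ℝ, F) ∞
      (fun w : ℝ × N ↦ e.symm (ψ (w.1, e w.2))) w := by
    have a1 : ContMDiffAt (𝓘(ℝ, ℝ).prod 𝓘(ℝ, F)) (𝓘(ℝ, ℝ × F)) ∞
        (fun w : ℝ × N ↦ (w.1, e w.2)) w := by
      apply ContMDiffAt.prodMk_space
      · exact contMDiffAt_fst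
      · exact (contMDiffAt_chart hw.2.1).comp w contMDiffAt_snd
    have a2 : ContMDiffAt 𝓘(ℝ, ℝ × F) 𝓘(ℝ, F) ∞ ψ (w.1, e w.2) :=
      (h1.contDiffAt ((isOpen_Ioo.prod Metric.isOpen_ball).mem_nhds (mk_mem_prod hw.1 hw.2.2))).contMDiffAt
    exact (contMDiffAt_chart_symm (h3 _ hw.1 _ hw.2.2).1).comp w (a2.comp w a1)
  refine hs.congr_of_eventuallyEq ?_
  filter_upwards [hO.mem_nhds hw] with w' hw' using (key _ hw'.1 _ hw'.2).2

/-- Near `(r, x)` the flow is the flow for the remaining time after the flow for time `s`, a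
composition of smooth maps. This is the step that continues smoothness along an integral curve. -/
lemma eventually_flowMap_of_add
    (hX : ContMDiff 𝓘(ℝ, F) 𝓘(ℝ, F).tangent ∞ fun x ↦ (⟨x, X x⟩ : TangentBundle 𝓘(ℝ, F) N))
    {x : N} {s r : ℝ}
    (hs : ∀ᶠ w : ℝ × N in 𝓝 (s, x), w ∈ flowDomain X ∧
      ContMDiffAt (𝓘(ℝ, ℝ).prod 𝓘(ℝ, F)) 𝓘(ℝ, F) ∞ (fun w : ℝ × N ↦ flowMap X w.1 w.2) w)
    (hr : ∀ᶠ w : ℝ × N in 𝓝 (r - s, flowMap X s x), w ∈ flowDomain X ∧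
      ContMDiffAt (𝓘(ℝ, ℝ).prod 𝓘(ℝ, F)) 𝓘(ℝ, F) ∞ (fun w : ℝ × N ↦ flowMap X w.1 w.2) w) :
    ∀ᶠ w : ℝ × N in 𝓝 (r, x), w ∈ flowDomain X ∧
      ContMDiffAt (𝓘(ℝ, ℝ).prod 𝓘(ℝ, F)) 𝓘(ℝ, F) ∞ (fun w : ℝ × N ↦ flowMap X w.1 w.2) w := by
  have hslice : ∀ᶠ w : ℝ × N in 𝓝 (r, x), (s, w.2) ∈ flowDomain X ∧
      ContMDiffAt (𝓘(ℝ, ℝ).prod 𝓘(ℝ, F)) 𝓘(ℝ, F) ∞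
        (fun w : ℝ × N ↦ flowMap X w.1 w.2) (s, w.2) := by
    have hc : ContinuousAt (fun w : ℝ × N ↦ (s, w.2)) (r, x) := by fun_prop
    exact hc.eventually hs
  let T : ℝ × N → ℝ × N := fun w ↦ (w.1 - s, flowMap X s w.2)
  have hT : ∀ w : ℝ × N, ContMDiffAt (𝓘(ℝ, ℝ).prod 𝓘(ℝ, F)) 𝓘(ℝ, F) ∞
        (fun w : ℝ × N ↦ flowMap X w.1 w.2) (s, w.2) →
      ContMDiffAt (𝓘(ℝ, ℝ).prod 𝓘(ℝ, F)) (𝓘(ℝ, ℝ).prod 𝓘(ℝ, F)) ∞ T w := by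
    intro w hw
    apply ContMDiffAt.prodMk
    · exact (contDiff_id.sub contDiff_const).contMDiff.contMDiffAt.comp w contMDiffAt_fst
    · exact ContMDiffAt.comp w (f := fun w : ℝ × N ↦ (s, w.2)) hw
        (contMDiffAt_const.prodMk contMDiffAt_snd)
  have hev := (hT _ hslice.self_of_nhds.2).continuousAt.eventually (p := fun w ↦ w ∈ flowDomain X ∧
      ContMDiffAt (𝓘(ℝ, ℝ).prod 𝓘(ℝ, F)) 𝓘(ℝ, F) ∞ (fun w : ℝ × N ↦ flowMap X w.1 w.2) w) hr
  have hgrp : ∀ᶠ w : ℝ × N in 𝓝 (r, x), w ∈ flowDomain X ∧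
      flowMap X w.1 w.2 = flowMap X (T w).1 (T w).2 := by
    filter_upwards [hslice, hev] with w hw1 hw2
    have := flowMap_add hX hw1.1 hw2.1
    simpa [T] using this
  filter_upwards [hslice, hev, hgrp.eventually_nhds] with w hw1 hw2 hw3
  refine ⟨hw3.self_of_nhds.1, ?_⟩
  exact (hw2.2.comp w (hT w hw1.2)).congr_of_eventuallyEq (hw3.mono fun _ h ↦ h.2)

/-- The flow domain of a smooth vector field is open and the flow is smooth there. -/
theorem eventually_flowMap [FiniteDimensional ℝ F]
    (hX : ContMDiff 𝓘(ℝ, F) 𝓘(ℝ, F).tangent ∞ fun x ↦ (⟨x, X x⟩ : TangentBundle 𝓘(ℝ, F) N))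
    {w₀ : ℝ × N} (hw₀ : w₀ ∈ flowDomain X) :
    ∀ᶠ w : ℝ × N in 𝓝 w₀, w ∈ flowDomain X ∧
      ContMDiffAt (𝓘(ℝ, ℝ).prod 𝓘(ℝ, F)) 𝓘(ℝ, F) ∞ (fun w : ℝ × N ↦ flowMap X w.1 w.2) w := by
  obtain ⟨t, x⟩ := w₀
  obtain ⟨c, a, b, h0, ht, hc, h⟩ := hw₀
  let Good : ℝ → Prop := fun s ↦ ∀ᶠ w : ℝ × N in 𝓝 (s, x), w ∈ flowDomain X ∧
      ContMDiffAt (𝓘(ℝ, ℝ).prod 𝓘(ℝ, F)) 𝓘(ℝ, F) ∞ (fun w : ℝ × N ↦ flowMap X w.1 w.2) w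
  have hG0 : Good 0 := eventually_flowMap_zero hX x
  suffices Good 0 ↔ Good t from this.1 hG0
  -- `Good` is shown to be locally constant on the interval, hence constant, and it holds at 0.
  refine isPreconnected_Ioo.induction₂ (s := Ioo a b) (fun s r ↦ Good s ↔ Good r) ?_
    (fun _ _ _ _ _ _ ↦ Iff.trans) (fun _ _ _ _ ↦ Iff.symm) h0 ht
  intro t₁ ht₁
  have hloc := (eventually_flowMap_zero hX (c t₁)).eventually_nhds
  have hcc : ContinuousAt c t₁ := (h.continuousOn).continuousAt (isOpen_Ioo.mem_nhds ht₁)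
  -- The local result at time 0 near `c t₁` covers both short steps needed: from `t₁` to `r`
  -- starting at `c t₁`, and from `r` back to `t₁` starting at `c r`.
  have e1 : ∀ᶠ r in 𝓝 t₁, ∀ᶠ w : ℝ × N in 𝓝 (r - t₁, c t₁), w ∈ flowDomain X ∧
      ContMDiffAt (𝓘(ℝ, ℝ).prod 𝓘(ℝ, F)) 𝓘(ℝ, F) ∞
        (fun w : ℝ × N ↦ flowMap X w.1 w.2) w := by
    have hc1 : ContinuousAt (fun r : ℝ ↦ (r - t₁, c t₁)) t₁ := by fun_prop
    rw [ContinuousAt, sub_self] at hc1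
    exact hc1.eventually hloc
  have e2 : ∀ᶠ r in 𝓝 t₁, ∀ᶠ w : ℝ × N in 𝓝 (t₁ - r, c r), w ∈ flowDomain X ∧
      ContMDiffAt (𝓘(ℝ, ℝ).prod 𝓘(ℝ, F)) 𝓘(ℝ, F) ∞
        (fun w : ℝ × N ↦ flowMap X w.1 w.2) w := by
    have hc1 : ContinuousAt (fun r : ℝ ↦ (t₁ - r, c r)) t₁ := by fun_prop
    rw [ContinuousAt, sub_self] at hc1
    exact hc1.eventually hloc
  have hfl : ∀ r ∈ Ioo a b, flowMap X r x = c r := fun r hr ↦ (flowMap_eq hX h0 hr hc h).2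
  filter_upwards [mem_nhdsWithin_of_mem_nhds e1, mem_nhdsWithin_of_mem_nhds e2,
    self_mem_nhdsWithin] with r hr1 hr2 hr
  constructor
  · intro hg
    exact eventually_flowMap_of_add hX hg (by rwa [hfl _ ht₁])
  · intro hg
    exact eventually_flowMap_of_add hX hg (by rwa [hfl _ hr])

end Flow

/-! ### Christoffel symbols, the Gauss formula and Lie derivatives in coordinates -/

section MetricCalculus

set_option synthInstance.maxHeartbeats 200000

variable {E : Type*} [NormedAddCommGroup E] [NormedSpace ℝ E]
  {F : Type*} [NormedAddCommGroup F] [NormedSpace ℝ F]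

/-- Christoffel symbols of the first kind of a field of bilinear forms on a vector space. -/
def christoffelForm (G : E → E →L[ℝ] E →L[ℝ] ℝ) (y u v w : E) : ℝ :=
  (fderiv ℝ G y u v w + fderiv ℝ G y v u w - fderiv ℝ G y w u v) / 2

/-- The Lie derivative of a field of bilinear forms along a vector field. -/
def lieForm (G : E → E →L[ℝ] E →L[ℝ] ℝ) (X : E → E) (y u v : E) : ℝ :=
  fderiv ℝ G y (X y) u v + G y (fderiv ℝ X y u) v + G y u (fderiv ℝ X y v)

variable {G : E → E →L[ℝ] E →L[ℝ] ℝ} {H : F → F →L[ℝ] F →L[ℝ] ℝ} {φ : F → E} {y₀ : F}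

lemma fderiv_symm_of_symm {G : E → E →L[ℝ] E →L[ℝ] ℝ} {y : E} (hG : DifferentiableAt ℝ G y)
    (hs : ∀ᶠ x in 𝓝 y, ∀ u v, G x u v = G x v u) (u v w : E) :
    fderiv ℝ G y u v w = fderiv ℝ G y u w v := by
  have h : ∀ v w, HasFDerivAt (fun x ↦ G x v w) (((fderiv ℝ G y).flip v).flip w) y := by
    intro v w
    have := (hG.hasFDerivAt.clm_apply (hasFDerivAt_const v y)).clm_apply (hasFDerivAt_const w y)
    refine this.congr_fderiv ?_
    ext u
    simp
  have h2 := (h w v).congr_of_eventuallyEq (f₁ := fun x ↦ G x v w) (hs.mono fun x hx ↦ hx v w)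
  exact DFunLike.congr_fun ((h v w).unique h2) u

/-- This is the product rule on both sides of `h`. It serves twice: with constant `A` and `B` for an
induced metric, and with `A` the tangential part of a field for the defining identity of that part.
-/
lemma fderiv_apply₂_of_pullback {Z W : F → E} {A B : F → F} {Z' W' : F →L[ℝ] E} {A' B' : F →L[ℝ] F}
    (hH : DifferentiableAt ℝ H y₀) (hG : DifferentiableAt ℝ G (φ y₀)) (hφ : DifferentiableAt ℝ φ y₀)
    (hA : HasFDerivAt A A' y₀) (hB : HasFDerivAt B B' y₀)
    (hZ : HasFDerivAt Z Z' y₀) (hW : HasFDerivAt W W' y₀)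
    (h : ∀ᶠ y in 𝓝 y₀, H y (A y) (B y) = G (φ y) (Z y) (W y)) (u : F) :
    fderiv ℝ H y₀ u (A y₀) (B y₀) + H y₀ (A' u) (B y₀) + H y₀ (A y₀) (B' u) =
      fderiv ℝ G (φ y₀) (fderiv ℝ φ y₀ u) (Z y₀) (W y₀) + G (φ y₀) (Z' u) (W y₀)
        + G (φ y₀) (Z y₀) (W' u) := by
  have h1 := (hH.hasFDerivAt.clm_apply hA).clm_apply hB
  have hGφ : HasFDerivAt (fun y ↦ G (φ y)) ((fderiv ℝ G (φ y₀)).comp (fderiv ℝ φ y₀)) y₀ :=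
    HasFDerivAt.comp (g := G) y₀ hG.hasFDerivAt hφ.hasFDerivAt
  have h2 := (hGφ.clm_apply hZ).clm_apply hW
  have h3 := DFunLike.congr_fun ((h1.congr_of_eventuallyEq
    (f₁ := fun y ↦ G (φ y) (Z y) (W y)) (h.mono fun _ h ↦ h.symm)).unique h2) u
  simp only [add_apply, ContinuousLinearMap.comp_apply,
    ContinuousLinearMap.flip_apply] at h3
  linarith

lemma fderiv_pullback (hH : DifferentiableAt ℝ H y₀) (hG : DifferentiableAt ℝ G (φ y₀))
    (hφ : ContDiffAt ℝ 2 φ y₀)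
    (hind : ∀ᶠ y in 𝓝 y₀, ∀ u v, H y u v = G (φ y) (fderiv ℝ φ y u) (fderiv ℝ φ y v))
    (u v w : F) :
    fderiv ℝ H y₀ u v w = fderiv ℝ G (φ y₀) (fderiv ℝ φ y₀ u) (fderiv ℝ φ y₀ v) (fderiv ℝ φ y₀ w)
      + G (φ y₀) (fderiv ℝ (fderiv ℝ φ) y₀ u v) (fderiv ℝ φ y₀ w)
      + G (φ y₀) (fderiv ℝ φ y₀ v) (fderiv ℝ (fderiv ℝ φ) y₀ u w) := by
  have h2 : DifferentiableAt ℝ (fderiv ℝ φ) y₀ :=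
    (hφ.fderiv_right (m := 1) (by norm_num)).differentiableAt one_ne_zero
  have hd : ∀ v, HasFDerivAt (fun y ↦ fderiv ℝ φ y v) ((fderiv ℝ (fderiv ℝ φ) y₀).flip v) y₀ := by
    intro v
    refine (h2.hasFDerivAt.clm_apply (hasFDerivAt_const v y₀)).congr_fderiv ?_
    ext; simp
  have := fderiv_apply₂_of_pullback hH hG (hφ.differentiableAt two_ne_zero)
    (hasFDerivAt_const v y₀) (hasFDerivAt_const w y₀) (hd v) (hd w)
    (hind.mono fun y hy ↦ hy v w) u
  simpa using this

lemma fderiv_fderiv_symm (hφ : ContDiffAt ℝ 2 φ y₀) (u v : F) :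
    fderiv ℝ (fderiv ℝ φ) y₀ u v = fderiv ℝ (fderiv ℝ φ) y₀ v u :=
  (hφ.isSymmSndFDerivAt (by simp)) u v

/-- **Gauss formula** for the Christoffel symbols of an induced metric. -/
lemma christoffelForm_pullback (hH : DifferentiableAt ℝ H y₀) (hG : DifferentiableAt ℝ G (φ y₀))
    (hGs : ∀ᶠ y in 𝓝 (φ y₀), ∀ u v, G y u v = G y v u) (hφ : ContDiffAt ℝ 2 φ y₀)
    (hind : ∀ᶠ y in 𝓝 y₀, ∀ u v, H y u v = G (φ y) (fderiv ℝ φ y u) (fderiv ℝ φ y v))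
    (u v z : F) :
    christoffelForm H y₀ u v z = G (φ y₀) (fderiv ℝ (fderiv ℝ φ) y₀ u v) (fderiv ℝ φ y₀ z)
      + christoffelForm G (φ y₀) (fderiv ℝ φ y₀ u) (fderiv ℝ φ y₀ v) (fderiv ℝ φ y₀ z) := by
  simp only [christoffelForm, fderiv_pullback hH hG hφ hind]
  -- Of the six terms containing second derivatives of `φ`, four cancel by symmetry and two add up,
  -- absorbing the factor 1/2.
  rw [fderiv_fderiv_symm hφ v u, fderiv_fderiv_symm hφ z u, fderiv_fderiv_symm hφ z v]
  rw [hGs.self_of_nhds (fderiv ℝ φ y₀ v) (fderiv ℝ (fderiv ℝ φ) y₀ u z)]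
  ring

lemma surjective_of_nondegenerate [FiniteDimensional ℝ F] {B : F →L[ℝ] F →L[ℝ] ℝ}
    (hB : ∀ v, (∀ w, B v w = 0) → v = 0) : Function.Surjective B := by
  have hinj : Function.Injective (LinearMap.toContinuousLinearMap.symm.toLinearMap ∘ₗ
      (B : F →ₗ[ℝ] F →L[ℝ] ℝ) : F →ₗ[ℝ] Module.Dual ℝ F) := by
    rw [injective_iff_map_eq_zero]
    intro v hv
    exact hB v fun w ↦ by simpa using DFunLike.congr_fun hv w
  have hs := (LinearMap.injective_iff_surjective_of_finrank_eq_finrank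
    (Subspace.dual_finrank_eq (K := ℝ) (V := F)).symm).1 hinj
  intro f
  obtain ⟨v, hv⟩ := hs (f : F →ₗ[ℝ] ℝ)
  refine ⟨v, ?_⟩
  ext w
  simpa using DFunLike.congr_fun hv w

lemma isInvertible_of_nondegenerate [FiniteDimensional ℝ F] {B : F →L[ℝ] F →L[ℝ] ℝ}
    (hB : ∀ v, (∀ w, B v w = 0) → v = 0) : B.IsInvertible := by
  have hinj : Function.Injective (B : F →ₗ[ℝ] F →L[ℝ] ℝ) := by
    rw [injective_iff_map_eq_zero]
    intro v hv
    exact hB v fun w ↦ by simpa using DFunLike.congr_fun hv w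
  exact ⟨(LinearEquiv.ofBijective (B : F →ₗ[ℝ] F →L[ℝ] ℝ)
    ⟨hinj, surjective_of_nondegenerate hB⟩).toContinuousLinearEquiv, by ext; rfl⟩

/-- Orthogonal decomposition with respect to a nondegenerate subspace. -/
lemma exists_sub_normal [FiniteDimensional ℝ F] {B : F →L[ℝ] F →L[ℝ] ℝ} {C : E →L[ℝ] E →L[ℝ] ℝ}
    {L : F →L[ℝ] E} (hB : ∀ v, (∀ w, B v w = 0) → v = 0) (hBC : ∀ u v, B u v = C (L u) (L v))
    (hC : ∀ u v, C u v = C v u) (w : E) : ∃ z, ∀ z', C (L z') (w - L z) = 0 := by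
  obtain ⟨z, hz⟩ := surjective_of_nondegenerate hB ((C w).comp L)
  refine ⟨z, fun z' ↦ ?_⟩
  have := DFunLike.congr_fun hz z'
  simp only [ContinuousLinearMap.comp_apply, hBC] at this
  rw [map_sub, hC _ w, hC _ (L z), this, sub_self]

lemma christoffelForm_add (y u v w w' : E) :
    christoffelForm G y u v (w + w') = christoffelForm G y u v w + christoffelForm G y u v w' := by
  simp only [christoffelForm, map_add, add_apply]; ring

lemma christoffelForm_zero (y u v : E) : christoffelForm G y u v 0 = 0 := by
  simp [christoffelForm]

/-- The test vector `w` is split into a tangential and a normal part. On the former the Gauss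
formula gives the geodesic equation for `H`; on the latter the second fundamental form, hypothesis
`htot`, vanishes. By the chain rule, `D²φ(u,u) + Dφ a` is the second derivative of the image of a
curve with velocity `u` and acceleration `a`. -/
lemma geodesic_equation_map [FiniteDimensional ℝ F]
    (hH : DifferentiableAt ℝ H y₀) (hHn : ∀ v, (∀ w, H y₀ v w = 0) → v = 0)
    (hG : DifferentiableAt ℝ G (φ y₀))
    (hGs : ∀ᶠ y in 𝓝 (φ y₀), ∀ u v, G y u v = G y v u) (hφ : ContDiffAt ℝ 2 φ y₀)
    (hind : ∀ᶠ y in 𝓝 y₀, ∀ u v, H y u v = G (φ y) (fderiv ℝ φ y u) (fderiv ℝ φ y v))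
    {u a : F} (hgeo : ∀ z, H y₀ a z + christoffelForm H y₀ u u z = 0)
    (htot : ∀ w, (∀ z, G (φ y₀) (fderiv ℝ φ y₀ z) w = 0) →
      G (φ y₀) (fderiv ℝ (fderiv ℝ φ) y₀ u u) w
        + christoffelForm G (φ y₀) (fderiv ℝ φ y₀ u) (fderiv ℝ φ y₀ u) w = 0) (w : E) :
    G (φ y₀) (fderiv ℝ (fderiv ℝ φ) y₀ u u + fderiv ℝ φ y₀ a) w
      + christoffelForm G (φ y₀) (fderiv ℝ φ y₀ u) (fderiv ℝ φ y₀ u) w = 0 := by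
  obtain ⟨z, hz⟩ := exists_sub_normal hHn hind.self_of_nhds hGs.self_of_nhds w
  have h1 := htot _ hz
  have h2 := hgeo z
  rw [christoffelForm_pullback hH hG hGs hφ hind, hind.self_of_nhds] at h2
  have h3 := hz a
  obtain ⟨ν, hν⟩ : ∃ ν, ν = w - fderiv ℝ φ y₀ z := ⟨_, rfl⟩
  rw [← hν] at h1 h3
  rw [show w = fderiv ℝ φ y₀ z + ν by rw [hν]; abel, christoffelForm_add]
  simp only [map_add, add_apply]
  linarith

/-- Write ξ = Dφ X + ν with ν normal. Then H(∇ᵤX, v) = G(∇ᵤξ, v) + G(ν, II(u,v)), where `u` and `v`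
are identified with their images under Dφ. The last term vanishes by `htot`, and symmetrizing in
`u`, `v` gives the Lie derivative of `G` along ξ, which is zero. -/
lemma lieForm_eq_zero_of_pullback [FiniteDimensional ℝ F] {X : F → F} {ξ : E → E}
    (hH : DifferentiableAt ℝ H y₀) (hHs : ∀ᶠ y in 𝓝 y₀, ∀ u v, H y u v = H y v u)
    (hG : DifferentiableAt ℝ G (φ y₀))
    (hGs : ∀ᶠ y in 𝓝 (φ y₀), ∀ u v, G y u v = G y v u) (hφ : ContDiffAt ℝ 2 φ y₀)
    (hind : ∀ᶠ y in 𝓝 y₀, ∀ u v, H y u v = G (φ y) (fderiv ℝ φ y u) (fderiv ℝ φ y v))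
    (hXd : DifferentiableAt ℝ X y₀) (hξd : DifferentiableAt ℝ ξ (φ y₀))
    (hX : ∀ᶠ y in 𝓝 y₀, ∀ z, H y (X y) z = G (φ y) (ξ (φ y)) (fderiv ℝ φ y z))
    (htot : ∀ u v w, (∀ z, G (φ y₀) (fderiv ℝ φ y₀ z) w = 0) →
      G (φ y₀) (fderiv ℝ (fderiv ℝ φ) y₀ u v) w
        + christoffelForm G (φ y₀) (fderiv ℝ φ y₀ u) (fderiv ℝ φ y₀ v) w = 0)
    (hξ : ∀ u v, lieForm G ξ (φ y₀) u v = 0) (u v : F) : lieForm H X y₀ u v = 0 := by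
  have h2 : DifferentiableAt ℝ (fderiv ℝ φ) y₀ :=
    (hφ.fderiv_right (m := 1) (by norm_num)).differentiableAt one_ne_zero
  have hφd := hφ.differentiableAt two_ne_zero
  have hd : ∀ v, HasFDerivAt (fun y ↦ fderiv ℝ φ y v) ((fderiv ℝ (fderiv ℝ φ) y₀).flip v) y₀ := by
    intro v
    refine (h2.hasFDerivAt.clm_apply (hasFDerivAt_const v y₀)).congr_fderiv ?_
    ext; simp
  -- Differentiating the defining identity `hX` of the tangential part avoids any derivative of ν;
  -- only the value of ν at the point is used later.
  have key : ∀ u v, fderiv ℝ H y₀ u (X y₀) v + H y₀ (fderiv ℝ X y₀ u) v =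
      fderiv ℝ G (φ y₀) (fderiv ℝ φ y₀ u) (ξ (φ y₀)) (fderiv ℝ φ y₀ v)
      + G (φ y₀) (fderiv ℝ ξ (φ y₀) (fderiv ℝ φ y₀ u)) (fderiv ℝ φ y₀ v)
      + G (φ y₀) (ξ (φ y₀)) (fderiv ℝ (fderiv ℝ φ) y₀ u v) := by
    intro u v
    have := fderiv_apply₂_of_pullback hH hG hφd hXd.hasFDerivAt
      (hasFDerivAt_const v y₀) (hξd.hasFDerivAt.comp y₀ hφd.hasFDerivAt) (hd v)
      (hX.mono fun y hy ↦ hy v) u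
    simpa using this
  have hGs0 := hGs.self_of_nhds
  have hHs0 := hHs.self_of_nhds
  obtain ⟨ν, hν⟩ : ∃ ν, ν = ξ (φ y₀) - fderiv ℝ φ y₀ (X y₀) := ⟨_, rfl⟩
  have hnormal : ∀ z, G (φ y₀) (fderiv ℝ φ y₀ z) ν = 0 := by
    intro z
    rw [hν, map_sub, hGs0, ← hX.self_of_nhds, hGs0 _ (fderiv ℝ φ y₀ (X y₀)), ← hind.self_of_nhds,
      sub_self]
  have hξν : ξ (φ y₀) = fderiv ℝ φ y₀ (X y₀) + ν := by rw [hν]; abel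
  have k1 := key u v
  have k2 := key v u
  have k3 := hξ (fderiv ℝ φ y₀ u) (fderiv ℝ φ y₀ v)
  have k4 := htot u v ν hnormal
  have k5 := christoffelForm_pullback hH hG hGs hφ hind u v (X y₀)
  have k6 : christoffelForm G (φ y₀) (fderiv ℝ φ y₀ u) (fderiv ℝ φ y₀ v) (ξ (φ y₀)) =
      christoffelForm G (φ y₀) (fderiv ℝ φ y₀ u) (fderiv ℝ φ y₀ v) (fderiv ℝ φ y₀ (X y₀))
      + christoffelForm G (φ y₀) (fderiv ℝ φ y₀ u) (fderiv ℝ φ y₀ v) ν := by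
    rw [← christoffelForm_add, ← hξν]
  have k7 : G (φ y₀) (ξ (φ y₀)) (fderiv ℝ (fderiv ℝ φ) y₀ u v) =
      G (φ y₀) (fderiv ℝ (fderiv ℝ φ) y₀ u v) (fderiv ℝ φ y₀ (X y₀))
      + G (φ y₀) (fderiv ℝ (fderiv ℝ φ) y₀ u v) ν := by
    rw [hGs0, ← map_add, ← hξν]
  rw [fderiv_fderiv_symm hφ v u] at k2
  have sG : ∀ a b c, fderiv ℝ G (φ y₀) a b c = fderiv ℝ G (φ y₀) a c b := fderiv_symm_of_symm hG hGs
  have sH : ∀ a b c, fderiv ℝ H y₀ a b c = fderiv ℝ H y₀ a c b := fderiv_symm_of_symm hH hHs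
  simp only [lieForm] at k3 ⊢
  simp only [christoffelForm] at k4 k5 k6
  rw [hHs0 u (fderiv ℝ X y₀ v)]
  rw [hGs0 (fderiv ℝ φ y₀ u)] at k3
  rw [sG _ (ξ (φ y₀))] at k1 k2
  rw [sH _ (X y₀)] at k1 k2
  rw [sG (fderiv ℝ φ y₀ v) (fderiv ℝ φ y₀ u)] at k2 
  rw [sH v (u)] at k2
  linarith [sG (fderiv ℝ φ y₀ v) (fderiv ℝ φ y₀ u) (ξ (φ y₀)), sH v u (X y₀)]

/-- Three factors depend on τ: the base point contributes the derivative of `G` along ξ, and each of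
the two differentials contributes Dξ. -/
lemma hasDerivAt_pullback_of_flow {Φ : ℝ × E → E} {ξ : E → E} {y : E}
    (hG : DifferentiableAt ℝ G y) (hΦ : ContDiffAt ℝ 2 Φ (0, y))
    (h0 : ∀ᶠ z in 𝓝 y, Φ (0, z) = z)
    (hξ : ∀ᶠ z in 𝓝 y, HasDerivAt (fun τ ↦ Φ (τ, z)) (ξ z) 0) (u v : E) :
    HasDerivAt (fun τ ↦ G (Φ (τ, y)) (fderiv ℝ (fun z ↦ Φ (τ, z)) y u)
      (fderiv ℝ (fun z ↦ Φ (τ, z)) y v)) (lieForm G ξ y u v) 0 := by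
  have hev : ∀ᶠ w in 𝓝 ((0 : ℝ), y), DifferentiableAt ℝ Φ w := by
    filter_upwards [hΦ.eventually (by simp)] with w hw using hw.differentiableAt two_ne_zero
  have h2 : DifferentiableAt ℝ (fderiv ℝ Φ) (0, y) :=
    (hΦ.fderiv_right (m := 1) (by norm_num)).differentiableAt one_ne_zero
  have hslice : ∀ {τ : ℝ} {z : E}, DifferentiableAt ℝ Φ (τ, z) → ∀ u,
      fderiv ℝ (fun z ↦ Φ (τ, z)) z u = fderiv ℝ Φ (τ, z) (0, u) := by
    intro τ z h u
    have := h.hasFDerivAt.comp z ((hasFDerivAt_const τ z).prodMk (hasFDerivAt_id z))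
    have h' := DFunLike.congr_fun this.fderiv u
    simpa [Function.comp_def] using h'
  have hξ' : ξ =ᶠ[𝓝 y] fun z ↦ fderiv ℝ Φ (0, z) (1, 0) := by
    have hc : ContinuousAt (fun z : E ↦ ((0 : ℝ), z)) y := by fun_prop
    filter_upwards [hc.eventually hev, hξ] with z hz1 hz2
    have := (hz1.hasFDerivAt.comp_hasDerivAt (0 : ℝ)
      ((hasDerivAt_id (0 : ℝ)).prodMk (hasDerivAt_const (0 : ℝ) z)))
    exact hz2.unique this
  have hξd : ∀ u, fderiv ℝ ξ y u = fderiv ℝ (fderiv ℝ Φ) (0, y) (0, u) (1, 0) := by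
    intro u
    rw [hξ'.fderiv_eq]
    have a1 := h2.hasFDerivAt.comp y ((hasFDerivAt_const (0 : ℝ) y).prodMk (hasFDerivAt_id y))
    have a2 := (a1.clm_apply (hasFDerivAt_const ((1 : ℝ), (0 : E)) y)).fderiv
    have a3 := DFunLike.congr_fun a2 u
    simpa [Function.comp_def] using a3
  -- The time derivative of the spatial differential is Dξ, by symmetry of the second derivative of
  -- `Φ` on ℝ × E.
  have hA : ∀ u, HasDerivAt (fun τ ↦ fderiv ℝ (fun z ↦ Φ (τ, z)) y u) (fderiv ℝ ξ y u) 0 := by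
    intro u
    have a1 := h2.hasFDerivAt.comp_hasDerivAt (0 : ℝ)
      ((hasDerivAt_id (0 : ℝ)).prodMk (hasDerivAt_const (0 : ℝ) y))
    have a2 := a1.clm_apply (hasDerivAt_const (0 : ℝ) ((0 : ℝ), u))
    rw [hξd, (hΦ.isSymmSndFDerivAt (by simp)) (0, u) (1, 0)]
    have hc : ContinuousAt (fun τ : ℝ ↦ (τ, y)) 0 := by fun_prop
    refine HasDerivAt.congr_of_eventuallyEq (by simpa using a2) ?_
    filter_upwards [hc.eventually hev] with τ hτ
    simp [hslice hτ]
  have hA0 : ∀ u, fderiv ℝ (fun z ↦ Φ (0, z)) y u = u := by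
    intro u
    rw [Filter.EventuallyEq.fderiv_eq (f := fun z ↦ z) h0]
    simp
  have hb : HasDerivAt (fun τ ↦ Φ (τ, y)) (ξ y) 0 := hξ.self_of_nhds
  have hG' : HasFDerivAt G (fderiv ℝ G y) (Φ (0, y)) := by
    rw [h0.self_of_nhds]; exact hG.hasFDerivAt
  have hGΦ : HasDerivAt (fun τ ↦ G (Φ (τ, y))) (fderiv ℝ G y (ξ y)) 0 :=
    HasFDerivAt.comp_hasDerivAt (l := G) (0 : ℝ) hG' hb
  have h1 := hGΦ.clm_apply (hA u)
  have h2 := h1.clm_apply (hA v)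
  refine h2.congr_deriv ?_
  rw [add_apply, hA0, hA0, h0.self_of_nhds]
  rfl

end MetricCalculus

namespace PseudoRiemannianMetric

/-! ### The metric and the geodesic equation in charts -/

section Charts

set_option synthInstance.maxHeartbeats 200000

variable {E : Type*} [NormedAddCommGroup E] [NormedSpace ℝ E]
  {M : Type*} [TopologicalSpace M] [ChartedSpace E M] [IsManifold 𝓘(ℝ, E) ∞ M]
  (g : PseudoRiemannianMetric E M)

/-- The pullback of a bilinear form by a linear map. -/
def pullbackForm {E F : Type*} [NormedAddCommGroup E] [NormedSpace ℝ E] [NormedAddCommGroup F]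
    [NormedSpace ℝ F] (B : E →L[ℝ] E →L[ℝ] ℝ) (L : F →L[ℝ] E) : F →L[ℝ] F →L[ℝ] ℝ :=
  B.bilinearComp L L

/-- The Gram form of the metric in the preferred chart at `p`. -/
def chartForm (p : M) (y : E) : E →L[ℝ] E →L[ℝ] ℝ :=
  pullbackForm (E := E) (F := E) (g.inner ((extChartAt 𝓘(ℝ, E) p).symm y)) (chartSymmDeriv p y)

lemma chartForm_apply (p : M) (y v w : E) :
    g.chartForm p y v w = g.inner _ (chartSymmDeriv p y v) (chartSymmDeriv p y w) := rfl

lemma inChart_eq (p : M) (v w y : E) : g.inChart p v w y = g.chartForm p y v w := rfl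

lemma chartForm_symm (p : M) (y u v : E) : g.chartForm p y u v = g.chartForm p y v u := by
  rw [chartForm_apply, chartForm_apply, g.symm]

lemma chartForm_nondegenerate {p : M} {y : E} (hy : y ∈ (extChartAt 𝓘(ℝ, E) p).target) (v : E)
    (hv : ∀ w, g.chartForm p y v w = 0) : v = 0 := by
  have h : chartSymmDeriv p y v = 0 := by
    apply g.nondegenerate
    intro w
    have := hv (chartDeriv p _ w)
    rwa [chartForm_apply, chartSymmDeriv_chartDeriv hy] at this
  rw [← chartDeriv_chartSymmDeriv hy v, h, map_zero]

lemma inner_eq_chartForm {p x : M} (hx : x ∈ (extChartAt 𝓘(ℝ, E) p).source)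
    (u v : TangentSpace 𝓘(ℝ, E) x) :
    g.inner x u v =
      g.chartForm p (extChartAt 𝓘(ℝ, E) p x) (chartDeriv p x u) (chartDeriv p x v) := by
  obtain ⟨y, hy, rfl⟩ : ∃ y ∈ (extChartAt 𝓘(ℝ, E) p).target, (extChartAt 𝓘(ℝ, E) p).symm y = x :=
    ⟨_, (extChartAt 𝓘(ℝ, E) p).map_source hx, (extChartAt 𝓘(ℝ, E) p).left_inv hx⟩
  rw [(extChartAt 𝓘(ℝ, E) p).right_inv hy, chartForm_apply, chartSymmDeriv_chartDeriv hy,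
    chartSymmDeriv_chartDeriv hy]

lemma contMDiffAt_chartSymmDeriv {p : M} {y : E} (hy : y ∈ (extChartAt 𝓘(ℝ, E) p).target) (v : E) :
    ContMDiffAt 𝓘(ℝ, E) 𝓘(ℝ, E).tangent ∞
      (fun z ↦ (⟨(extChartAt 𝓘(ℝ, E) p).symm z, chartSymmDeriv p z v⟩ : TangentBundle 𝓘(ℝ, E) M))
      y := by
  have hx := (extChartAt 𝓘(ℝ, E) p).map_target hy
  rw [(trivializationAt E (TangentSpace 𝓘(ℝ, E)) p).contMDiffAt_iff
    (by rw [Trivialization.mem_source]; simpa [extChartAt_source] using hx)]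
  refine ⟨contMDiffAt_chart_symm hy, ?_⟩
  refine (contMDiffAt_const (c := v)).congr_of_eventuallyEq ?_
  filter_upwards [(isOpen_extChartAt_target p).mem_nhds hy] with z hz
  rw [trivializationAt_snd_eq ((extChartAt 𝓘(ℝ, E) p).map_target hz), chartDeriv_chartSymmDeriv hz]

variable [FiniteDimensional ℝ E]

/-- In finite dimension smoothness of a form may be tested on constant vectors, which reduces the
claim to smooth sections paired by the metric. -/
lemma contDiffOn_chartForm (p : M) :
    ContDiffOn ℝ ∞ (g.chartForm p) (extChartAt 𝓘(ℝ, E) p).target := by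
  rw [contDiffOn_clm_apply]
  intro v
  rw [contDiffOn_clm_apply]
  intro w y hy
  have h2 : ContMDiffAt 𝓘(ℝ, E) (𝓘(ℝ, E).prod 𝓘(ℝ)) ∞
      (fun z ↦ TotalSpace.mk' ℝ (E := Bundle.Trivial M ℝ) ((extChartAt 𝓘(ℝ, E) p).symm z)
        (g.inner _ (chartSymmDeriv p z v) (chartSymmDeriv p z w))) y := by
    apply ContMDiffAt.clm_bundle_apply₂ (F₁ := E) (F₂ := E)
    · exact (g.contMDiff _).comp y (contMDiffAt_chart_symm hy)
    · exact contMDiffAt_chartSymmDeriv hy v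
    · exact contMDiffAt_chartSymmDeriv hy w
  simp only [contMDiffAt_totalSpace] at h2
  exact h2.2.contDiffAt.contDiffWithinAt

lemma contDiffAt_chartForm {p : M} {y : E} (hy : y ∈ (extChartAt 𝓘(ℝ, E) p).target) :
    ContDiffAt ℝ ∞ (g.chartForm p) y :=
  (g.contDiffOn_chartForm p).contDiffAt ((isOpen_extChartAt_target p).mem_nhds hy)

lemma differentiableAt_chartForm {p : M} {y : E} (hy : y ∈ (extChartAt 𝓘(ℝ, E) p).target) :
    DifferentiableAt ℝ (g.chartForm p) y :=
  (g.contDiffAt_chartForm hy).differentiableAt (by simp)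

lemma christoffel_eq {p : M} {y : E} (hy : y ∈ (extChartAt 𝓘(ℝ, E) p).target) (u v w : E) :
    g.christoffel p y u v w = christoffelForm (g.chartForm p) y u v w := by
  have h : ∀ a b c, fderiv ℝ (g.inChart p a b) y c = fderiv ℝ (g.chartForm p) y c a b := by
    intro a b c
    have h1 := (g.differentiableAt_chartForm hy).hasFDerivAt
    have h2 := (h1.clm_apply (hasFDerivAt_const a y)).clm_apply (hasFDerivAt_const b y)
    have h3 : HasFDerivAt (g.inChart p a b) _ y := h2
    rw [h3.fderiv]
    simp
  simp only [christoffel, christoffelForm, h]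

/-- The geodesic equation for `γ` at time `t`, written in the preferred chart at `p`. -/
def GeodesicEquation (γ : ℝ → M) (p : M) (t : ℝ) : Prop :=
  ∀ w : E, g.chartForm p (extChartAt 𝓘(ℝ, E) p (γ t))
      (deriv (deriv fun s ↦ extChartAt 𝓘(ℝ, E) p (γ s)) t) w
    + christoffelForm (g.chartForm p) (extChartAt 𝓘(ℝ, E) p (γ t))
      (deriv (fun s ↦ extChartAt 𝓘(ℝ, E) p (γ s)) t)
      (deriv (fun s ↦ extChartAt 𝓘(ℝ, E) p (γ s)) t) w = 0

lemma isGeodesicOn_iff {γ : ℝ → M} {J : Set ℝ} :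
    g.IsGeodesicOn γ J ↔ ContMDiffOn 𝓘(ℝ, ℝ) 𝓘(ℝ, E) ∞ γ J ∧
      ∀ t ∈ J, g.GeodesicEquation γ (γ t) t := by
  refine and_congr_right fun _ ↦ forall₂_congr fun t _ ↦ forall_congr' fun w ↦ ?_
  simp only [inChart_eq, g.christoffel_eq (mem_extChartAt_target (γ t))]

end Charts

/-! ### Coordinate expressions of maps that pull one metric back to another -/

section LocalRepresentation

variable {E : Type*} [NormedAddCommGroup E] [NormedSpace ℝ E]
  {M : Type*} [TopologicalSpace M] [ChartedSpace E M] [IsManifold 𝓘(ℝ, E) ∞ M]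
  {F : Type*} [NormedAddCommGroup F] [NormedSpace ℝ F]
  {N : Type*} [TopologicalSpace N] [ChartedSpace F N] [IsManifold 𝓘(ℝ, F) ∞ N]

/-- The coordinate expression of a map in the preferred charts at `p` and `q`. -/
def localRep (E : Type*) [NormedAddCommGroup E] [NormedSpace ℝ E] {M : Type*} [TopologicalSpace M]
    [ChartedSpace E M] {F : Type*} [NormedAddCommGroup F] [NormedSpace ℝ F]
    {N : Type*} [TopologicalSpace N] [ChartedSpace F N] (f : N → M) (p : N) (q : M) (y : F) : E :=
  extChartAt 𝓘(ℝ, E) q (f ((extChartAt 𝓘(ℝ, F) p).symm y))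

lemma contDiffAt_localRep {f : N → M} {p : N} {q : M} {y : F}
    (hy : y ∈ (extChartAt 𝓘(ℝ, F) p).target)
    (hf : ContMDiffAt 𝓘(ℝ, F) 𝓘(ℝ, E) ∞ f ((extChartAt 𝓘(ℝ, F) p).symm y))
    (hq : f ((extChartAt 𝓘(ℝ, F) p).symm y) ∈ (extChartAt 𝓘(ℝ, E) q).source) :
    ContDiffAt ℝ ∞ (localRep E f p q) y :=
  ((contMDiffAt_chart hq).comp y (hf.comp y (contMDiffAt_chart_symm hy))).contDiffAt

lemma fderiv_localRep {f : N → M} {p : N} {q : M} {y : F}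
    (hy : y ∈ (extChartAt 𝓘(ℝ, F) p).target)
    (hf : ContMDiffAt 𝓘(ℝ, F) 𝓘(ℝ, E) ∞ f ((extChartAt 𝓘(ℝ, F) p).symm y))
    (hq : f ((extChartAt 𝓘(ℝ, F) p).symm y) ∈ (extChartAt 𝓘(ℝ, E) q).source) (v : F) :
    fderiv ℝ (localRep E f p q) y v =
      chartDeriv q _ (mfderiv 𝓘(ℝ, F) 𝓘(ℝ, E) f _ (chartSymmDeriv p y v)) := by
  have h1 := (hf.mdifferentiableAt (by simp)).hasMFDerivAt.comp y
    (mdifferentiableAt_chart_symm hy).hasMFDerivAt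
  have h2 := (mdifferentiableAt_chart hq).hasMFDerivAt.comp y h1
  have h3 : HasFDerivAt (localRep E f p q) ((chartDeriv q _).comp
      ((mfderiv 𝓘(ℝ, F) 𝓘(ℝ, E) f _).comp (chartSymmDeriv p y))) y :=
    hasMFDerivAt_iff_hasFDerivAt.1 h2
  rw [h3.fderiv]
  rfl

/-- `f` pulls the metric `g` back to the metric `h` near `x`. -/
def IsPullbackNear (g : PseudoRiemannianMetric E M) (h : PseudoRiemannianMetric F N) (f : N → M)
    (x : N) : Prop :=
  ∀ᶠ x' in 𝓝 x, ContMDiffAt 𝓘(ℝ, F) 𝓘(ℝ, E) ∞ f x' ∧ ∀ u v : TangentSpace 𝓘(ℝ, F) x',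
    h.inner x' u v =
      g.inner (f x') (mfderiv 𝓘(ℝ, F) 𝓘(ℝ, E) f x' u) (mfderiv 𝓘(ℝ, F) 𝓘(ℝ, E) f x' v)

variable {g : PseudoRiemannianMetric E M} {h : PseudoRiemannianMetric F N} {f : N → M}

lemma eventually_chart_symm {p x : N} (hx : x ∈ (extChartAt 𝓘(ℝ, F) p).source) {P : N → Prop}
    (hP : ∀ᶠ x' in 𝓝 x, P x') :
    ∀ᶠ y in 𝓝 (extChartAt 𝓘(ℝ, F) p x), y ∈ (extChartAt 𝓘(ℝ, F) p).target ∧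
      P ((extChartAt 𝓘(ℝ, F) p).symm y) := by
  have ht := (extChartAt 𝓘(ℝ, F) p).map_source hx
  have hc : ContinuousAt (extChartAt 𝓘(ℝ, F) p).symm (extChartAt 𝓘(ℝ, F) p x) :=
    (contMDiffAt_chart_symm ht).continuousAt
  rw [ContinuousAt, (extChartAt 𝓘(ℝ, F) p).left_inv hx] at hc
  exact Filter.Eventually.and ((isOpen_extChartAt_target p).mem_nhds ht) (hc.eventually hP)

lemma IsPullbackNear.eventually_chartForm {x p : N} {q : M} (hf : IsPullbackNear g h f x)
    (hp : x ∈ (extChartAt 𝓘(ℝ, F) p).source) (hq : f x ∈ (extChartAt 𝓘(ℝ, E) q).source) :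
    ∀ᶠ y in 𝓝 (extChartAt 𝓘(ℝ, F) p x), ∀ u v, h.chartForm p y u v =
      g.chartForm q (localRep E f p q y) (fderiv ℝ (localRep E f p q) y u)
        (fderiv ℝ (localRep E f p q) y v) := by
  have hc : ∀ᶠ x' in 𝓝 x, f x' ∈ (extChartAt 𝓘(ℝ, E) q).source :=
    hf.self_of_nhds.1.continuousAt.eventually ((isOpen_extChartAt_source q).mem_nhds hq)
  filter_upwards [eventually_chart_symm hp (hf.and hc)] with y hy u v
  obtain ⟨hyt, ⟨hs, hi⟩, hyq⟩ := hy
  rw [chartForm_apply, hi, g.inner_eq_chartForm hyq, fderiv_localRep hyt hs hyq,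
    fderiv_localRep hyt hs hyq]
  rfl

lemma deriv_deriv_comp {φ : F → E} {c : ℝ → F} {t : ℝ} (hφ : ContDiffAt ℝ 2 φ (c t))
    (hc : ContDiffAt ℝ 2 c t) :
    deriv (fun s ↦ φ (c s)) t = fderiv ℝ φ (c t) (deriv c t) ∧
    deriv (deriv fun s ↦ φ (c s)) t =
      fderiv ℝ (fderiv ℝ φ) (c t) (deriv c t) (deriv c t) + fderiv ℝ φ (c t) (deriv (deriv c) t) := by
  have h1 : ∀ᶠ s in 𝓝 t, deriv (fun s ↦ φ (c s)) s = fderiv ℝ φ (c s) (deriv c s) := by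
    filter_upwards [hc.continuousAt.eventually (hφ.eventually (by simp)),
      hc.eventually (by simp)] with s hs1 hs2
    exact ((hs1.differentiableAt two_ne_zero).hasFDerivAt.comp_hasDerivAt s
      (hs2.differentiableAt two_ne_zero).hasDerivAt).deriv
  refine ⟨h1.self_of_nhds, ?_⟩
  rw [Filter.EventuallyEq.deriv_eq h1]
  have h2 : HasDerivAt (fun s ↦ fderiv ℝ φ (c s)) (fderiv ℝ (fderiv ℝ φ) (c t) (deriv c t)) t :=
    ((hφ.fderiv_right (m := 1) (by norm_num)).differentiableAt
      one_ne_zero).hasFDerivAt.comp_hasDerivAt t (hc.differentiableAt two_ne_zero).hasDerivAt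
  have h3 : DifferentiableAt ℝ (deriv c) t := by
    have : ContDiffAt ℝ 1 (fun s ↦ fderiv ℝ c s 1) t :=
      (hc.fderiv_right (m := 1) (by norm_num)).clm_apply contDiffAt_const
    simp only [fderiv_apply_one_eq_deriv] at this
    exact this.differentiableAt one_ne_zero
  exact (h2.clm_apply h3.hasDerivAt).deriv

variable [FiniteDimensional ℝ E] [FiniteDimensional ℝ F]

/-- The hypothesis `htot` is the vanishing of the second fundamental form on the diagonal, in the
charts at `p` and `q`. It has two sources: totally geodesic immersions, and local isometries between
manifolds of equal dimension, where no nonzero normal vector exists. -/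
lemma GeodesicEquation.map {γ : ℝ → N} {t : ℝ} {p : N} {q : M} (hγ : h.GeodesicEquation γ p t)
    (hγs : ContMDiffAt 𝓘(ℝ, ℝ) 𝓘(ℝ, F) ∞ γ t) (hp : γ t ∈ (extChartAt 𝓘(ℝ, F) p).source)
    (hq : f (γ t) ∈ (extChartAt 𝓘(ℝ, E) q).source) (hf : IsPullbackNear g h f (γ t))
    (htot : ∀ u w, (∀ z, g.chartForm q (localRep E f p q (extChartAt 𝓘(ℝ, F) p (γ t)))
        (fderiv ℝ (localRep E f p q) (extChartAt 𝓘(ℝ, F) p (γ t)) z) w = 0) →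
      g.chartForm q (localRep E f p q (extChartAt 𝓘(ℝ, F) p (γ t)))
        (fderiv ℝ (fderiv ℝ (localRep E f p q)) (extChartAt 𝓘(ℝ, F) p (γ t)) u u) w
      + christoffelForm (g.chartForm q) (localRep E f p q (extChartAt 𝓘(ℝ, F) p (γ t)))
        (fderiv ℝ (localRep E f p q) (extChartAt 𝓘(ℝ, F) p (γ t)) u)
        (fderiv ℝ (localRep E f p q) (extChartAt 𝓘(ℝ, F) p (γ t)) u) w = 0) :
    g.GeodesicEquation (fun s ↦ f (γ s)) q t := by
  have hy := (extChartAt 𝓘(ℝ, F) p).map_source hp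
  have hinv := (extChartAt 𝓘(ℝ, F) p).left_inv hp
  have hφ : ContDiffAt ℝ ∞ (localRep E f p q) (extChartAt 𝓘(ℝ, F) p (γ t)) :=
    contDiffAt_localRep hy (by rw [hinv]; exact hf.self_of_nhds.1) (by rwa [hinv])
  have hφ0 : localRep E f p q (extChartAt 𝓘(ℝ, F) p (γ t)) = extChartAt 𝓘(ℝ, E) q (f (γ t)) := by
    rw [localRep, hinv]
  have hyq : localRep E f p q (extChartAt 𝓘(ℝ, F) p (γ t)) ∈ (extChartAt 𝓘(ℝ, E) q).target := by
    rw [hφ0]; exact (extChartAt 𝓘(ℝ, E) q).map_source hq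
  have hc : ContDiffAt ℝ ∞ (fun s ↦ extChartAt 𝓘(ℝ, F) p (γ s)) t :=
    ((contMDiffAt_chart hp).comp t hγs).contDiffAt
  have heq : (fun s ↦ extChartAt 𝓘(ℝ, E) q (f (γ s))) =ᶠ[𝓝 t]
      fun s ↦ localRep E f p q (extChartAt 𝓘(ℝ, F) p (γ s)) := by
    filter_upwards [hγs.continuousAt.eventually ((isOpen_extChartAt_source p).mem_nhds hp)]
      with s hs
    rw [localRep, (extChartAt 𝓘(ℝ, F) p).left_inv hs]
  obtain ⟨hd1, hd2⟩ := deriv_deriv_comp (φ := localRep E f p q)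
    (c := fun s ↦ extChartAt 𝓘(ℝ, F) p (γ s)) (t := t) (hφ.of_le (by norm_cast)) (hc.of_le (by norm_cast))
  intro w
  rw [heq.deriv_eq, heq.deriv.deriv_eq, hd1, hd2, ← hφ0]
  exact geodesic_equation_map (h.differentiableAt_chartForm hy) (h.chartForm_nondegenerate hy)
    (g.differentiableAt_chartForm hyq) (Eventually.of_forall fun y ↦ g.chartForm_symm q y)
    (hφ.of_le (by norm_cast)) (hf.eventually_chartForm hp hq) hγ (htot _) w

end LocalRepresentation

end PseudoRiemannianMetric

namespace PseudoRiemannianMetric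

/-! ### Geodesics under local isometries and totally geodesic immersions -/

section Isometric

variable {E : Type*} [NormedAddCommGroup E] [NormedSpace ℝ E] [FiniteDimensional ℝ E]
  {M : Type*} [TopologicalSpace M] [ChartedSpace E M] [IsManifold 𝓘(ℝ, E) ∞ M]
  {g : PseudoRiemannianMetric E M}

/-- Local isometries preserve the geodesic equation, in any charts. -/
lemma GeodesicEquation.map_of_isPullbackNear {M' : Type*} [TopologicalSpace M'] [ChartedSpace E M']
    [IsManifold 𝓘(ℝ, E) ∞ M'] {h : PseudoRiemannianMetric E M'} {f : M' → M}
    {γ : ℝ → M'} {t : ℝ} {p : M'} {q : M} (hγ : h.GeodesicEquation γ p t)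
    (hγs : ContMDiffAt 𝓘(ℝ, ℝ) 𝓘(ℝ, E) ∞ γ t) (hp : γ t ∈ (extChartAt 𝓘(ℝ, E) p).source)
    (hq : f (γ t) ∈ (extChartAt 𝓘(ℝ, E) q).source) (hf : IsPullbackNear g h f (γ t)) :
    g.GeodesicEquation (fun s ↦ f (γ s)) q t := by
  refine hγ.map hγs hp hq hf fun u w hw ↦ ?_
  have hy := (extChartAt 𝓘(ℝ, E) p).map_source hp
  have hyq : localRep E f p q (extChartAt 𝓘(ℝ, E) p (γ t)) ∈ (extChartAt 𝓘(ℝ, E) q).target := by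
    rw [localRep, (extChartAt 𝓘(ℝ, E) p).left_inv hp]; exact (extChartAt 𝓘(ℝ, E) q).map_source hq
  have hind := (hf.eventually_chartForm hp hq).self_of_nhds
  set L := fderiv ℝ (localRep E f p q) (extChartAt 𝓘(ℝ, E) p (γ t))
  -- A map pulling the metric back to a nondegenerate one has injective differential. Both manifolds
  -- are modelled on `E`, so it is bijective, and the normal vector `w` must be zero.
  have hinj : Function.Injective (L : E →ₗ[ℝ] E) := by
    rw [injective_iff_map_eq_zero]
    intro v hv
    apply h.chartForm_nondegenerate hy
    intro w
    have hv' : L v = 0 := hv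
    rw [hind, hv', map_zero, zero_apply]
  have hsurj := LinearMap.surjective_of_injective hinj
  have hw0 : w = 0 := by
    apply g.chartForm_nondegenerate hyq
    intro z
    obtain ⟨z', rfl⟩ := hsurj z
    rw [chartForm_symm]
    exact hw z'
  rw [hw0, christoffelForm_zero, map_zero, add_zero]

-- A change of chart is the identity read in two charts; regarded as an isometry, it yields the
-- chart independence of the geodesic equation.
omit [FiniteDimensional ℝ E] in
lemma isPullbackNear_id (x : M) : IsPullbackNear g g id x :=
  Eventually.of_forall fun x' ↦ ⟨contMDiffAt_id, fun u v ↦ by rw [mfderiv_id]; rfl⟩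

/-- The geodesic equation does not depend on the chart. -/
lemma GeodesicEquation.change {γ : ℝ → M} {t : ℝ} {p : M} {q : M} (hγ : g.GeodesicEquation γ p t)
    (hγs : ContMDiffAt 𝓘(ℝ, ℝ) 𝓘(ℝ, E) ∞ γ t) (hp : γ t ∈ (extChartAt 𝓘(ℝ, E) p).source)
    (hq : γ t ∈ (extChartAt 𝓘(ℝ, E) q).source) : g.GeodesicEquation γ q t :=
  hγ.map_of_isPullbackNear (f := id) hγs hp hq (isPullbackNear_id _)

/-- Local isometries map geodesics to geodesics. -/
lemma IsGeodesicOn.map_of_isPullbackNear {f : M → M} {γ : ℝ → M} {J : Set ℝ} (hJ : IsOpen J)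
    (hγ : g.IsGeodesicOn γ J) (hf : ∀ t ∈ J, IsPullbackNear g g f (γ t)) :
    g.IsGeodesicOn (fun s ↦ f (γ s)) J := by
  rw [isGeodesicOn_iff] at hγ ⊢
  have hs : ∀ t ∈ J, ContMDiffAt 𝓘(ℝ, ℝ) 𝓘(ℝ, E) ∞ γ t :=
    fun t ht ↦ hγ.1.contMDiffAt (hJ.mem_nhds ht)
  exact ⟨fun t ht ↦ ((hf t ht).self_of_nhds.1.comp t (hs t ht)).contMDiffWithinAt,
    fun t ht ↦ (hγ.2 t ht).map_of_isPullbackNear (hs t ht) (mem_extChartAt_source _)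
      (mem_extChartAt_source _) (hf t ht)⟩

variable {F : Type*} [NormedAddCommGroup F] [NormedSpace ℝ F] [FiniteDimensional ℝ F]
  {N : Type*} [TopologicalSpace N] [ChartedSpace F N] [IsManifold 𝓘(ℝ, F) ∞ N]
  {h : PseudoRiemannianMetric F N} {f : N → M}

omit [FiniteDimensional ℝ E] [FiniteDimensional ℝ F] in
lemma IsSubmanifold.isPullbackNear (hf : g.IsSubmanifold h f) (x : N) : IsPullbackNear g h f x :=
  Eventually.of_forall fun x' ↦ ⟨hf.isImmersion.contMDiff x', hf.induced x'⟩

omit [FiniteDimensional ℝ F] in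
lemma IsTotallyGeodesic.chart (hg : g.IsTotallyGeodesic (F := F) f)
    (hf : ContMDiff 𝓘(ℝ, F) 𝓘(ℝ, E) ∞ f) (x : N) (u v : F) (w : E)
    (hw : ∀ z, g.chartForm (f x) (localRep E f x (f x) (extChartAt 𝓘(ℝ, F) x x))
      (fderiv ℝ (localRep E f x (f x)) (extChartAt 𝓘(ℝ, F) x x) z) w = 0) :
    g.chartForm (f x) (localRep E f x (f x) (extChartAt 𝓘(ℝ, F) x x))
        (fderiv ℝ (fderiv ℝ (localRep E f x (f x))) (extChartAt 𝓘(ℝ, F) x x) u v) w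
      + christoffelForm (g.chartForm (f x)) (localRep E f x (f x) (extChartAt 𝓘(ℝ, F) x x))
        (fderiv ℝ (localRep E f x (f x)) (extChartAt 𝓘(ℝ, F) x x) u)
        (fderiv ℝ (localRep E f x (f x)) (extChartAt 𝓘(ℝ, F) x x) v) w = 0 := by
  have h0 : localRep E f x (f x) (extChartAt 𝓘(ℝ, F) x x) = extChartAt 𝓘(ℝ, E) (f x) (f x) := by
    rw [localRep, extChartAt_to_inv]
  have hφ : ContDiffAt ℝ ∞ (localRep E f x (f x)) (extChartAt 𝓘(ℝ, F) x x) :=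
    contDiffAt_localRep (mem_extChartAt_target x) (hf _)
      (by rw [extChartAt_to_inv]; exact mem_extChartAt_source _)
  have h2 : DifferentiableAt ℝ (fderiv ℝ (localRep E f x (f x))) (extChartAt 𝓘(ℝ, F) x x) :=
    (hφ.fderiv_right (m := 1) (by norm_cast)).differentiableAt one_ne_zero
  have hd : fderiv ℝ (fun z ↦ fderiv ℝ (localRep E f x (f x)) z v) (extChartAt 𝓘(ℝ, F) x x) u =
      fderiv ℝ (fderiv ℝ (localRep E f x (f x))) (extChartAt 𝓘(ℝ, F) x x) u v := by
    rw [(h2.hasFDerivAt.clm_apply (hasFDerivAt_const v _)).fderiv]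
    simp
  have hy : localRep E f x (f x) (extChartAt 𝓘(ℝ, F) x x) ∈ (extChartAt 𝓘(ℝ, E) (f x)).target := by
    rw [h0]; exact mem_extChartAt_target _
  have key := hg x u v w (by
    intro z
    have := hw z
    rw [h0] at this
    exact this)
  rw [← hd, ← g.christoffel_eq hy]
  exact key

/-- Totally geodesic isometric immersions map geodesics to geodesics. -/
lemma IsGeodesicOn.map_of_isTotallyGeodesic (hf : g.IsSubmanifold h f)
    (hg : g.IsTotallyGeodesic (F := F) f) {γ : ℝ → N} {J : Set ℝ} (hJ : IsOpen J)
    (hγ : h.IsGeodesicOn γ J) : g.IsGeodesicOn (fun s ↦ f (γ s)) J := by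
  rw [isGeodesicOn_iff] at hγ ⊢
  have hs : ∀ t ∈ J, ContMDiffAt 𝓘(ℝ, ℝ) 𝓘(ℝ, F) ∞ γ t :=
    fun t ht ↦ hγ.1.contMDiffAt (hJ.mem_nhds ht)
  exact ⟨fun t ht ↦ ((hf.isImmersion.contMDiff _).comp t (hs t ht)).contMDiffWithinAt,
    fun t ht ↦ (hγ.2 t ht).map (hs t ht) (mem_extChartAt_source _)
      (mem_extChartAt_source _) (hf.isPullbackNear _)
      fun u w hw ↦ hg.chart hf.isImmersion.contMDiff _ u u w hw⟩

end Isometric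

/-! ### The geodesic spray -/

section Uniqueness

set_option synthInstance.maxHeartbeats 200000

variable {E : Type*} [NormedAddCommGroup E] [NormedSpace ℝ E]
  {M : Type*} [TopologicalSpace M] [ChartedSpace E M] [IsManifold 𝓘(ℝ, E) ∞ M]
  (g : PseudoRiemannianMetric E M)

/-- The Christoffel symbols of the first kind on the diagonal, as a covector. -/
def christoffelCovector (p : M) (w : E × E) : E →L[ℝ] ℝ :=
  fderiv ℝ (g.chartForm p) w.1 w.2 w.2
    - (1 / 2 : ℝ) • ((fderiv ℝ (g.chartForm p) w.1).flip w.2).flip w.2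

lemma christoffelCovector_apply (p : M) (w : E × E) (z : E) :
    g.christoffelCovector p w z = christoffelForm (g.chartForm p) w.1 w.2 w.2 z := by
  simp only [christoffelCovector, christoffelForm, sub_apply, smul_apply,
    ContinuousLinearMap.flip_apply, smul_eq_mul]
  ring

/-- The geodesic spray in the preferred chart at `p`. -/
def spray (p : M) (w : E × E) : E × E :=
  (w.2, -(g.chartForm p w.1).inverse (g.christoffelCovector p w))

lemma christoffelCovector_smul (p : M) (y v : E) (a : ℝ) :
    g.christoffelCovector p (y, a • v) = a ^ 2 • g.christoffelCovector p (y, v) := by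
  ext z
  simp only [christoffelCovector_apply, christoffelForm, map_smul, smul_apply, smul_eq_mul]
  ring

variable [FiniteDimensional ℝ E]

omit [FiniteDimensional ℝ E] in
lemma _root_.ContDiffAt.fderiv_apply_prod {W : Type*} [NormedAddCommGroup W] [NormedSpace ℝ W]
    {A : E → W} {a b : E × E → E} {w : E × E} (hA : ContDiffAt ℝ ∞ A (a w))
    (ha : ContDiffAt ℝ ∞ a w) (hb : ContDiffAt ℝ ∞ b w) :
    ContDiffAt ℝ ∞ (fun w ↦ fderiv ℝ A (a w) (b w)) w :=
  (ContDiffAt.comp (g := fderiv ℝ A) w (hA.fderiv_right (m := ∞) (by simp)) ha).clm_apply hb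

lemma contDiffAt_christoffelCovector {p : M} {w : E × E}
    (hw : w.1 ∈ (extChartAt 𝓘(ℝ, E) p).target) :
    ContDiffAt ℝ ∞ (g.christoffelCovector p) w := by
  have hon : ContDiffOn ℝ ∞ (g.christoffelCovector p)
      (Prod.fst ⁻¹' (extChartAt 𝓘(ℝ, E) p).target) := by
    rw [contDiffOn_clm_apply]
    intro z w hw
    have hG := g.contDiffAt_chartForm hw
    have e1 := ((hG.fderiv_apply_prod contDiffAt_fst contDiffAt_snd).clm_apply
      contDiffAt_snd).clm_apply (contDiffAt_const (c := z))
    have e2 := ((hG.fderiv_apply_prod contDiffAt_fst (contDiffAt_const (c := z))).clm_apply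
      contDiffAt_snd).clm_apply contDiffAt_snd
    refine ((e1.sub (contDiffAt_const.mul e2 (f := fun _ ↦ (1 / 2 : ℝ)))).congr_of_eventuallyEq
      (Eventually.of_forall fun w ↦ ?_)).contDiffWithinAt
    simp only [christoffelCovector, sub_apply, smul_apply,
      ContinuousLinearMap.flip_apply, smul_eq_mul]
  exact hon.contDiffAt (((isOpen_extChartAt_target p).preimage continuous_fst).mem_nhds hw)

lemma contDiffAt_inverse_chartForm {p : M} {y : E} (hy : y ∈ (extChartAt 𝓘(ℝ, E) p).target) :
    ContDiffAt ℝ ∞ (fun z ↦ (g.chartForm p z).inverse) y := by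
  have : CompleteSpace E := FiniteDimensional.complete ℝ E
  obtain ⟨L, hL⟩ := isInvertible_of_nondegenerate (g.chartForm_nondegenerate hy)
  refine ContDiffAt.comp (g := ContinuousLinearMap.inverse) (f := g.chartForm p) y ?_
    (g.contDiffAt_chartForm hy)
  rw [← hL]
  exact contDiffAt_map_inverse L

lemma contDiffOn_spray (p : M) :
    ContDiffOn ℝ ∞ (g.spray p) ((extChartAt 𝓘(ℝ, E) p).target ×ˢ univ) := by
  rintro w ⟨hy, -⟩
  have h1 : ContDiffAt ℝ ∞ (fun w : E × E ↦ (g.chartForm p w.1).inverse) w :=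
    ContDiffAt.comp (g := fun z ↦ (g.chartForm p z).inverse) w
      (g.contDiffAt_inverse_chartForm hy) contDiffAt_fst
  exact (contDiffAt_snd.prodMk
    (h1.clm_apply (g.contDiffAt_christoffelCovector hy)).neg).contDiffWithinAt

variable {g}

/-- Inverting the Gram form solves the weak equation for the second derivative, giving an explicit
ODE with smooth right-hand side. -/
lemma geodesicEquation_iff {γ : ℝ → M} {p : M} {t : ℝ}
    (hp : γ t ∈ (extChartAt 𝓘(ℝ, E) p).source) :
    g.GeodesicEquation γ p t ↔ deriv (deriv fun s ↦ extChartAt 𝓘(ℝ, E) p (γ s)) t =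
      (g.spray p (extChartAt 𝓘(ℝ, E) p (γ t), deriv (fun s ↦ extChartAt 𝓘(ℝ, E) p (γ s)) t)).2 := by
  have : CompleteSpace E := FiniteDimensional.complete ℝ E
  have hy := (extChartAt 𝓘(ℝ, E) p).map_source hp
  have hinv := isInvertible_of_nondegenerate (g.chartForm_nondegenerate hy)
  obtain ⟨L, hL⟩ := hinv
  have h1 : g.GeodesicEquation γ p t ↔ g.chartForm p (extChartAt 𝓘(ℝ, E) p (γ t))
      (deriv (deriv fun s ↦ extChartAt 𝓘(ℝ, E) p (γ s)) t) + g.christoffelCovector p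
        (extChartAt 𝓘(ℝ, E) p (γ t), deriv (fun s ↦ extChartAt 𝓘(ℝ, E) p (γ s)) t) = 0 := by
    rw [ContinuousLinearMap.ext_iff]
    exact forall_congr' fun w ↦ by
      rw [add_apply, christoffelCovector_apply, zero_apply]
  rw [h1, spray, ← hL, ContinuousLinearMap.inverse_equiv, add_eq_zero_iff_eq_neg]
  change L _ = _ ↔ _ = -L.symm _
  rw [← map_neg, ContinuousLinearEquiv.eq_symm_apply]

end Uniqueness

end PseudoRiemannianMetric

/-! ### Velocities of curves as points of the tangent bundle -/

section Velocity

variable {E : Type*} [NormedAddCommGroup E] [NormedSpace ℝ E]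
  {M : Type*} [TopologicalSpace M] [ChartedSpace E M]

/-- The velocity of a curve, as a point of the tangent bundle. -/
def velocity (E : Type*) [NormedAddCommGroup E] [NormedSpace ℝ E] {M : Type*} [TopologicalSpace M]
    [ChartedSpace E M] (γ : ℝ → M) (t : ℝ) : TangentBundle 𝓘(ℝ, E) M :=
  ⟨γ t, mfderiv 𝓘(ℝ, ℝ) 𝓘(ℝ, E) γ t (1 : ℝ)⟩

/-- The coordinates of a tangent vector in the chart induced by the preferred chart at `p`. -/
def tangentCoord (p : M) (v : TangentBundle 𝓘(ℝ, E) M) : E × E :=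
  (extChartAt 𝓘(ℝ, E) p v.1, chartDeriv p v.1 v.2)

lemma Filter.EventuallyEq.velocity_eq {γ σ : ℝ → M} {t : ℝ} (h : γ =ᶠ[𝓝 t] σ) :
    velocity E γ t = velocity E σ t := by
  have h0 := h.self_of_nhds
  have hd : (mfderiv 𝓘(ℝ, ℝ) 𝓘(ℝ, E) γ t : ℝ → E) = (mfderiv 𝓘(ℝ, ℝ) 𝓘(ℝ, E) σ t : ℝ → E) :=
    congrArg (DFunLike.coe (F := ℝ →L[ℝ] E)) h.mfderiv_eq
  refine TotalSpace.ext h0 (heq_of_eq ?_)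
  exact congrFun hd 1

variable [IsManifold 𝓘(ℝ, E) ∞ M]

/-- Velocities at base points that are only propositionally equal live in different types; comparing
their coordinates in a common chart circumvents this. -/
lemma eq_of_tangentCoord_eq {p : M} {v w : TangentBundle 𝓘(ℝ, E) M}
    (hv : v.1 ∈ (extChartAt 𝓘(ℝ, E) p).source) (hw : w.1 ∈ (extChartAt 𝓘(ℝ, E) p).source)
    (h : tangentCoord p v = tangentCoord p w) : v = w := by
  obtain ⟨x, v⟩ := v
  obtain ⟨x', w⟩ := w
  obtain rfl : x = x' := (extChartAt 𝓘(ℝ, E) p).injOn hv hw (congrArg Prod.fst h)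
  have h2 : chartDeriv p x v = chartDeriv p x w := congrArg Prod.snd h
  obtain ⟨y, hy, rfl⟩ : ∃ y ∈ (extChartAt 𝓘(ℝ, E) p).target, (extChartAt 𝓘(ℝ, E) p).symm y = x :=
    ⟨_, (extChartAt 𝓘(ℝ, E) p).map_source hv, (extChartAt 𝓘(ℝ, E) p).left_inv hv⟩
  rw [← chartSymmDeriv_chartDeriv hy v, h2, chartSymmDeriv_chartDeriv hy]

lemma hasDerivAt_chart_velocity {γ : ℝ → M} {t : ℝ} {p : M}
    (hγ : MDifferentiableAt 𝓘(ℝ, ℝ) 𝓘(ℝ, E) γ t) (hp : γ t ∈ (extChartAt 𝓘(ℝ, E) p).source) :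
    HasDerivAt (fun s ↦ extChartAt 𝓘(ℝ, E) p (γ s)) (tangentCoord p (velocity E γ t)).2 t := by
  refine HasMFDerivAt.hasDerivAt_chart (hγ.hasMFDerivAt.congr_mfderiv ?_) hp
  refine ContinuousLinearMap.ext fun (r : ℝ) ↦ ?_
  have := (mfderiv 𝓘(ℝ, ℝ) 𝓘(ℝ, E) γ t).map_smul r (1 : ℝ)
  refine Eq.trans ?_ this
  congr 1
  exact (mul_one r).symm

lemma tangentCoord_velocity {γ : ℝ → M} {t : ℝ} {p : M}
    (hγ : MDifferentiableAt 𝓘(ℝ, ℝ) 𝓘(ℝ, E) γ t) (hp : γ t ∈ (extChartAt 𝓘(ℝ, E) p).source) :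
    tangentCoord p (velocity E γ t) =
      (extChartAt 𝓘(ℝ, E) p (γ t), deriv (fun s ↦ extChartAt 𝓘(ℝ, E) p (γ s)) t) := by
  rw [(hasDerivAt_chart_velocity hγ hp).deriv]; rfl

omit [IsManifold 𝓘(ℝ, E) ∞ M] in
lemma velocity_comp_affine {γ : ℝ → M} {a b t : ℝ}
    (hγ : MDifferentiableAt 𝓘(ℝ, ℝ) 𝓘(ℝ, E) γ (a * t + b)) :
    velocity E (fun s ↦ γ (a * s + b)) t =
      ⟨γ (a * t + b), a • (velocity E γ (a * t + b)).2⟩ := by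
  have h1 : HasDerivAt (fun s : ℝ ↦ a * s + b) a t := by
    simpa using ((hasDerivAt_id t).const_mul a).add_const b
  have h2 := hγ.hasMFDerivAt.comp t h1.hasFDerivAt.hasMFDerivAt
  refine TotalSpace.ext rfl (heq_of_eq ?_)
  change mfderiv 𝓘(ℝ, ℝ) 𝓘(ℝ, E) (γ ∘ fun s ↦ a * s + b) t (1 : ℝ) = _
  rw [h2.mfderiv]
  have := (mfderiv 𝓘(ℝ, ℝ) 𝓘(ℝ, E) γ (a * t + b)).map_smul a (1 : ℝ)
  refine Eq.trans ?_ this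
  change mfderiv 𝓘(ℝ, ℝ) 𝓘(ℝ, E) γ (a * t + b) ((1 : ℝ) * a) = _
  congr 1
  exact (one_mul a).trans (mul_one a).symm

/-- Two smooth curves with distinct velocities at a time have distinct velocities at nearby times. -/
lemma eventually_velocity_ne [T2Space M] {γ σ : ℝ → M} {t : ℝ}
    (hγ : ContMDiffAt 𝓘(ℝ, ℝ) 𝓘(ℝ, E) ∞ γ t) (hσ : ContMDiffAt 𝓘(ℝ, ℝ) 𝓘(ℝ, E) ∞ σ t)
    (h : velocity E γ t ≠ velocity E σ t) : ∀ᶠ s in 𝓝 t, velocity E γ s ≠ velocity E σ s := by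
  -- Equal base points allow a comparison of coordinate derivatives in one chart; distinct base
  -- points are separated by Hausdorffness.
  by_cases h0 : γ t = σ t
  · set p := γ t
    have hp : γ t ∈ (extChartAt 𝓘(ℝ, E) p).source := mem_extChartAt_source _
    have hpσ : σ t ∈ (extChartAt 𝓘(ℝ, E) p).source := by rw [← h0]; exact hp
    have hne : deriv (fun s ↦ extChartAt 𝓘(ℝ, E) p (γ s)) t ≠
        deriv (fun s ↦ extChartAt 𝓘(ℝ, E) p (σ s)) t := by
      intro hd
      refine h (eq_of_tangentCoord_eq (p := p) hp hpσ ?_)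
      rw [tangentCoord_velocity (hγ.mdifferentiableAt (by simp)) hp,
        tangentCoord_velocity (hσ.mdifferentiableAt (by simp)) hpσ, hd, ← h0]
    have hcont : ∀ {γ : ℝ → M}, ContMDiffAt 𝓘(ℝ, ℝ) 𝓘(ℝ, E) ∞ γ t →
        γ t ∈ (extChartAt 𝓘(ℝ, E) p).source →
        ContinuousAt (deriv fun s ↦ extChartAt 𝓘(ℝ, E) p (γ s)) t := by
      intro γ hγ hp
      have hc : ContDiffAt ℝ ∞ (fun s ↦ extChartAt 𝓘(ℝ, E) p (γ s)) t :=
        ((contMDiffAt_chart hp).comp t hγ).contDiffAt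
      have := (hc.fderiv_right (m := 0) (by simp)).clm_apply (contDiffAt_const (c := (1 : ℝ)))
      simp only [fderiv_apply_one_eq_deriv] at this
      exact this.continuousAt
    have hev : ∀ {γ : ℝ → M}, ContMDiffAt 𝓘(ℝ, ℝ) 𝓘(ℝ, E) ∞ γ t →
        γ t ∈ (extChartAt 𝓘(ℝ, E) p).source → ∀ᶠ s in 𝓝 t,
          γ s ∈ (extChartAt 𝓘(ℝ, E) p).source ∧ MDifferentiableAt 𝓘(ℝ, ℝ) 𝓘(ℝ, E) γ s := by
      intro γ hγ hp
      have : IsManifold 𝓘(ℝ, E) 1 M := .of_le (n := ∞) (by norm_cast)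
      have h1 : ∀ᶠ s in 𝓝 t, ContMDiffAt 𝓘(ℝ, ℝ) 𝓘(ℝ, E) 1 γ s :=
        (contMDiffAt_iff_contMDiffAt_nhds (by simp)).1 (hγ.of_le (by norm_cast))
      filter_upwards [h1,
        hγ.continuousAt.eventually ((isOpen_extChartAt_source p).mem_nhds hp)] with s h1 h2
      exact ⟨h2, h1.mdifferentiableAt one_ne_zero⟩
    filter_upwards [(hcont hγ hp).ne_iff_eventually_ne (hcont hσ hpσ) |>.1 hne, hev hγ hp,
      hev hσ hpσ] with s h1 h2 h3 h4
    have := congrArg (tangentCoord p) h4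
    rw [tangentCoord_velocity h2.2 h2.1, tangentCoord_velocity h3.2 h3.1] at this
    exact h1 (congrArg Prod.snd this)
  · filter_upwards [hγ.continuousAt.ne_iff_eventually_ne hσ.continuousAt |>.1 h0] with s hs h4
    exact hs (congrArg TotalSpace.proj h4)

end Velocity

namespace PseudoRiemannianMetric

/-! ### Uniqueness and affine reparametrization of geodesics -/

section Uniqueness

variable {E : Type*} [NormedAddCommGroup E] [NormedSpace ℝ E]
  {M : Type*} [TopologicalSpace M] [ChartedSpace E M] [IsManifold 𝓘(ℝ, E) ∞ M]
  {g : PseudoRiemannianMetric E M} {γ σ : ℝ → M} {J : Set ℝ}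

lemma IsGeodesicOn.contMDiffAt (hγ : g.IsGeodesicOn γ J) (hJ : IsOpen J) {t : ℝ} (ht : t ∈ J) :
    ContMDiffAt 𝓘(ℝ, ℝ) 𝓘(ℝ, E) ∞ γ t :=
  hγ.1.contMDiffAt (hJ.mem_nhds ht)

lemma IsGeodesicOn.mdifferentiableAt (hγ : g.IsGeodesicOn γ J) (hJ : IsOpen J) {t : ℝ}
    (ht : t ∈ J) : MDifferentiableAt 𝓘(ℝ, ℝ) 𝓘(ℝ, E) γ t :=
  (hγ.contMDiffAt hJ ht).mdifferentiableAt (by simp)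

variable [FiniteDimensional ℝ E]

lemma IsGeodesicOn.hasDerivAt_chart (hγ : g.IsGeodesicOn γ J) (hJ : IsOpen J) {t : ℝ} (ht : t ∈ J)
    {p : M} (hp : γ t ∈ (extChartAt 𝓘(ℝ, E) p).source) :
    HasDerivAt (fun s ↦ (extChartAt 𝓘(ℝ, E) p (γ s), deriv (fun r ↦ extChartAt 𝓘(ℝ, E) p (γ r)) s))
      (g.spray p (extChartAt 𝓘(ℝ, E) p (γ t), deriv (fun r ↦ extChartAt 𝓘(ℝ, E) p (γ r)) t)) t := by
  have hs := hγ.contMDiffAt hJ ht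
  have hc : ContDiffAt ℝ ∞ (fun s ↦ extChartAt 𝓘(ℝ, E) p (γ s)) t :=
    ((contMDiffAt_chart hp).comp t hs).contDiffAt
  have h1 := (hc.differentiableAt (by simp)).hasDerivAt
  have h2 : DifferentiableAt ℝ (deriv fun s ↦ extChartAt 𝓘(ℝ, E) p (γ s)) t := by
    have := (hc.fderiv_right (m := 1) (by norm_cast)).clm_apply (contDiffAt_const (c := (1 : ℝ)))
    simp only [fderiv_apply_one_eq_deriv] at this
    exact this.differentiableAt one_ne_zero
  have h3 := h2.hasDerivAt
  have heq := (geodesicEquation_iff hp).1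
    (((isGeodesicOn_iff g).1 hγ).2 t ht |>.change hs (mem_extChartAt_source _) hp)
  rw [heq] at h3
  exact h1.prodMk h3

/-- Converse to `IsGeodesicOn.hasDerivAt_chart`: integral curves of the spray project to geodesics,
and the velocity coordinates recover the integral curve. -/
lemma isGeodesicOn_of_hasDerivAt {p : M} {w : ℝ → E × E} (hJ : IsOpen J) (hw : ContDiffOn ℝ ∞ w J)
    (hd : ∀ t ∈ J, (w t).1 ∈ (extChartAt 𝓘(ℝ, E) p).target ∧ HasDerivAt w (g.spray p (w t)) t) :
    g.IsGeodesicOn (fun s ↦ (extChartAt 𝓘(ℝ, E) p).symm (w s).1) J ∧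
    ∀ t ∈ J, tangentCoord p (velocity E (fun s ↦ (extChartAt 𝓘(ℝ, E) p).symm (w s).1) t) = w t := by
  have hs : ∀ t ∈ J, ContMDiffAt 𝓘(ℝ, ℝ) 𝓘(ℝ, E) ∞
      (fun s ↦ (extChartAt 𝓘(ℝ, E) p).symm (w s).1) t := by
    intro t ht
    exact (contMDiffAt_chart_symm (hd t ht).1).comp t
      (hw.contDiffAt (hJ.mem_nhds ht)).fst.contMDiffAt
  have hsrc : ∀ t ∈ J, (extChartAt 𝓘(ℝ, E) p).symm (w t).1 ∈ (extChartAt 𝓘(ℝ, E) p).source :=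
    fun t ht ↦ (extChartAt 𝓘(ℝ, E) p).map_target (hd t ht).1
  have hc : ∀ t ∈ J, (fun s ↦ extChartAt 𝓘(ℝ, E) p ((extChartAt 𝓘(ℝ, E) p).symm (w s).1))
      =ᶠ[𝓝 t] fun s ↦ (w s).1 := fun t ht ↦ by
    filter_upwards [hJ.mem_nhds ht] with s hs using (extChartAt 𝓘(ℝ, E) p).right_inv (hd s hs).1
  have h1 : ∀ t ∈ J, HasDerivAt (fun s ↦ (w s).1) (w t).2 t := fun t ht ↦
    (ContinuousLinearMap.fst ℝ E E).hasFDerivAt.comp_hasDerivAt t (hd t ht).2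
  have h2 : ∀ t ∈ J, HasDerivAt (fun s ↦ (w s).2) (g.spray p (w t)).2 t := fun t ht ↦
    (ContinuousLinearMap.snd ℝ E E).hasFDerivAt.comp_hasDerivAt t (hd t ht).2
  have hc1 : ∀ t ∈ J, deriv (fun s ↦ extChartAt 𝓘(ℝ, E) p ((extChartAt 𝓘(ℝ, E) p).symm (w s).1)) t
      = (w t).2 := fun t ht ↦ by rw [(hc t ht).deriv_eq, (h1 t ht).deriv]
  have hc2 : ∀ t ∈ J, deriv (deriv (fun s ↦ extChartAt 𝓘(ℝ, E) p
      ((extChartAt 𝓘(ℝ, E) p).symm (w s).1))) t = (g.spray p (w t)).2 := fun t ht ↦ by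
    have : (deriv (fun s ↦ extChartAt 𝓘(ℝ, E) p ((extChartAt 𝓘(ℝ, E) p).symm (w s).1)))
        =ᶠ[𝓝 t] fun s ↦ (w s).2 := by
      filter_upwards [hJ.mem_nhds ht] with s hs using hc1 s hs
    rw [this.deriv_eq, (h2 t ht).deriv]
  refine ⟨(isGeodesicOn_iff g).2 ⟨fun t ht ↦ (hs t ht).contMDiffWithinAt, fun t ht ↦ ?_⟩,
    fun t ht ↦ ?_⟩
  · refine GeodesicEquation.change (p := p) ?_ (hs t ht) (hsrc t ht) (mem_extChartAt_source _)
    rw [geodesicEquation_iff (hsrc t ht), hc2 t ht, hc1 t ht,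
      (extChartAt 𝓘(ℝ, E) p).right_inv (hd t ht).1]
  · rw [tangentCoord_velocity ((hs t ht).mdifferentiableAt (by simp)) (hsrc t ht), hc1 t ht,
      (extChartAt 𝓘(ℝ, E) p).right_inv (hd t ht).1]

/-- The spray is continuously differentiable, hence locally Lipschitz, so ODE uniqueness applies in
one chart. -/
lemma IsGeodesicOn.eventuallyEq (hJ : IsOpen J) (hγ : g.IsGeodesicOn γ J) (hσ : g.IsGeodesicOn σ J)
    {t : ℝ} (ht : t ∈ J) (h : velocity E γ t = velocity E σ t) : γ =ᶠ[𝓝 t] σ := by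
  set p := γ t with hpdef
  have hp : γ t ∈ (extChartAt 𝓘(ℝ, E) p).source := mem_extChartAt_source _
  have hpσ : σ t ∈ (extChartAt 𝓘(ℝ, E) p).source := by
    have : γ t = σ t := congrArg TotalSpace.proj h
    rw [← this]; exact hp
  have hw := tangentCoord_velocity (hγ.mdifferentiableAt hJ ht) hp
  have hz := tangentCoord_velocity (hσ.mdifferentiableAt hJ ht) hpσ
  have hsp : ContDiffAt ℝ 1 (g.spray p)
      (extChartAt 𝓘(ℝ, E) p (γ t), deriv (fun r ↦ extChartAt 𝓘(ℝ, E) p (γ r)) t) :=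
    ((g.contDiffOn_spray p).contDiffAt (((isOpen_extChartAt_target p).prod isOpen_univ).mem_nhds
      ⟨(extChartAt 𝓘(ℝ, E) p).map_source hp, mem_univ _⟩)).of_le (by norm_cast)
  obtain ⟨K, S, hS, hK⟩ := hsp.exists_lipschitzOnWith
  have hev : ∀ {γ : ℝ → M}, g.IsGeodesicOn γ J → γ t ∈ (extChartAt 𝓘(ℝ, E) p).source →
      S ∈ 𝓝 (extChartAt 𝓘(ℝ, E) p (γ t), deriv (fun r ↦ extChartAt 𝓘(ℝ, E) p (γ r)) t) →
      ∀ᶠ s in 𝓝 t, γ s ∈ (extChartAt 𝓘(ℝ, E) p).source ∧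
        HasDerivAt (fun s ↦ (extChartAt 𝓘(ℝ, E) p (γ s),
          deriv (fun r ↦ extChartAt 𝓘(ℝ, E) p (γ r)) s))
        (g.spray p (extChartAt 𝓘(ℝ, E) p (γ s), deriv (fun r ↦ extChartAt 𝓘(ℝ, E) p (γ r)) s)) s ∧
        (extChartAt 𝓘(ℝ, E) p (γ s), deriv (fun r ↦ extChartAt 𝓘(ℝ, E) p (γ r)) s) ∈ S := by
    intro γ hγ hp hS
    filter_upwards [hJ.mem_nhds ht, (hγ.contMDiffAt hJ ht).continuousAt.eventually
      ((isOpen_extChartAt_source p).mem_nhds hp),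
      (hγ.hasDerivAt_chart hJ ht hp).continuousAt.eventually hS] with s h1 h2 h3
    exact ⟨h2, hγ.hasDerivAt_chart hJ h1 h2, h3⟩
  have hS' : S ∈ 𝓝 (extChartAt 𝓘(ℝ, E) p (σ t), deriv (fun r ↦ extChartAt 𝓘(ℝ, E) p (σ r)) t) := by
    rw [← hz, ← h, hw]; exact hS
  have key := ODE_solution_unique_of_eventually (v := fun _ ↦ g.spray p) (s := fun _ ↦ S) (K := K)
    (Eventually.of_forall fun _ ↦ hK) ((hev hγ hp hS).mono fun _ h ↦ h.2)
    ((hev hσ hpσ hS').mono fun _ h ↦ h.2) (by rw [← hw, ← hz, h])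
  filter_upwards [key, hev hγ hp hS, hev hσ hpσ hS'] with s h1 h2 h3
  exact (extChartAt 𝓘(ℝ, E) p).injOn h2.1 h3.1 (congrArg Prod.fst h1)

/-- Geodesics are determined by their velocity at one time. -/
theorem IsGeodesicOn.eqOn [T2Space M] (hJ : IsOpen J) (hJc : IsPreconnected J)
    (hγ : g.IsGeodesicOn γ J) (hσ : g.IsGeodesicOn σ J) {t₀ : ℝ} (h0 : t₀ ∈ J)
    (h : velocity E γ t₀ = velocity E σ t₀) : EqOn γ σ J := by
  intro t ht
  suffices velocity E γ t₀ = velocity E σ t₀ ↔ velocity E γ t = velocity E σ t from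
    congrArg TotalSpace.proj (this.1 h)
  -- Agreement of the velocities and disagreement of the velocities are both open conditions on the
  -- time, and `J` is connected.
  refine hJc.induction₂ (fun s t ↦ velocity E γ s = velocity E σ s ↔ velocity E γ t = velocity E σ t)
    (fun s hs ↦ ?_) (fun _ _ _ _ _ _ ↦ Iff.trans) (fun _ _ _ _ ↦ Iff.symm) h0 ht
  apply mem_nhdsWithin_of_mem_nhds
  by_cases hv : velocity E γ s = velocity E σ s
  · filter_upwards [(IsGeodesicOn.eventuallyEq hJ hγ hσ hs hv).eventually_nhds] with r hr
    exact iff_of_true hv (Filter.EventuallyEq.velocity_eq hr)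
  · filter_upwards [eventually_velocity_ne (hγ.contMDiffAt hJ hs) (hσ.contMDiffAt hJ hs) hv]
      with r hr using iff_of_false hv hr

omit [FiniteDimensional ℝ E] in
lemma IsGeodesicOn.mono {J' : Set ℝ} (hγ : g.IsGeodesicOn γ J) (h : J' ⊆ J) :
    g.IsGeodesicOn γ J' := ⟨hγ.1.mono h, fun t ht ↦ hγ.2 t (h ht)⟩

/-- Affine reparametrizations of geodesics are geodesics. -/
lemma IsGeodesicOn.comp_affine (hJ : IsOpen J) (hγ : g.IsGeodesicOn γ J) (a b : ℝ) :
    g.IsGeodesicOn (fun s ↦ γ (a * s + b)) ((fun s ↦ a * s + b) ⁻¹' J) := by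
  rw [isGeodesicOn_iff]
  refine ⟨fun t ht ↦ ?_, fun t ht w ↦ ?_⟩
  · have h1 : ContDiff ℝ ∞ (fun s : ℝ ↦ a * s + b) := by fun_prop
    exact ((hγ.contMDiffAt hJ ht).comp t h1.contMDiff.contMDiffAt).contMDiffWithinAt
  · have h1 : deriv (fun s ↦ extChartAt 𝓘(ℝ, E) (γ (a * t + b)) (γ (a * s + b))) = fun t' ↦
        a • deriv (fun s ↦ extChartAt 𝓘(ℝ, E) (γ (a * t + b)) (γ s)) (a * t' + b) := by
      funext t'
      rw [deriv_comp_mul_left a (fun s ↦ extChartAt 𝓘(ℝ, E) (γ (a * t + b)) (γ (s + b))) t',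
        deriv_comp_add_const (f := fun s ↦ extChartAt 𝓘(ℝ, E) (γ (a * t + b)) (γ s))]
    have h2 : deriv (deriv (fun s ↦ extChartAt 𝓘(ℝ, E) (γ (a * t + b)) (γ (a * s + b)))) t =
        (a ^ 2) • deriv (deriv (fun s ↦ extChartAt 𝓘(ℝ, E) (γ (a * t + b)) (γ s))) (a * t + b) := by
      rw [h1, deriv_fun_const_smul_field,
        deriv_comp_mul_left a (fun s ↦ deriv (fun s ↦ extChartAt 𝓘(ℝ, E) (γ (a * t + b)) (γ s))
          (s + b)) t,
        deriv_comp_add_const (f := deriv (fun s ↦ extChartAt 𝓘(ℝ, E) (γ (a * t + b)) (γ s))),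
        smul_smul, sq]
    have := ((isGeodesicOn_iff g).1 hγ).2 _ ht w
    -- The acceleration term and the Christoffel term, quadratic in the velocity, both scale by `a ^
    -- 2`.
    rw [h2, h1, ← christoffelCovector_apply g _ (_, _), christoffelCovector_smul, map_smul,
      smul_apply, smul_apply, ← smul_add, christoffelCovector_apply, this, smul_zero]

end Uniqueness

end PseudoRiemannianMetric

namespace PseudoRiemannianMetric

/-! ### The exponential map and geodesic completeness -/

section Exponential

variable {E : Type*} [NormedAddCommGroup E] [NormedSpace ℝ E] [FiniteDimensional ℝ E]
  {M : Type*} [TopologicalSpace M] [T2Space M] [ChartedSpace E M] [IsManifold 𝓘(ℝ, E) ∞ M]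
  {g : PseudoRiemannianMetric E M}

/-- A family of geodesics through a point, depending smoothly on the initial velocity and
homogeneous in it. -/
lemma exists_geodesic_family (g : PseudoRiemannianMetric E M) (p : M) :
    ∃ (Θ : ℝ → E → E) (ε : ℝ), 0 < ε ∧
      (∀ t ∈ Ioo (-ε) ε, ContDiffOn ℝ ∞ (Θ t) (Metric.ball 0 ε)) ∧
      (∀ t ∈ Ioo (-ε) ε, Θ t 0 = extChartAt 𝓘(ℝ, E) p p) ∧
      (∀ v ∈ Metric.ball (0 : E) ε, HasDerivAt (fun t ↦ Θ t v) v 0) ∧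
      (∀ t ∈ Ioo (-ε) ε, ∀ v ∈ Metric.ball (0 : E) ε, ∀ a : ℝ, |a| ≤ 1 → Θ t (a • v) = Θ (a * t) v) ∧
      ∀ v ∈ Metric.ball (0 : E) ε,
        g.IsGeodesicOn (fun t ↦ (extChartAt 𝓘(ℝ, E) p).symm (Θ t v)) (Ioo (-ε) ε) ∧
        (extChartAt 𝓘(ℝ, E) p).symm (Θ 0 v) = p := by
  have : CompleteSpace E := FiniteDimensional.complete ℝ E
  set y₀ := extChartAt 𝓘(ℝ, E) p p with hy₀
  -- The spray is integrated near the zero vector at `p`, an equilibrium, so small initial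
  -- velocities share a common time interval.
  obtain ⟨ψ, ε, hε, h1, h2, h3⟩ := exists_contDiffOn_local_flow_of_isOpen
    ((isOpen_extChartAt_target p).prod isOpen_univ) (g.contDiffOn_spray p)
    (x₀ := (y₀, (0 : E))) ⟨mem_extChartAt_target p, mem_univ _⟩
  have hmem : ∀ v ∈ Metric.ball (0 : E) ε, (y₀, v) ∈ Metric.ball (y₀, (0 : E)) ε := by
    intro v hv
    rw [← ball_prod_same]
    exact ⟨Metric.mem_ball_self hε, hv⟩
  have h0 : (0 : ℝ) ∈ Ioo (-ε) ε := ⟨by linarith, hε⟩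
  have hopen : IsOpen (Ioo (-ε) ε ×ˢ Metric.ball (y₀, (0 : E)) ε) :=
    isOpen_Ioo.prod Metric.isOpen_ball
  have hψ : ∀ t ∈ Ioo (-ε) ε, ∀ v ∈ Metric.ball (0 : E) ε, ContDiffAt ℝ ∞ ψ (t, (y₀, v)) :=
    fun t ht v hv ↦ h1.contDiffAt (hopen.mem_nhds ⟨ht, hmem v hv⟩)
  have hgeo : ∀ v ∈ Metric.ball (0 : E) ε,
      g.IsGeodesicOn (fun t ↦ (extChartAt 𝓘(ℝ, E) p).symm (ψ (t, (y₀, v))).1) (Ioo (-ε) ε) ∧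
      ∀ t ∈ Ioo (-ε) ε, tangentCoord p (velocity E
        (fun s ↦ (extChartAt 𝓘(ℝ, E) p).symm (ψ (s, (y₀, v))).1) t) = ψ (t, (y₀, v)) := by
    intro v hv
    refine isGeodesicOn_of_hasDerivAt isOpen_Ioo (fun t ht ↦ ?_) fun t ht ↦ ?_
    · exact (ContDiffAt.comp (g := ψ) t (hψ t ht v hv)
        (contDiffAt_id.prodMk contDiffAt_const)).contDiffWithinAt
    · exact ⟨(h3 t ht _ (hmem v hv)).1.1, (h3 t ht _ (hmem v hv)).2⟩
  have hscale : ∀ t ∈ Ioo (-ε) ε, ∀ v ∈ Metric.ball (0 : E) ε, ∀ a : ℝ, |a| ≤ 1 →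
      a • v ∈ Metric.ball (0 : E) ε ∧ a * t ∈ Ioo (-ε) ε := by
    intro t ht v hv a ha
    rw [mem_ball_zero_iff] at hv ⊢
    constructor
    · rw [norm_smul, Real.norm_eq_abs]
      nlinarith [norm_nonneg v, abs_nonneg a]
    · have : |a * t| < ε := by rw [abs_mul]; nlinarith [abs_nonneg t, abs_lt.2 ht, abs_nonneg a]
      exact abs_lt.1 this
  -- The geodesic with initial velocity `v`, run at speed `a`, has initial velocity `a • v`;
  -- uniqueness identifies the two. The bound `|a| ≤ 1` keeps both in the domain.
  have hhom : ∀ t ∈ Ioo (-ε) ε, ∀ v ∈ Metric.ball (0 : E) ε, ∀ a : ℝ, |a| ≤ 1 →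
      (ψ (t, (y₀, a • v))).1 = (ψ (a * t, (y₀, v))).1 := by
    intro t ht v hv a ha
    obtain ⟨hav, hat⟩ := hscale t ht v hv a ha
    refine (extChartAt 𝓘(ℝ, E) p).symm.injOn (h3 t ht _ (hmem _ hav)).1.1
      (h3 _ hat _ (hmem v hv)).1.1 ?_
    have hg2 := ((hgeo v hv).1.comp_affine isOpen_Ioo a 0).mono
      (J' := Ioo (-ε) ε) fun s hs ↦ by
        simpa using (hscale s hs v hv a ha).2
    have h00 : ψ (a * 0 + 0, (y₀, v)) = (y₀, v) := by
      rw [mul_zero, zero_add, h2 _ (hmem v hv)]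
    have hpsrc : (extChartAt 𝓘(ℝ, E) p).symm y₀ ∈ (extChartAt 𝓘(ℝ, E) p).source :=
      (extChartAt 𝓘(ℝ, E) p).map_target (mem_extChartAt_target p)
    have := IsGeodesicOn.eqOn isOpen_Ioo isPreconnected_Ioo (hgeo _ hav).1 hg2 h0 ?_ ht
    · simpa using this
    · refine eq_of_tangentCoord_eq (p := p) ?_ ?_ ?_
      · change (extChartAt 𝓘(ℝ, E) p).symm (ψ (0, (y₀, a • v))).1 ∈ _
        rw [h2 _ (hmem _ hav)]; exact hpsrc
      · change (extChartAt 𝓘(ℝ, E) p).symm (ψ (a * 0 + 0, (y₀, v))).1 ∈ _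
        rw [h00]; exact hpsrc
      · have hm := (hgeo v hv).1.mdifferentiableAt isOpen_Ioo
          (t := a * 0 + 0) (by simpa using h0)
        have hv' := (hgeo v hv).2 (a * 0 + 0) (by simpa using h0)
        rw [h00] at hv'
        rw [(hgeo _ hav).2 0 h0, h2 _ (hmem _ hav), velocity_comp_affine hm]
        refine Prod.ext (congrArg Prod.fst hv').symm ?_
        refine Eq.trans ?_ (ContinuousLinearMap.map_smul (chartDeriv p _) a _).symm
        exact congrArg (a • ·) (congrArg Prod.snd hv').symm
  refine ⟨fun t v ↦ (ψ (t, (y₀, v))).1, ε, hε, fun t ht v hv ↦ ?_, fun t ht ↦ ?_, fun v hv ↦ ?_,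
    hhom, fun v hv ↦ ⟨(hgeo v hv).1, ?_⟩⟩
  · exact (ContDiffAt.comp (g := ψ) v (hψ t ht v hv)
        (contDiffAt_const.prodMk (contDiffAt_const.prodMk contDiffAt_id))).fst.contDiffWithinAt
  · have := hhom t ht 0 (Metric.mem_ball_self hε) 0 (by simp)
    rw [zero_smul, zero_mul, h2 _ (hmem _ (Metric.mem_ball_self hε))] at this
    exact this
  · have := (ContinuousLinearMap.fst ℝ E E).hasFDerivAt.comp_hasDerivAt (0 : ℝ)
      (h3 0 h0 _ (hmem v hv)).2
    rw [h2 _ (hmem v hv)] at this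
    exact this
  · change (extChartAt 𝓘(ℝ, E) p).symm (ψ (0, (y₀, v))).1 = p
    rw [h2 _ (hmem v hv)]; exact extChartAt_to_inv p

/-- Every point near `x` lies on a complete geodesic through `x`. -/
lemma IsGeodesicallyComplete.eventually_exists_geodesic (hg : g.IsGeodesicallyComplete) (x : M) :
    ∀ᶠ y in 𝓝 x, ∃ σ : ℝ → M, g.IsGeodesicOn σ univ ∧ σ 0 = x ∧ ∃ s, σ s = y := by
  have : CompleteSpace E := FiniteDimensional.complete ℝ E
  obtain ⟨Θ, ε, hε, h1, h2, h3, h4, h6⟩ := g.exists_geodesic_family x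
  have h0 : (0 : ℝ) ∈ Ioo (-ε) ε := ⟨by linarith, hε⟩
  have hτ : ε / 2 ∈ Ioo (-ε) ε := ⟨by linarith, by linarith⟩
  have hb : Metric.ball (0 : E) ε ∈ 𝓝 (0 : E) := Metric.ball_mem_nhds 0 hε
  have hC : ContDiffAt ℝ ∞ (Θ (ε / 2)) 0 := (h1 _ hτ).contDiffAt hb
  -- `Θ (ε / 2)` plays the role of the exponential map, at a time inside the common interval.
  -- Homogeneity turns its derivative at 0 in direction `v` into a time derivative at 0, which is
  -- `(ε / 2) • v`.
  have hL1 : ∀ v ∈ Metric.ball (0 : E) ε, fderiv ℝ (Θ (ε / 2)) 0 v = (ε / 2) • v := by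
    intro v hv
    have e1 : HasDerivAt (fun a : ℝ ↦ Θ (ε / 2) (a • v)) (fderiv ℝ (Θ (ε / 2)) 0 v) 0 := by
      have hd := (hC.differentiableAt (by simp)).hasFDerivAt
      have hl : HasDerivAt (fun a : ℝ ↦ a • v) v 0 := by
        simpa using (hasDerivAt_id (0 : ℝ)).smul_const v
      exact HasFDerivAt.comp_hasDerivAt (0 : ℝ) (by rw [zero_smul]; exact hd) hl
    have e2 : HasDerivAt (fun a : ℝ ↦ Θ (a * (ε / 2)) v) ((ε / 2) • v) 0 := by
      have hl : HasDerivAt (fun a : ℝ ↦ a * (ε / 2)) (ε / 2) 0 := by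
        simpa using (hasDerivAt_id (0 : ℝ)).mul_const (ε / 2)
      exact HasDerivAt.scomp (0 : ℝ) (by rw [zero_mul]; exact h3 v hv) hl
    refine (e1.congr_of_eventuallyEq ?_).unique e2
    filter_upwards [Metric.ball_mem_nhds (0 : ℝ) one_pos] with a ha
    rw [mem_ball_zero_iff] at ha
    exact (h4 _ hτ v hv a ha.le).symm
  have hL : ∀ v, fderiv ℝ (Θ (ε / 2)) 0 v = (ε / 2) • v := by
    intro v
    have hc : (0 : ℝ) < ε / (‖v‖ + 1) := by positivity
    have hm : (ε / (‖v‖ + 1)) • v ∈ Metric.ball (0 : E) ε := by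
      rw [mem_ball_zero_iff, norm_smul, Real.norm_of_nonneg hc.le, div_mul_eq_mul_div,
        div_lt_iff₀ (by positivity)]
      nlinarith
    have := hL1 _ hm
    rw [map_smul, smul_comm] at this
    exact smul_right_injective E hc.ne' this
  -- The strict derivative at 0 is a nonzero multiple of the identity, so small vectors reach every
  -- point near `x`.
  have hmap : map (Θ (ε / 2)) (𝓝 0) = 𝓝 (extChartAt 𝓘(ℝ, E) x x) := by
    rw [← h2 _ hτ]
    refine (hC.hasStrictFDerivAt (by simp)).map_nhds_eq_of_surj ?_
    refine LinearMap.range_eq_top.2 fun w ↦ ⟨(ε / 2)⁻¹ • w, ?_⟩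
    refine (hL _).trans ?_
    rw [smul_smul, mul_inv_cancel₀ (by positivity), one_smul]
  have hev : ∀ᶠ z in 𝓝 (extChartAt 𝓘(ℝ, E) x x), ∃ v ∈ Metric.ball (0 : E) ε, Θ (ε / 2) v = z := by
    rw [← hmap, eventually_map]
    filter_upwards [hb] with v hv using ⟨v, hv, rfl⟩
  filter_upwards [(contMDiffAt_chart (mem_extChartAt_source (I := 𝓘(ℝ, E)) x)).continuousAt.eventually
    hev, extChartAt_source_mem_nhds (I := 𝓘(ℝ, E)) x] with y ⟨v, hv, hvy⟩ hy
  obtain ⟨hgeo, hx⟩ := h6 v hv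
  obtain ⟨σ, hσ, hσ0⟩ := hg ((extChartAt 𝓘(ℝ, E) x).symm (Θ 0 v)) 
    (velocity E (fun t ↦ (extChartAt 𝓘(ℝ, E) x).symm (Θ t v)) 0).2
  refine ⟨σ, hσ, (congrArg TotalSpace.proj hσ0).trans hx, ε / 2, ?_⟩
  rw [IsGeodesicOn.eqOn isOpen_Ioo isPreconnected_Ioo (hσ.mono (subset_univ _)) hgeo h0 hσ0 hτ]
  change (extChartAt 𝓘(ℝ, E) x).symm (Θ (ε / 2) v) = y
  rw [hvy, (extChartAt 𝓘(ℝ, E) x).left_inv hy]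

/-- In a geodesically complete manifold, every geodesic on an interval extends to all times. -/
lemma IsGeodesicallyComplete.exists_extension (hg : g.IsGeodesicallyComplete) {γ : ℝ → M}
    {J : Set ℝ} (hJ : IsOpen J) (hJc : IsPreconnected J) (hJn : J.Nonempty)
    (hγ : g.IsGeodesicOn γ J) : ∃ σ : ℝ → M, g.IsGeodesicOn σ univ ∧ EqOn γ σ J := by
  obtain ⟨t₀, ht₀⟩ := hJn
  obtain ⟨σ, hσ, hσ0⟩ := hg (γ t₀) (velocity E γ t₀).2
  have h1 := hσ.comp_affine isOpen_univ 1 (-t₀)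
  refine ⟨_, h1, IsGeodesicOn.eqOn hJ hJc hγ (h1.mono (subset_univ _)) ht₀ ?_⟩
  rw [velocity_comp_affine (hσ.mdifferentiableAt isOpen_univ (mem_univ _)), one_smul,
    show 1 * t₀ + -t₀ = 0 by ring]
  exact hσ0.symm

lemma IsMaximalGeodesic.eq_univ {γ : ℝ → M} {J : Set ℝ} (hγ : g.IsMaximalGeodesic γ J)
    (hg : g.IsGeodesicallyComplete) : J = univ := by
  obtain ⟨σ, hσ, hEq⟩ := hg.exists_extension hγ.isOpen hγ.ordConnected.isPreconnected hγ.nonempty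
    hγ.isGeodesicOn
  exact (hγ.maximal σ univ isOpen_univ ordConnected_univ (subset_univ _) hσ hEq).symm

omit [FiniteDimensional ℝ E] [T2Space M] in
lemma IsGeodesicOn.isMaximalGeodesic {γ : ℝ → M} (hγ : g.IsGeodesicOn γ univ) :
    g.IsMaximalGeodesic γ univ :=
  ⟨isOpen_univ, ordConnected_univ, univ_nonempty, hγ, fun _ _ _ _ h _ _ ↦ univ_subset_iff.1 h⟩

end Exponential

end PseudoRiemannianMetric

namespace PseudoRiemannianMetric

/-! ### Flows and their generating fields in charts -/

section VelocityFields

variable {E : Type*} [NormedAddCommGroup E] [NormedSpace ℝ E]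
  {M : Type*} [TopologicalSpace M] [ChartedSpace E M]
  {F : Type*} [NormedAddCommGroup F] [NormedSpace ℝ F]
  {N : Type*} [TopologicalSpace N] [ChartedSpace F N]

lemma velocity_comp {f : N → M} {c : ℝ → N} {t : ℝ}
    (hf : MDifferentiableAt 𝓘(ℝ, F) 𝓘(ℝ, E) f (c t))
    (hc : MDifferentiableAt 𝓘(ℝ, ℝ) 𝓘(ℝ, F) c t) :
    velocity E (fun s ↦ f (c s)) t =
      ⟨f (c t), mfderiv 𝓘(ℝ, F) 𝓘(ℝ, E) f (c t) (velocity F c t).2⟩ := by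
  refine TotalSpace.ext rfl (heq_of_eq ?_)
  change mfderiv 𝓘(ℝ, ℝ) 𝓘(ℝ, E) (f ∘ c) t (1 : ℝ) = _
  rw [(hf.hasMFDerivAt.comp t hc.hasMFDerivAt).mfderiv]
  rfl

lemma hasMFDerivAt_of_velocity_eq {X : (x : N) → TangentSpace 𝓘(ℝ, F) x} {c : ℝ → N} {t : ℝ}
    (hc : MDifferentiableAt 𝓘(ℝ, ℝ) 𝓘(ℝ, F) c t) (h : velocity F c t = ⟨c t, X (c t)⟩) :
    HasMFDerivAt 𝓘(ℝ, ℝ) 𝓘(ℝ, F) c t ((1 : ℝ →L[ℝ] ℝ).smulRight (X (c t))) := by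
  have h2 : mfderiv 𝓘(ℝ, ℝ) 𝓘(ℝ, F) c t (1 : ℝ) = X (c t) := by
    have := TotalSpace.mk_inj.1 h
    exact this
  refine hc.hasMFDerivAt.congr_mfderiv (ContinuousLinearMap.ext fun (r : ℝ) ↦ ?_)
  have := (mfderiv 𝓘(ℝ, ℝ) 𝓘(ℝ, F) c t).map_smul r (1 : ℝ)
  rw [h2] at this
  refine Eq.trans ?_ this
  congr 1
  exact (mul_one r).symm

lemma _root_.HasMFDerivAt.velocity_eq {c : ℝ → N} {t : ℝ} {v : TangentSpace 𝓘(ℝ, F) (c t)}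
    (h : HasMFDerivAt 𝓘(ℝ, ℝ) 𝓘(ℝ, F) c t ((1 : ℝ →L[ℝ] ℝ).smulRight v)) :
    velocity F c t = ⟨c t, v⟩ := by
  refine TotalSpace.ext rfl (heq_of_eq ?_)
  change mfderiv 𝓘(ℝ, ℝ) 𝓘(ℝ, F) c t (1 : ℝ) = _
  rw [h.mfderiv]
  exact one_smul ℝ v

variable [IsManifold 𝓘(ℝ, F) ∞ N] {X : (x : N) → TangentSpace 𝓘(ℝ, F) x}

omit [IsManifold 𝓘(ℝ, F) ∞ N] in
lemma coordField_chart {p x : N} (hx : x ∈ (extChartAt 𝓘(ℝ, F) p).source) :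
    coordField X p (extChartAt 𝓘(ℝ, F) p x) = chartDeriv p x (X x) := by
  rw [coordField, (extChartAt 𝓘(ℝ, F) p).left_inv hx]

variable {ψ : ℝ → N → N} {x p : N}

/-- Here and in the lemmas that follow, `ψ` is only assumed smooth at `(0, x)` and no group law is
required. They thus apply both to one-parameter groups on `M` and to the partial flow `flowMap` on
`N`. -/
lemma contDiffAt_localRep_flow
    (hψ : ContMDiffAt (𝓘(ℝ, ℝ).prod 𝓘(ℝ, F)) 𝓘(ℝ, F) ∞ (fun w : ℝ × N ↦ ψ w.1 w.2) (0, x))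
    (h0 : ψ 0 x = x) (hp : x ∈ (extChartAt 𝓘(ℝ, F) p).source) :
    ContDiffAt ℝ ∞ (fun w : ℝ × F ↦ localRep F (ψ w.1) p p w.2) (0, extChartAt 𝓘(ℝ, F) p x) := by
  have a1 : ContMDiffAt 𝓘(ℝ, ℝ × F) (𝓘(ℝ, ℝ).prod 𝓘(ℝ, F)) ∞
      (fun w : ℝ × F ↦ (w.1, (extChartAt 𝓘(ℝ, F) p).symm w.2)) (0, extChartAt 𝓘(ℝ, F) p x) := by
    apply ContMDiffAt.prodMk
    · exact contDiffAt_fst.contMDiffAt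
    · exact ContMDiffAt.comp (g := (extChartAt 𝓘(ℝ, F) p).symm) (0, extChartAt 𝓘(ℝ, F) p x)
        (contMDiffAt_chart_symm ((extChartAt 𝓘(ℝ, F) p).map_source hp))
        contDiffAt_snd.contMDiffAt
  have hinv := (extChartAt 𝓘(ℝ, F) p).left_inv hp
  have a2 := ContMDiffAt.comp (g := fun w : ℝ × N ↦ ψ w.1 w.2) (0, extChartAt 𝓘(ℝ, F) p x)
    (by simp only [hinv]; exact hψ) a1
  have a3 := ContMDiffAt.comp (g := extChartAt 𝓘(ℝ, F) p) (0, extChartAt 𝓘(ℝ, F) p x)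
    (contMDiffAt_chart (by simp only [Function.comp_apply, hinv, h0]; exact hp)) a2
  exact (contMDiffAt_iff_contDiffAt.1 a3)

lemma hasDerivAt_localRep_flow {z : F} (hz : z ∈ (extChartAt 𝓘(ℝ, F) p).target)
    (hd : MDifferentiableAt 𝓘(ℝ, ℝ) 𝓘(ℝ, F) (fun τ ↦ ψ τ ((extChartAt 𝓘(ℝ, F) p).symm z)) 0)
    (hv : velocity F (fun τ ↦ ψ τ ((extChartAt 𝓘(ℝ, F) p).symm z)) 0 =
      ⟨(extChartAt 𝓘(ℝ, F) p).symm z, X ((extChartAt 𝓘(ℝ, F) p).symm z)⟩) :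
    localRep F (ψ 0) p p z = z ∧
      HasDerivAt (fun τ ↦ localRep F (ψ τ) p p z) (coordField X p z) 0 := by
  have h0 : ψ 0 ((extChartAt 𝓘(ℝ, F) p).symm z) = (extChartAt 𝓘(ℝ, F) p).symm z :=
    congrArg TotalSpace.proj hv
  have hs := (extChartAt 𝓘(ℝ, F) p).map_target hz
  refine ⟨by rw [localRep, h0, (extChartAt 𝓘(ℝ, F) p).right_inv hz], ?_⟩
  have := hasDerivAt_chart_velocity (p := p) hd (by rw [h0]; exact hs)
  rw [hv] at this
  exact this

lemma eventually_contMDiffAt_slice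
    (hψ : ContMDiffAt (𝓘(ℝ, ℝ).prod 𝓘(ℝ, F)) 𝓘(ℝ, F) ∞ (fun w : ℝ × N ↦ ψ w.1 w.2) (0, x)) :
    ∀ᶠ w in 𝓝 ((0 : ℝ), x), ContMDiffAt 𝓘(ℝ, ℝ) 𝓘(ℝ, F) 1 (fun τ ↦ ψ τ w.2) w.1 ∧
      ContMDiffAt 𝓘(ℝ, F) 𝓘(ℝ, F) 1 (ψ w.1) w.2 := by
  have : IsManifold 𝓘(ℝ, F) 1 N := .of_le (n := ∞) (by norm_cast)
  have h1 := (contMDiffAt_iff_contMDiffAt_nhds (n := 1) (by simp)).1 (hψ.of_le (by norm_cast))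
  filter_upwards [h1] with w hw
  constructor
  · exact ContMDiffAt.comp (g := fun w : ℝ × N ↦ ψ w.1 w.2) (f := fun τ : ℝ ↦ (τ, w.2)) w.1 hw
      (contMDiffAt_id.prodMk contMDiffAt_const)
  · exact ContMDiffAt.comp (g := fun w : ℝ × N ↦ ψ w.1 w.2) (f := fun z : N ↦ (w.1, z)) w.2 hw
      (contMDiffAt_const.prodMk contMDiffAt_id)

lemma eventually_hasDerivAt_localRep_flow
    (hψ : ContMDiffAt (𝓘(ℝ, ℝ).prod 𝓘(ℝ, F)) 𝓘(ℝ, F) ∞ (fun w : ℝ × N ↦ ψ w.1 w.2) (0, x))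
    (hX : ∀ᶠ z in 𝓝 x, velocity F (fun τ ↦ ψ τ z) 0 = ⟨z, X z⟩)
    (hp : x ∈ (extChartAt 𝓘(ℝ, F) p).source) :
    ∀ᶠ z in 𝓝 (extChartAt 𝓘(ℝ, F) p x), localRep F (ψ 0) p p z = z ∧
      HasDerivAt (fun τ ↦ localRep F (ψ τ) p p z) (coordField X p z) 0 := by
  have hc : ContinuousAt (fun z : N ↦ ((0 : ℝ), z)) x := by fun_prop
  filter_upwards [eventually_chart_symm hp ((hc.eventually
    (eventually_contMDiffAt_slice hψ)).and hX)] with z hz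
  exact hasDerivAt_localRep_flow hz.1 (hz.2.1.1.mdifferentiableAt one_ne_zero) hz.2.2

/-- The coordinate field is the time derivative at 0 of a smooth map of time and position. -/
lemma contDiffAt_coordField_of_flow
    (hψ : ContMDiffAt (𝓘(ℝ, ℝ).prod 𝓘(ℝ, F)) 𝓘(ℝ, F) ∞ (fun w : ℝ × N ↦ ψ w.1 w.2) (0, x))
    (hX : ∀ᶠ z in 𝓝 x, velocity F (fun τ ↦ ψ τ z) 0 = ⟨z, X z⟩)
    (hp : x ∈ (extChartAt 𝓘(ℝ, F) p).source) :
    ContDiffAt ℝ ∞ (coordField X p) (extChartAt 𝓘(ℝ, F) p x) := by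
  have h1 := contDiffAt_localRep_flow hψ (congrArg TotalSpace.proj hX.self_of_nhds) hp
  have h2 : ContDiffAt ℝ ∞ (fun z ↦ fderiv ℝ (fun w : ℝ × F ↦ localRep F (ψ w.1) p p w.2)
      (0, z) (1, 0)) (extChartAt 𝓘(ℝ, F) p x) :=
    (ContDiffAt.comp (g := fderiv ℝ (fun w : ℝ × F ↦ localRep F (ψ w.1) p p w.2)) _
      (h1.fderiv_right (m := ∞) (by simp)) (contDiffAt_const.prodMk contDiffAt_id)).clm_apply
      contDiffAt_const
  refine h2.congr_of_eventuallyEq ?_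
  have hc : ContinuousAt (fun z : F ↦ ((0 : ℝ), z)) (extChartAt 𝓘(ℝ, F) p x) := by fun_prop
  filter_upwards [eventually_hasDerivAt_localRep_flow hψ hX hp,
    hc.eventually ((h1.of_le (m := 1) (by norm_cast)).eventually (by simp))] with z hz hd
  have e : HasDerivAt (fun τ ↦ localRep F (ψ τ) p p z) _ 0 :=
    HasFDerivAt.comp_hasDerivAt (l := fun w : ℝ × F ↦ localRep F (ψ w.1) p p w.2)
    (f := fun τ : ℝ ↦ (τ, z)) (0 : ℝ)
    (hd.differentiableAt one_ne_zero).hasFDerivAt ((hasDerivAt_id 0).prodMk (hasDerivAt_const 0 z))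
  exact hz.2.unique e

/-- The derivative at time `0` of the metric pulled back along a flow is its Lie derivative. -/
lemma hasDerivAt_inner_flow [FiniteDimensional ℝ F]
    (h : PseudoRiemannianMetric F N)
    (hψ : ContMDiffAt (𝓘(ℝ, ℝ).prod 𝓘(ℝ, F)) 𝓘(ℝ, F) ∞ (fun w : ℝ × N ↦ ψ w.1 w.2) (0, x))
    (hX : ∀ᶠ z in 𝓝 x, velocity F (fun τ ↦ ψ τ z) 0 = ⟨z, X z⟩)
    (hp : x ∈ (extChartAt 𝓘(ℝ, F) p).source) (u v : TangentSpace 𝓘(ℝ, F) x) :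
    HasDerivAt (fun τ ↦ h.inner (ψ τ x) (mfderiv 𝓘(ℝ, F) 𝓘(ℝ, F) (ψ τ) x u)
        (mfderiv 𝓘(ℝ, F) 𝓘(ℝ, F) (ψ τ) x v))
      (lieForm (h.chartForm p) (coordField X p) (extChartAt 𝓘(ℝ, F) p x) (chartDeriv p x u)
        (chartDeriv p x v)) 0 := by
  have h0 : ψ 0 x = x := congrArg TotalSpace.proj hX.self_of_nhds
  have hev := eventually_hasDerivAt_localRep_flow hψ hX hp
  have key := hasDerivAt_pullback_of_flow (G := h.chartForm p)
    (Φ := fun w ↦ localRep F (ψ w.1) p p w.2) (ξ := coordField X p)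
    (h.differentiableAt_chartForm ((extChartAt 𝓘(ℝ, F) p).map_source hp))
    ((contDiffAt_localRep_flow hψ h0 hp).of_le (by norm_cast)) (hev.mono fun _ h ↦ h.1)
    (hev.mono fun _ h ↦ h.2) (chartDeriv p x u) (chartDeriv p x v)
  refine key.congr_of_eventuallyEq ?_
  have hc : ContinuousAt (fun τ : ℝ ↦ (τ, x)) 0 := by fun_prop
  have hc2 : ContinuousAt (fun τ : ℝ ↦ ψ τ x) 0 :=
    ((hc.eventually (p := fun w : ℝ × N ↦ ContMDiffAt 𝓘(ℝ, ℝ) 𝓘(ℝ, F) 1 (fun τ ↦ ψ τ w.2) w.1 ∧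
      ContMDiffAt 𝓘(ℝ, F) 𝓘(ℝ, F) 1 (ψ w.1) w.2)
      (eventually_contMDiffAt_slice hψ)).self_of_nhds.1).continuousAt
  have hsrc : ∀ᶠ τ in 𝓝 (0 : ℝ), ψ τ x ∈ (extChartAt 𝓘(ℝ, F) p).source :=
    hc2.eventually (p := fun z ↦ z ∈ (extChartAt 𝓘(ℝ, F) p).source)
      (by beta_reduce; rw [h0]; exact (isOpen_extChartAt_source p).mem_nhds hp)
  obtain ⟨y, hy, rfl⟩ : ∃ y ∈ (extChartAt 𝓘(ℝ, F) p).target, (extChartAt 𝓘(ℝ, F) p).symm y = x :=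
    ⟨_, (extChartAt 𝓘(ℝ, F) p).map_source hp, (extChartAt 𝓘(ℝ, F) p).left_inv hp⟩
  filter_upwards [hsrc, hc.eventually (p := fun w : ℝ × N ↦
      ContMDiffAt 𝓘(ℝ, ℝ) 𝓘(ℝ, F) 1 (fun τ ↦ ψ τ w.2) w.1 ∧
      ContMDiffAt 𝓘(ℝ, F) 𝓘(ℝ, F) 1 (ψ w.1) w.2) (eventually_contMDiffAt_slice hψ)] with τ h1 h2
  rw [(extChartAt 𝓘(ℝ, F) p).right_inv hy, h.inner_eq_chartForm h1]
  have hf : ∀ w, fderiv ℝ (localRep F (ψ τ) p p) y (chartDeriv p _ w) =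
      chartDeriv p _ (mfderiv 𝓘(ℝ, F) 𝓘(ℝ, F) (ψ τ) ((extChartAt 𝓘(ℝ, F) p).symm y) w) := by
    intro w
    have e1 := (h2.2.mdifferentiableAt one_ne_zero).hasMFDerivAt.comp y
      (mdifferentiableAt_chart_symm hy).hasMFDerivAt
    have e2 := (mdifferentiableAt_chart h1).hasMFDerivAt.comp y e1
    have e3 : HasFDerivAt (localRep F (ψ τ) p p) ((chartDeriv p _).comp
        ((mfderiv 𝓘(ℝ, F) 𝓘(ℝ, F) (ψ τ) _).comp (chartSymmDeriv p y))) y :=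
      hasMFDerivAt_iff_hasFDerivAt.1 e2
    rw [e3.fderiv]
    change chartDeriv p _ (mfderiv 𝓘(ℝ, F) 𝓘(ℝ, F) (ψ τ) _ (chartSymmDeriv p y _)) = _
    rw [chartSymmDeriv_chartDeriv hy]
  change _ = h.chartForm p (localRep F (ψ τ) p p y) (fderiv ℝ (localRep F (ψ τ) p p) y _)
    (fderiv ℝ (localRep F (ψ τ) p p) y _)
  rw [hf, hf]
  rfl

end VelocityFields

end PseudoRiemannianMetric

namespace PseudoRiemannianMetric

/-! ### Killing fields and their tangential components -/

section Killing

variable {E : Type*} [NormedAddCommGroup E] [NormedSpace ℝ E]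
  {M : Type*} [TopologicalSpace M] [ChartedSpace E M] [IsManifold 𝓘(ℝ, E) ∞ M]
  {g : PseudoRiemannianMetric E M}

/-- A smooth vector field along which the Lie derivative of the metric vanishes. -/
structure IsKillingField (g : PseudoRiemannianMetric E M) (X : (x : M) → TangentSpace 𝓘(ℝ, E) x) :
    Prop where
  contMDiff : ContMDiff 𝓘(ℝ, E) 𝓘(ℝ, E).tangent ∞ fun x ↦ (⟨x, X x⟩ : TangentBundle 𝓘(ℝ, E) M)
  lieForm_eq_zero (p : M) (u v : E) :
    lieForm (g.chartForm p) (coordField X p) (extChartAt 𝓘(ℝ, E) p p) u v = 0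

/-- The infinitesimal generator of a one-parameter group of transformations. -/
def generator (φ : ℝ → M → M) (x : M) : TangentSpace 𝓘(ℝ, E) x :=
  (velocity E (fun τ ↦ φ τ x) 0).2

variable {φ : ℝ → M → M}

lemma IsOneParameterIsometryGroup.contMDiffAt_orbit (hφ : g.IsOneParameterIsometryGroup φ) (t : ℝ)
    (x : M) : ContMDiffAt 𝓘(ℝ, ℝ) 𝓘(ℝ, E) ∞ (fun τ ↦ φ τ x) t :=
  ContMDiffAt.comp (g := fun w : ℝ × M ↦ φ w.1 w.2) (f := fun τ : ℝ ↦ (τ, x)) t (hφ.contMDiff _)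
    (contMDiffAt_id.prodMk contMDiffAt_const)

lemma IsOneParameterIsometryGroup.velocity_zero (hφ : g.IsOneParameterIsometryGroup φ) (x : M) :
    velocity E (fun τ ↦ φ τ x) 0 = ⟨x, generator φ x⟩ :=
  TotalSpace.ext (hφ.map_zero x) HEq.rfl

/-- By the group law, the orbit of `x` near time `t` is the orbit of `φ t x` near time 0. -/
lemma IsOneParameterIsometryGroup.velocity_orbit (hφ : g.IsOneParameterIsometryGroup φ) (t : ℝ)
    (x : M) : velocity E (fun τ ↦ φ τ x) t = ⟨φ t x, generator φ (φ t x)⟩ := by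
  have h1 : (fun τ ↦ φ τ x) = fun τ ↦ φ (1 * τ + -t) (φ t x) := by
    funext τ
    rw [← hφ.map_add]
    congr 1
    ring
  have h2 := (hφ.contMDiffAt_orbit (1 * t + -t) (φ t x)).mdifferentiableAt (by simp)
  rw [h1, velocity_comp_affine (γ := fun τ ↦ φ τ (φ t x)) h2, one_smul]
  rw [show 1 * t + -t = 0 by ring]
  exact hφ.velocity_zero (φ t x)

lemma IsOneParameterIsometryGroup.contDiffAt_coordField (hφ : g.IsOneParameterIsometryGroup φ)
    (p : M) : ContDiffAt ℝ ∞ (coordField (generator φ) p) (extChartAt 𝓘(ℝ, E) p p) :=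
  contDiffAt_coordField_of_flow (hφ.contMDiff _) (Eventually.of_forall hφ.velocity_zero)
    (mem_extChartAt_source p)

lemma chartDeriv_surjective (p : M) : Function.Surjective (chartDeriv (E := E) p p) := by
  intro v
  have h1 := chartDeriv_chartSymmDeriv (mem_extChartAt_target (I := 𝓘(ℝ, E)) p) v
  rw [extChartAt_to_inv] at h1
  exact ⟨_, h1⟩

lemma IsOneParameterIsometryGroup.isKillingField [FiniteDimensional ℝ E]
    (hφ : g.IsOneParameterIsometryGroup φ) : g.IsKillingField (generator φ) where
  contMDiff := contMDiff_of_contDiffAt_coordField hφ.contDiffAt_coordField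
  lieForm_eq_zero p u v := by
    obtain ⟨u, rfl⟩ := chartDeriv_surjective p u
    obtain ⟨v, rfl⟩ := chartDeriv_surjective p v
    have h1 := g.hasDerivAt_inner_flow (ψ := φ) (X := generator φ) (hφ.contMDiff (0, p))
      (Eventually.of_forall hφ.velocity_zero) (mem_extChartAt_source p) u v
    simp only [hφ.isometry] at h1
    exact h1.unique (hasDerivAt_const _ _)

variable {F : Type*} [NormedAddCommGroup F] [NormedSpace ℝ F] [FiniteDimensional ℝ F]
  {N : Type*} [TopologicalSpace N] [ChartedSpace F N] [IsManifold 𝓘(ℝ, F) ∞ N]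
  {h : PseudoRiemannianMetric F N} {f : N → M}

/-- The covector g(Ξ, df ·) is represented by a vector because `h` is nondegenerate. This is the
orthogonal projection of Ξ to the tangent space of `N`. -/
lemma exists_tangential (g : PseudoRiemannianMetric E M) (h : PseudoRiemannianMetric F N) (f : N → M)
    (Ξ : (x : M) → TangentSpace 𝓘(ℝ, E) x) (x : N) : ∃ v : TangentSpace 𝓘(ℝ, F) x, ∀ z,
      h.inner x v z = g.inner (f x) (Ξ (f x)) (mfderiv 𝓘(ℝ, F) 𝓘(ℝ, E) f x z) := by
  obtain ⟨v, hv⟩ := surjective_of_nondegenerate (F := F) (B := h.inner x) (h.nondegenerate x)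
    (ContinuousLinearMap.comp (M₁ := F) (M₂ := E) (M₃ := ℝ) (g.inner (f x) (Ξ (f x)))
      (mfderiv 𝓘(ℝ, F) 𝓘(ℝ, E) f x))
  exact ⟨v, fun z ↦ DFunLike.congr_fun hv z⟩

/-- The tangential component, along an immersion `f`, of a vector field on the ambient manifold. -/
def tangentialField (g : PseudoRiemannianMetric E M) (h : PseudoRiemannianMetric F N) (f : N → M)
    (Ξ : (x : M) → TangentSpace 𝓘(ℝ, E) x) (x : N) : TangentSpace 𝓘(ℝ, F) x :=
  (exists_tangential g h f Ξ x).choose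

lemma inner_tangentialField (Ξ : (x : M) → TangentSpace 𝓘(ℝ, E) x) (x : N)
    (z : TangentSpace 𝓘(ℝ, F) x) : h.inner x (tangentialField g h f Ξ x) z =
      g.inner (f x) (Ξ (f x)) (mfderiv 𝓘(ℝ, F) 𝓘(ℝ, E) f x z) :=
  (exists_tangential g h f Ξ x).choose_spec z

lemma eventually_chartForm_tangentialField (hf : ContMDiff 𝓘(ℝ, F) 𝓘(ℝ, E) ∞ f)
    (Ξ : (x : M) → TangentSpace 𝓘(ℝ, E) x) (p : N) :
    ∀ᶠ y in 𝓝 (extChartAt 𝓘(ℝ, F) p p), ∀ z,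
      h.chartForm p y (coordField (tangentialField g h f Ξ) p y) z =
        g.chartForm (f p) (localRep E f p (f p) y)
          (coordField Ξ (f p) (localRep E f p (f p) y)) (fderiv ℝ (localRep E f p (f p)) y z) := by
  have hc : ∀ᶠ x in 𝓝 p, f x ∈ (extChartAt 𝓘(ℝ, E) (f p)).source :=
    (hf p).continuousAt.eventually (extChartAt_source_mem_nhds (f p))
  filter_upwards [eventually_chart_symm (mem_extChartAt_source p) hc] with y ⟨hy, hy2⟩ z
  rw [h.chartForm_apply, chartSymmDeriv_coordField hy, inner_tangentialField,
    g.inner_eq_chartForm hy2, fderiv_localRep hy (hf _) hy2]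
  congr 2
  exact (coordField_chart hy2).symm

/-- In a chart the tangential field is the inverse Gram form of `h` applied to a covector that
depends smoothly on the point. -/
lemma contDiffAt_coordField_tangentialField [FiniteDimensional ℝ E]
    (hf : ContMDiff 𝓘(ℝ, F) 𝓘(ℝ, E) ∞ f)
    {Ξ : (x : M) → TangentSpace 𝓘(ℝ, E) x}
    (hΞ : ContMDiff 𝓘(ℝ, E) 𝓘(ℝ, E).tangent ∞ fun x ↦ (⟨x, Ξ x⟩ : TangentBundle 𝓘(ℝ, E) M)) (p : N) :
    ContDiffAt ℝ ∞ (coordField (tangentialField g h f Ξ) p) (extChartAt 𝓘(ℝ, F) p p) := by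
  have hyt : extChartAt 𝓘(ℝ, F) p p ∈ (extChartAt 𝓘(ℝ, F) p).target := mem_extChartAt_target p
  have h0 : localRep E f p (f p) (extChartAt 𝓘(ℝ, F) p p) ∈ (extChartAt 𝓘(ℝ, E) (f p)).target := by
    rw [localRep, extChartAt_to_inv]; exact mem_extChartAt_target _
  have hφ : ContDiffAt ℝ ∞ (localRep E f p (f p)) (extChartAt 𝓘(ℝ, F) p p) :=
    contDiffAt_localRep hyt (hf _) (by rw [extChartAt_to_inv]; exact mem_extChartAt_source _)
  have hG : ContDiffAt ℝ ∞ (fun y ↦ g.chartForm (f p) (localRep E f p (f p) y))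
      (extChartAt 𝓘(ℝ, F) p p) :=
    ContDiffAt.comp (g := g.chartForm (f p)) _ (g.contDiffAt_chartForm h0) hφ
  have hξ : ContDiffAt ℝ ∞ (fun y ↦ coordField Ξ (f p) (localRep E f p (f p) y))
      (extChartAt 𝓘(ℝ, F) p p) :=
    ContDiffAt.comp (g := coordField Ξ (f p)) _ ((contDiffOn_coordField (f p) hΞ).contDiffAt
      ((isOpen_extChartAt_target (f p)).mem_nhds h0)) hφ
  have hα : ContDiffAt ℝ ∞ (fun y ↦ (g.chartForm (f p) (localRep E f p (f p) y)
      (coordField Ξ (f p) (localRep E f p (f p) y))).comp (fderiv ℝ (localRep E f p (f p)) y))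
      (extChartAt 𝓘(ℝ, F) p p) :=
    (hG.clm_apply hξ).clm_comp (hφ.fderiv_right (m := ∞) (by simp))
  refine ((h.contDiffAt_inverse_chartForm hyt).clm_apply hα).congr_of_eventuallyEq ?_
  filter_upwards [eventually_chartForm_tangentialField (g := g) (h := h) hf Ξ p,
    (isOpen_extChartAt_target p).mem_nhds hyt] with y hy hy2
  obtain ⟨L, hL⟩ := isInvertible_of_nondegenerate (h.chartForm_nondegenerate hy2)
  have : CompleteSpace F := FiniteDimensional.complete ℝ F
  have e1 : h.chartForm p y (coordField (tangentialField g h f Ξ) p y) =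
      (g.chartForm (f p) (localRep E f p (f p) y)
        (coordField Ξ (f p) (localRep E f p (f p) y))).comp (fderiv ℝ (localRep E f p (f p)) y) :=
    ContinuousLinearMap.ext hy
  rw [← e1, ← hL, ContinuousLinearMap.inverse_equiv]
  exact (L.symm_apply_apply _).symm

/-- The tangential component of a Killing field along a totally geodesic submanifold is a Killing
field. -/
theorem IsKillingField.tangentialField [FiniteDimensional ℝ E] {Ξ : (x : M) → TangentSpace 𝓘(ℝ, E) x}
    (hΞ : g.IsKillingField Ξ) (hf : g.IsSubmanifold h f) (hg : g.IsTotallyGeodesic (F := F) f) :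
    h.IsKillingField (tangentialField g h f Ξ) where
  contMDiff := contMDiff_of_contDiffAt_coordField
    (contDiffAt_coordField_tangentialField hf.isImmersion.contMDiff hΞ.contMDiff)
  lieForm_eq_zero p u v := by
    have hfs := hf.isImmersion.contMDiff
    have hyt : extChartAt 𝓘(ℝ, F) p p ∈ (extChartAt 𝓘(ℝ, F) p).target := mem_extChartAt_target p
    have he : localRep E f p (f p) (extChartAt 𝓘(ℝ, F) p p) = extChartAt 𝓘(ℝ, E) (f p) (f p) := by
      rw [localRep, extChartAt_to_inv]
    have h0 : localRep E f p (f p) (extChartAt 𝓘(ℝ, F) p p) ∈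
        (extChartAt 𝓘(ℝ, E) (f p)).target := by
      rw [he]; exact mem_extChartAt_target _
    have hφ : ContDiffAt ℝ ∞ (localRep E f p (f p)) (extChartAt 𝓘(ℝ, F) p p) :=
      contDiffAt_localRep hyt (hfs _) (by rw [extChartAt_to_inv]; exact mem_extChartAt_source _)
    exact lieForm_eq_zero_of_pullback (G := g.chartForm (f p)) (ξ := coordField Ξ (f p))
      (φ := localRep E f p (f p)) (h.differentiableAt_chartForm hyt)
      (Eventually.of_forall fun y ↦ h.chartForm_symm p y) (g.differentiableAt_chartForm h0)
      (Eventually.of_forall fun y ↦ g.chartForm_symm (f p) y) (hφ.of_le (by norm_cast))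
      ((hf.isPullbackNear p).eventually_chartForm (mem_extChartAt_source p)
        (mem_extChartAt_source _))
      ((contDiffAt_coordField_tangentialField hfs hΞ.contMDiff p).differentiableAt (by simp))
      (((contDiffOn_coordField (f p) hΞ.contMDiff).contDiffAt
        ((isOpen_extChartAt_target (f p)).mem_nhds h0)).differentiableAt (by simp))
      (eventually_chartForm_tangentialField hfs Ξ p) (hg.chart hfs p)
      (fun u v ↦ by rw [he]; exact hΞ.lieForm_eq_zero (f p) u v) u v

/-- A curve in a submanifold that is mapped to an orbit of a one-parameter group is an integral curve
of the tangential component of its generator. -/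
lemma isMIntegralCurve_tangentialField (hφ : g.IsOneParameterIsometryGroup φ)
    (hf : g.IsSubmanifold h f) {c : ℝ → N} (hc : ContMDiff 𝓘(ℝ, ℝ) 𝓘(ℝ, F) ∞ c)
    (horb : ∀ t, f (c t) = φ t (f (c 0))) :
    IsMIntegralCurve c (tangentialField g h f (generator φ)) := by
  intro t
  have hcd : MDifferentiableAt 𝓘(ℝ, ℝ) 𝓘(ℝ, F) c t := (hc t).mdifferentiableAt (by simp)
  refine hasMFDerivAt_of_velocity_eq hcd ?_
  refine TotalSpace.ext rfl (heq_of_eq ?_)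
  have h1 := velocity_comp ((hf.isImmersion.contMDiff (c t)).mdifferentiableAt (by simp)) hcd
  have h2 : velocity E (fun s ↦ f (c s)) t = ⟨f (c t), generator φ (f (c t))⟩ := by
    have : (fun s ↦ f (c s)) = fun s ↦ φ s (f (c 0)) := funext horb
    rw [this, hφ.velocity_orbit, ← horb t]
  rw [h1] at h2
  have h3 : mfderiv 𝓘(ℝ, F) 𝓘(ℝ, E) f (c t) (velocity F c t).2 = generator φ (f (c t)) :=
    TotalSpace.mk_inj.1 h2
  -- The velocity and the tangential field have the same `h`-product with every `z`, because `df` of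
  -- the velocity is the generator itself.
  refine (sub_eq_zero (G := F)).1 (h.nondegenerate (c t) _ fun z ↦ ?_)
  have h4 := inner_tangentialField (g := g) (h := h) (f := f) (generator φ) (c t) z
  have h5 := hf.induced (c t) (velocity F c t).2 z
  rw [h3, ← h4] at h5
  have e := (h.inner (c t)).map_sub (velocity F c t).2 
    (tangentialField g h f (generator φ) (c t))
  have e2 := DFunLike.congr_fun e z
  refine e2.trans ?_
  exact sub_eq_zero.2 h5

end Killing

end PseudoRiemannianMetric

/-! ### The group law for germs and differentials of flows -/

section FlowGerms

variable {F : Type*} [NormedAddCommGroup F] [NormedSpace ℝ F] [FiniteDimensional ℝ F]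
  {N : Type*} [TopologicalSpace N] [T2Space N] [ChartedSpace F N] [IsManifold 𝓘(ℝ, F) ∞ N]
  {X : (x : N) → TangentSpace 𝓘(ℝ, F) x}

lemma contMDiffAt_flowMap
    (hX : ContMDiff 𝓘(ℝ, F) 𝓘(ℝ, F).tangent ∞ fun x ↦ (⟨x, X x⟩ : TangentBundle 𝓘(ℝ, F) N))
    {t : ℝ} {x : N} (h : (t, x) ∈ flowDomain X) :
    ContMDiffAt 𝓘(ℝ, F) 𝓘(ℝ, F) ∞ (flowMap X t) x :=
  ContMDiffAt.comp (g := fun w : ℝ × N ↦ flowMap X w.1 w.2) (f := fun z : N ↦ (t, z)) x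
    (eventually_flowMap hX h).self_of_nhds.2 (contMDiffAt_const.prodMk contMDiffAt_id)

lemma isOpen_flowDomain
    (hX : ContMDiff 𝓘(ℝ, F) 𝓘(ℝ, F).tangent ∞ fun x ↦ (⟨x, X x⟩ : TangentBundle 𝓘(ℝ, F) N)) :
    IsOpen (flowDomain X) :=
  isOpen_iff_mem_nhds.2 fun _ hw ↦ (eventually_flowMap hX hw).mono fun _ h ↦ h.1

lemma zero_mem_flowDomain
    (hX : ContMDiff 𝓘(ℝ, F) 𝓘(ℝ, F).tangent ∞ fun x ↦ (⟨x, X x⟩ : TangentBundle 𝓘(ℝ, F) N))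
    (x : N) : (0, x) ∈ flowDomain X :=
  (eventually_flowMap_zero hX x).self_of_nhds.1

omit [FiniteDimensional ℝ F] in
lemma velocity_flowMap
    (hX : ContMDiff 𝓘(ℝ, F) 𝓘(ℝ, F).tangent ∞ fun x ↦ (⟨x, X x⟩ : TangentBundle 𝓘(ℝ, F) N))
    {t : ℝ} {x : N} (h : (t, x) ∈ flowDomain X) :
    velocity F (fun s ↦ flowMap X s x) t = ⟨flowMap X t x, X (flowMap X t x)⟩ :=
  (hasMFDerivAt_flowMap hX h).velocity_eq

lemma velocity_flowMap_zero
    (hX : ContMDiff 𝓘(ℝ, F) 𝓘(ℝ, F).tangent ∞ fun x ↦ (⟨x, X x⟩ : TangentBundle 𝓘(ℝ, F) N))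
    (x : N) : velocity F (fun s ↦ flowMap X s x) 0 = ⟨x, X x⟩ := by
  rw [velocity_flowMap hX (zero_mem_flowDomain hX x), flowMap_zero hX (zero_mem_flowDomain hX x)]

/-- Since the flow domain is open, for small `τ` the group law holds on a whole neighbourhood of
`x`, so it may be differentiated in space. -/
lemma eventually_flowMap_add
    (hX : ContMDiff 𝓘(ℝ, F) 𝓘(ℝ, F).tangent ∞ fun x ↦ (⟨x, X x⟩ : TangentBundle 𝓘(ℝ, F) N))
    {s : ℝ} {x : N} (h : (s, x) ∈ flowDomain X) :
    ∀ᶠ τ in 𝓝 (0 : ℝ), (τ, flowMap X s x) ∈ flowDomain X ∧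
      flowMap X (τ + s) =ᶠ[𝓝 x] fun z ↦ flowMap X τ (flowMap X s z) := by
  have hc : ContinuousAt (fun w : ℝ × N ↦ (w.1, flowMap X s w.2)) (0, x) := by
    have : ContinuousAt (fun w : ℝ × N ↦ flowMap X s w.2) (0, x) :=
      ContinuousAt.comp (g := flowMap X s) (contMDiffAt_flowMap hX h).continuousAt continuousAt_snd
    exact continuousAt_fst.prodMk this
  have h1 : ∀ᶠ w in 𝓝 ((0 : ℝ), x), (w.1, flowMap X s w.2) ∈ flowDomain X :=
    hc.eventually ((isOpen_flowDomain hX).mem_nhds (zero_mem_flowDomain hX _))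
  have hc2 : ContinuousAt (fun w : ℝ × N ↦ (s, w.2)) (0, x) := by fun_prop
  have h2 : ∀ᶠ w in 𝓝 ((0 : ℝ), x), (s, w.2) ∈ flowDomain X :=
    hc2.eventually ((isOpen_flowDomain hX).mem_nhds h)
  have h3 := (h1.and h2).curry_nhds
  filter_upwards [h3] with τ hτ
  exact ⟨hτ.self_of_nhds.1, hτ.mono fun z hz ↦ (flowMap_add hX hz.2 hz.1).2⟩

/-- This is the chain rule for the group law, stated in the tangent bundle because the two base
points are not definitionally equal. -/
lemma mfderiv_flowMap_add
    (hX : ContMDiff 𝓘(ℝ, F) 𝓘(ℝ, F).tangent ∞ fun x ↦ (⟨x, X x⟩ : TangentBundle 𝓘(ℝ, F) N))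
    {s : ℝ} {x : N} (h : (s, x) ∈ flowDomain X) :
    ∀ᶠ τ in 𝓝 (0 : ℝ), (τ, flowMap X s x) ∈ flowDomain X ∧ ∀ u : TangentSpace 𝓘(ℝ, F) x,
      (⟨flowMap X (τ + s) x, mfderiv 𝓘(ℝ, F) 𝓘(ℝ, F) (flowMap X (τ + s)) x u⟩ :
        TangentBundle 𝓘(ℝ, F) N) = ⟨flowMap X τ (flowMap X s x),
          mfderiv 𝓘(ℝ, F) 𝓘(ℝ, F) (flowMap X τ) (flowMap X s x)
            (mfderiv 𝓘(ℝ, F) 𝓘(ℝ, F) (flowMap X s) x u)⟩ := by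
  filter_upwards [eventually_flowMap_add hX h] with τ hτ
  refine ⟨hτ.1, fun u ↦ TotalSpace.ext hτ.2.self_of_nhds (heq_of_eq ?_)⟩
  have h1 := ((contMDiffAt_flowMap hX hτ.1).mdifferentiableAt (by simp)).hasMFDerivAt.comp x
    ((contMDiffAt_flowMap hX h).mdifferentiableAt (by simp)).hasMFDerivAt
  have h2 : (mfderiv 𝓘(ℝ, F) 𝓘(ℝ, F) (flowMap X (τ + s)) x : F → F) =
      mfderiv 𝓘(ℝ, F) 𝓘(ℝ, F) (fun z ↦ flowMap X τ (flowMap X s z)) x :=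
    congrArg (DFunLike.coe (F := F →L[ℝ] F)) hτ.2.mfderiv_eq
  have h3 : (mfderiv 𝓘(ℝ, F) 𝓘(ℝ, F) (fun z ↦ flowMap X τ (flowMap X s z)) x : F → F) u =
      mfderiv 𝓘(ℝ, F) 𝓘(ℝ, F) (flowMap X τ) (flowMap X s x)
            (mfderiv 𝓘(ℝ, F) 𝓘(ℝ, F) (flowMap X s) x u) :=
    congrArg (fun L : F →L[ℝ] F ↦ L u) h1.mfderiv
  exact (congrFun h2 u).trans h3

lemma mfderiv_flowMap_zero
    (hX : ContMDiff 𝓘(ℝ, F) 𝓘(ℝ, F).tangent ∞ fun x ↦ (⟨x, X x⟩ : TangentBundle 𝓘(ℝ, F) N))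
    (x : N) (u : TangentSpace 𝓘(ℝ, F) x) :
    (⟨flowMap X 0 x, mfderiv 𝓘(ℝ, F) 𝓘(ℝ, F) (flowMap X 0) x u⟩ : TangentBundle 𝓘(ℝ, F) N) =
      ⟨x, u⟩ := by
  have h : flowMap X 0 = id := funext fun z ↦ flowMap_zero hX (zero_mem_flowDomain hX z)
  rw [h, mfderiv_id]
  rfl

/-- The points through which there is an integral curve defined for all times. -/
def completeSet (X : (x : N) → TangentSpace 𝓘(ℝ, F) x) : Set N :=
  {x | ∀ t, (t, x) ∈ flowDomain X}

omit [FiniteDimensional ℝ F] in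
lemma isMIntegralCurve_flowMap
    (hX : ContMDiff 𝓘(ℝ, F) 𝓘(ℝ, F).tangent ∞ fun x ↦ (⟨x, X x⟩ : TangentBundle 𝓘(ℝ, F) N))
    {x : N} (hx : x ∈ completeSet X) : IsMIntegralCurve (fun t ↦ flowMap X t x) X :=
  fun t ↦ hasMFDerivAt_flowMap hX (hx t)

omit [FiniteDimensional ℝ F] in
lemma IsMIntegralCurve.mem_completeSet
    (hX : ContMDiff 𝓘(ℝ, F) 𝓘(ℝ, F).tangent ∞ fun x ↦ (⟨x, X x⟩ : TangentBundle 𝓘(ℝ, F) N))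
    {c : ℝ → N} (hc : IsMIntegralCurve c X) (t : ℝ) : c t ∈ completeSet X := by
  intro s
  have := (flowMap_eq_of_isMIntegralCurve hX (hc.comp_add t) s).1
  simpa using this

end FlowGerms

namespace PseudoRiemannianMetric

/-! ### Isometric flows of Killing fields and their completeness -/

section KillingFlow

variable {F : Type*} [NormedAddCommGroup F] [NormedSpace ℝ F] [FiniteDimensional ℝ F]
  {N : Type*} [TopologicalSpace N] [T2Space N] [ChartedSpace F N] [IsManifold 𝓘(ℝ, F) ∞ N]
  {h : PseudoRiemannianMetric F N} {X : (x : N) → TangentSpace 𝓘(ℝ, F) x}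

omit [FiniteDimensional ℝ F] [T2Space N] in
lemma inner_congr (h : PseudoRiemannianMetric F N) {x y : N} {u v : TangentSpace 𝓘(ℝ, F) x}
    {u' v' : TangentSpace 𝓘(ℝ, F) y} (hu : (⟨x, u⟩ : TangentBundle 𝓘(ℝ, F) N) = ⟨y, u'⟩)
    (hv : (⟨x, v⟩ : TangentBundle 𝓘(ℝ, F) N) = ⟨y, v'⟩) : h.inner x u v = h.inner y u' v' := by
  obtain rfl : x = y := congrArg TotalSpace.proj hu
  rw [TotalSpace.mk_inj.1 hu, TotalSpace.mk_inj.1 hv]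

/-- The local flow of a Killing field is isometric. -/
theorem IsKillingField.inner_flowMap (hX : h.IsKillingField X) {t : ℝ} {x : N}
    (ht : (t, x) ∈ flowDomain X) (u v : TangentSpace 𝓘(ℝ, F) x) :
    h.inner (flowMap X t x) (mfderiv 𝓘(ℝ, F) 𝓘(ℝ, F) (flowMap X t) x u)
      (mfderiv 𝓘(ℝ, F) 𝓘(ℝ, F) (flowMap X t) x v) = h.inner x u v := by
  obtain ⟨c, a, b, h0, htab, hc, hci⟩ := ht
  have hD : ∀ s ∈ Ioo a b, (s, x) ∈ flowDomain X := fun s hs ↦ ⟨c, a, b, h0, hs, hc, hci⟩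
  let β : ℝ → ℝ := fun s ↦ h.inner (flowMap X s x) (mfderiv 𝓘(ℝ, F) 𝓘(ℝ, F) (flowMap X s) x u)
      (mfderiv 𝓘(ℝ, F) 𝓘(ℝ, F) (flowMap X s) x v)
  -- The group law moves the derivative at time `s` to time 0 at the point `flowMap X s x`, where it
  -- is the vanishing Lie derivative.
  have hβ : ∀ s ∈ Ioo a b, HasDerivAt β 0 s := by
    intro s hs
    have h1 := h.hasDerivAt_inner_flow (ψ := flowMap X) (X := X) (x := flowMap X s x)
      (p := flowMap X s x) (eventually_flowMap_zero hX.contMDiff _).self_of_nhds.2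
      (Eventually.of_forall (velocity_flowMap_zero hX.contMDiff)) (mem_extChartAt_source _)
      (mfderiv 𝓘(ℝ, F) 𝓘(ℝ, F) (flowMap X s) x u) (mfderiv 𝓘(ℝ, F) 𝓘(ℝ, F) (flowMap X s) x v)
    rw [hX.lieForm_eq_zero] at h1
    have h2 : HasDerivAt (fun τ ↦ β (τ + s)) 0 0 := by
      refine h1.congr_of_eventuallyEq ?_
      filter_upwards [mfderiv_flowMap_add hX.contMDiff (hD s hs)] with τ hτ
      exact h.inner_congr (hτ.2 u) (hτ.2 v)
    have h3 := HasDerivAt.comp_sub_const (f := fun τ ↦ β (τ + s)) s s (by rwa [sub_self])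
    simpa using h3
  have h4 : β t = β 0 := by
    refine (convex_Ioo a b).is_const_of_fderivWithin_eq_zero (𝕜 := ℝ)
      (fun s hs ↦ (hβ s hs).differentiableAt.differentiableWithinAt) (fun s hs ↦ ?_) htab h0
    rw [fderivWithin_of_isOpen isOpen_Ioo hs]
    ext
    simpa using (hβ s hs).deriv
  exact h4.trans (h.inner_congr (mfderiv_flowMap_zero hX.contMDiff x u)
    (mfderiv_flowMap_zero hX.contMDiff x v))

lemma IsKillingField.isPullbackNear_flowMap (hX : h.IsKillingField X) {t : ℝ} {x : N}
    (ht : (t, x) ∈ flowDomain X) : IsPullbackNear h h (flowMap X t) x := by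
  have hc : ContinuousAt (fun z : N ↦ (t, z)) x := by fun_prop
  filter_upwards [hc.eventually ((isOpen_flowDomain hX.contMDiff).mem_nhds ht)] with z hz
  exact ⟨contMDiffAt_flowMap hX.contMDiff hz, fun u v ↦ (hX.inner_flowMap hz u v).symm⟩

/-- On a geodesically complete manifold, completeness of integral curves of a Killing field
propagates along geodesics. -/
lemma IsKillingField.mem_completeSet_of_geodesic (hX : h.IsKillingField X)
    (hN : h.IsGeodesicallyComplete) {σ : ℝ → N} (hσ : h.IsGeodesicOn σ univ) {r : ℝ}
    (hr : σ r ∈ completeSet X) (s : ℝ) : σ s ∈ completeSet X := by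
  -- `C t` is the velocity of σ at `r` transported by the flow, defined for all `t` because the
  -- integral curve through `σ r` is complete. The geodesic `Y t` with velocity `C t` at `r` stands
  -- in for the image of σ under the flow, before that flow is known to exist along σ.
  let C : ℝ → TangentBundle 𝓘(ℝ, F) N := fun t ↦
    ⟨flowMap X t (σ r), mfderiv 𝓘(ℝ, F) 𝓘(ℝ, F) (flowMap X t) (σ r) (velocity F σ r).2⟩
  have hext : ∀ t, ∃ y : ℝ → N, h.IsGeodesicOn y univ ∧ velocity F y r = C t := by
    intro t
    obtain ⟨y, hy, hy0⟩ := hN (C t).1 (C t).2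
    have h1 := hy.comp_affine isOpen_univ 1 (-r)
    refine ⟨_, h1, ?_⟩
    rw [velocity_comp_affine (hy.mdifferentiableAt isOpen_univ (mem_univ _)), one_smul,
      show 1 * r + -r = 0 by ring]
    exact hy0
  choose Y hY hYv using hext
  have hY0 : Y 0 s = σ s := by
    refine IsGeodesicOn.eqOn isOpen_univ isPreconnected_univ (hY 0) hσ (mem_univ r) ?_ (mem_univ s)
    rw [hYv]
    exact mfderiv_flowMap_zero hX.contMDiff (σ r) _
  have hflow : ∀ t, ∀ᶠ τ in 𝓝 (0 : ℝ), (τ, Y t s) ∈ flowDomain X ∧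
      Y (τ + t) s = flowMap X τ (Y t s) := by
    intro t
    have hcont : Continuous (Y t) :=
      continuous_iff_continuousAt.2 fun q ↦ ((hY t).contMDiffAt isOpen_univ (mem_univ q)).continuousAt
    have hYr : Y t r = flowMap X t (σ r) := congrArg TotalSpace.proj (hYv t)
    obtain ⟨a, b, ha, hb⟩ : ∃ a b : ℝ, r ∈ Ioo a b ∧ s ∈ Ioo a b :=
      ⟨min r s - 1, max r s + 1, ⟨by linarith [min_le_left r s], by linarith [le_max_left r s]⟩,
        by linarith [min_le_right r s], by linarith [le_max_right r s]⟩
    -- Compactness gives one flow time valid along the whole segment of `Y t` between `r` and `s`.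
    -- On it the flow is isometric, so it maps `Y t` to a geodesic with velocity `C (τ + t)` at `r`,
    -- that is, to `Y (τ + t)`.
    have htube : ∀ᶠ τ in 𝓝 (0 : ℝ), ∀ q ∈ Icc a b, (τ, Y t q) ∈ flowDomain X := by
      refine isCompact_Icc.eventually_forall_of_forall_eventually fun q _ ↦ ?_
      have hc : ContinuousAt (fun w : ℝ × ℝ ↦ (w.1, Y t w.2)) (0, q) := by fun_prop
      exact hc.eventually ((isOpen_flowDomain hX.contMDiff).mem_nhds
        (zero_mem_flowDomain hX.contMDiff _))
    filter_upwards [htube, mfderiv_flowMap_add hX.contMDiff (hr t)] with τ h1 h2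
    refine ⟨h1 s (Ioo_subset_Icc_self hb), ?_⟩
    have hgeo : h.IsGeodesicOn (fun q ↦ flowMap X τ (Y t q)) (Ioo a b) :=
      IsGeodesicOn.map_of_isPullbackNear isOpen_Ioo ((hY t).mono (subset_univ _))
        fun q hq ↦ hX.isPullbackNear_flowMap (h1 q (Ioo_subset_Icc_self hq))
    refine IsGeodesicOn.eqOn isOpen_Ioo isPreconnected_Ioo ((hY (τ + t)).mono (subset_univ _)) hgeo
      ha ?_ hb
    rw [hYv, velocity_comp ((contMDiffAt_flowMap hX.contMDiff
      (h1 r (Ioo_subset_Icc_self ha))).mdifferentiableAt (by simp))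
      ((hY t).mdifferentiableAt isOpen_univ (mem_univ r))]
    refine (h2.2 _).trans ?_
    exact congrArg (fun v : TangentBundle 𝓘(ℝ, F) N ↦ (⟨flowMap X τ v.1,
      mfderiv 𝓘(ℝ, F) 𝓘(ℝ, F) (flowMap X τ) v.1 v.2⟩ : TangentBundle 𝓘(ℝ, F) N)) (hYv t).symm
  -- The local relation with the flow shows that `t ↦ Y t s` is an integral curve on all of ℝ; no
  -- regularity of `Y` in `t` has to be known beforehand.
  have hint : IsMIntegralCurve (fun t ↦ Y t s) X := by
    intro t
    have h1 := hasMFDerivAt_flowMap hX.contMDiff (zero_mem_flowDomain hX.contMDiff (Y t s))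
    have heq : (fun t' ↦ Y t' s) =ᶠ[𝓝 t] fun t' ↦ flowMap X (1 * t' + -t) (Y t s) := by
      have hc : ContinuousAt (fun t' : ℝ ↦ t' - t) t := by fun_prop
      rw [ContinuousAt, sub_self] at hc
      filter_upwards [hc.eventually (hflow t)] with t' ht'
      have := ht'.2
      rw [sub_add_cancel] at this
      rw [this, one_mul, sub_eq_add_neg]
    have hmd : MDifferentiableAt 𝓘(ℝ, ℝ) 𝓘(ℝ, F) (fun τ ↦ flowMap X τ (Y t s)) (1 * t + -t) := by
      rw [show 1 * t + -t = 0 by ring]; exact h1.mdifferentiableAt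
    have hmd2 : MDifferentiableAt 𝓘(ℝ, ℝ) 𝓘(ℝ, F) (fun t' ↦ Y t' s) t := by
      have hd : HasDerivAt (fun t' : ℝ ↦ 1 * t' + -t) 1 t := by
        simpa using (hasDerivAt_id t).add_const (-t)
      have hm : MDifferentiableAt 𝓘(ℝ, ℝ) 𝓘(ℝ, F) (fun t' ↦ flowMap X (1 * t' + -t) (Y t s)) t :=
        (hmd.hasMFDerivAt.comp t hd.hasFDerivAt.hasMFDerivAt).mdifferentiableAt
      exact hm.congr_of_eventuallyEq heq
    refine hasMFDerivAt_of_velocity_eq hmd2 ?_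
    rw [heq.velocity_eq, velocity_comp_affine (γ := fun τ ↦ flowMap X τ (Y t s)) hmd, one_smul,
      show 1 * t + -t = 0 by ring]
    exact velocity_flowMap_zero hX.contMDiff (Y t s)
  have := hint.mem_completeSet hX.contMDiff 0
  rwa [hY0] at this

/-- On a geodesically complete manifold, the union of the complete integral curves of a Killing field
is open and closed. -/
lemma IsKillingField.isClopen_completeSet (hX : h.IsKillingField X)
    (hN : h.IsGeodesicallyComplete) : IsClopen (completeSet X) := by
  -- Each point near `x` is joined to `x` by a complete geodesic, so membership in `completeSet X`
  -- is locally constant.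
  have key : ∀ x, ∀ᶠ y in 𝓝 x, y ∈ completeSet X ↔ x ∈ completeSet X := by
    intro x
    filter_upwards [hN.eventually_exists_geodesic x] with y ⟨σ, hσ, h0, s, hs⟩
    rw [← h0, ← hs]
    exact ⟨fun hy ↦ hX.mem_completeSet_of_geodesic hN hσ hy 0,
      fun hy ↦ hX.mem_completeSet_of_geodesic hN hσ hy s⟩
  refine ⟨⟨isOpen_iff_mem_nhds.2 fun x hx ↦ ?_⟩, isOpen_iff_mem_nhds.2 fun x hx ↦ ?_⟩
  · exact (key x).mono fun y hy ↦ fun hy2 ↦ hx (hy.1 hy2)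
  · exact (key x).mono fun y hy ↦ hy.2 hx

open Classical in
/-- The restriction of a vector field to a set, extended by zero. -/
def cutField (A : Set N) (X : (x : N) → TangentSpace 𝓘(ℝ, F) x) (x : N) : TangentSpace 𝓘(ℝ, F) x :=
  if x ∈ A then X x else 0

omit [FiniteDimensional ℝ F] [T2Space N] [IsManifold 𝓘(ℝ, F) ∞ N] in
lemma cutField_of_mem {A : Set N} {x : N} (hx : x ∈ A) : cutField A X x = X x := if_pos hx

omit [FiniteDimensional ℝ F] [T2Space N] [IsManifold 𝓘(ℝ, F) ∞ N] in
lemma cutField_of_notMem {A : Set N} {x : N} (hx : x ∉ A) : cutField A X x = 0 := if_neg hx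

omit [FiniteDimensional ℝ F] [T2Space N] in
set_option synthInstance.maxHeartbeats 200000 in
lemma IsKillingField.cutField (hX : h.IsKillingField X) {A : Set N} (hA : IsClopen A) :
    h.IsKillingField (cutField A X) := by
  have hin : ∀ p ∈ A, coordField (PseudoRiemannianMetric.cutField A X) p
      =ᶠ[𝓝 (extChartAt 𝓘(ℝ, F) p p)] coordField X p := by
    intro p hp
    filter_upwards [eventually_chart_symm (mem_extChartAt_source p) (hA.isOpen.mem_nhds hp)]
      with y hy
    rw [coordField, coordField, cutField_of_mem hy.2]
  have hout : ∀ p ∉ A, coordField (PseudoRiemannianMetric.cutField A X) p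
      =ᶠ[𝓝 (extChartAt 𝓘(ℝ, F) p p)] fun _ ↦ 0 := by
    intro p hp
    filter_upwards [eventually_chart_symm (mem_extChartAt_source p)
      (hA.compl.isOpen.mem_nhds hp)] with y hy
    rw [coordField, cutField_of_notMem hy.2, map_zero]
  refine ⟨contMDiff_of_contDiffAt_coordField fun p ↦ ?_, fun p u v ↦ ?_⟩
  · by_cases hp : p ∈ A
    · exact ((contDiffOn_coordField p hX.contMDiff).contDiffAt ((isOpen_extChartAt_target p).mem_nhds
        (mem_extChartAt_target p))).congr_of_eventuallyEq (hin p hp)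
    · exact contDiffAt_const.congr_of_eventuallyEq (hout p hp)
  · by_cases hp : p ∈ A
    · rw [← hX.lieForm_eq_zero p u v, lieForm, lieForm, (hin p hp).fderiv_eq,
        (hin p hp).self_of_nhds]
    · rw [lieForm, (hout p hp).fderiv_eq, (hout p hp).self_of_nhds]
      simp

lemma IsKillingField.isOneParameterIsometryGroup (hX : h.IsKillingField X)
    (hc : ∀ x, x ∈ completeSet X) : h.IsOneParameterIsometryGroup (flowMap X) where
  contMDiff w := (eventually_flowMap hX.contMDiff (hc w.2 w.1)).self_of_nhds.2
  map_zero x := flowMap_zero hX.contMDiff (hc x 0)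
  map_add s t x := (flowMap_add hX.contMDiff (hc x t) (hc _ s)).2
  isometry t x u v := hX.inner_flowMap (hc x t) u v

/-- The complete integral curves of a Killing field on a geodesically complete manifold are orbits of
a common one-parameter group of isometries. -/
theorem IsKillingField.exists_isOneParameterIsometryGroup (hX : h.IsKillingField X)
    (hN : h.IsGeodesicallyComplete) : ∃ φ : ℝ → N → N, h.IsOneParameterIsometryGroup φ ∧
      ∀ c : ℝ → N, IsMIntegralCurve c X → ∀ t, c t = φ t (c 0) := by
  -- Completeness of `X` is not established off `completeSet X`, so the field is set to zero there.
  -- Clopenness keeps it smooth and Killing.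
  have hK := hX.cutField (hX.isClopen_completeSet hN)
  have hcurve : ∀ c : ℝ → N, IsMIntegralCurve c X →
      IsMIntegralCurve c (PseudoRiemannianMetric.cutField (completeSet X) X) := by
    intro c hc t
    rw [cutField_of_mem (hc.mem_completeSet hX.contMDiff t)]
    exact hc t
  refine ⟨_, hK.isOneParameterIsometryGroup fun x ↦ ?_, fun c hc t ↦
    (flowMap_eq_of_isMIntegralCurve hK.contMDiff (hcurve c hc) t).2.symm⟩
  -- In `completeSet X` the integral curves of `X` never leave the set, so they remain integral
  -- curves of the cut field; elsewhere constant curves serve.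
  by_cases hx : x ∈ completeSet X
  · have := (hcurve _ (isMIntegralCurve_flowMap hX.contMDiff hx)).mem_completeSet hK.contMDiff 0
    rwa [flowMap_zero hX.contMDiff (hx 0)] at this
  · have : IsMIntegralCurve (fun _ : ℝ ↦ x)
        (PseudoRiemannianMetric.cutField (completeSet X) X) := by
      intro t
      rw [cutField_of_notMem hx, ContinuousLinearMap.smulRight_zero]
      exact hasMFDerivAt_const x t
    exact this.mem_completeSet hK.contMDiff 0

end KillingFlow

end PseudoRiemannianMetric

end

theorem theorem5p1
    {E : Type*} [NormedAddCommGroup E] [NormedSpace ℝ E] [FiniteDimensional ℝ E]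
    {M : Type*} [TopologicalSpace M] [T2Space M] [ChartedSpace E M] [IsManifold 𝓘(ℝ, E) ∞ M]
    {F : Type*} [NormedAddCommGroup F] [NormedSpace ℝ F] [FiniteDimensional ℝ F]
    {N : Type*} [TopologicalSpace N] [T2Space N] [ChartedSpace F N] [IsManifold 𝓘(ℝ, F) ∞ N]
    (g : PseudoRiemannianMetric E M) (h : PseudoRiemannianMetric F N) (f : N → M)
    (hM : g.IsGeodesicOrbit)
    (hf : g.IsSubmanifold h f)
    (hgeod : g.IsTotallyGeodesic (F := F) f)
    (hN : h.IsGeodesicallyComplete) :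
    h.IsGeodesicOrbit := by
  intro γ J hγ
  obtain rfl : J = univ := hγ.eq_univ hN
  -- The image geodesic is defined on all of ℝ and is therefore maximal, although `M` is not assumed
  -- complete.
  obtain ⟨φ, hφ, l, hl, hl', hrange, horb⟩ := hM _ univ
    (hγ.isGeodesicOn.map_of_isTotallyGeodesic hf hgeod isOpen_univ).isMaximalGeodesic
  obtain ⟨ψ, hψ, horb'⟩ :=
    (hφ.isKillingField.tangentialField hf hgeod).exists_isOneParameterIsometryGroup hN
  -- It is `γ ∘ l`, not `γ`, that is an integral curve of the tangential field; the same `l` then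
  -- serves on `N`.
  have hc : ContMDiff 𝓘(ℝ, ℝ) 𝓘(ℝ, F) ∞ fun t ↦ γ (l t) :=
    fun t ↦ (hγ.isGeodesicOn.contMDiffAt isOpen_univ (mem_univ _)).comp t hl.contMDiff.contMDiffAt
  exact ⟨ψ, hψ, l, hl, hl', hrange,
    horb' _ (PseudoRiemannianMetric.isMIntegralCurve_tangentialField hφ hf hc horb)⟩
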